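/- Let $G$ be a Lie group of dimension $n$ which is a closed embedded submanifold of a Euclidean space, with identity $e$ and Lie algebra $\mathfrak g=T_eG$. Let $L_g$ denote left translation by $g\in G$. Let $\mathbb I$ be an inner product on $\mathfrak g$, let $\nabla$ be the Levi-Civita connection of the left-invariant Riemannian metric on $G$ induced by $\mathbb I$, and let $\stackrel{\mathfrak g}{\nabla}\colon\mathfrak g\times\mathfrak g\to\mathfrak g$ be its restriction to $\mathfrak g$, i.e. $T_eL_g(\stackrel{\mathfrak g}{\nabla}_v w)=(\nabla_{v^{\mathrm L}}w^{\mathrm L})(g)$ for the left-invariant vector fields $v^{\mathrm L},w^{\mathrm L}$ generated by $v,w\in\mathfrak g$. Let $R$ be an endomorphism of $\mathfrak g$ that is symmetric and positive semidefinite with respect to $\mathbb I$ ($R=0$ is allowed), and let $\psi\colon G\to\mathbb R$ be smooth. Let $T>0$ and let $\boldsymbol u\colon\mathbb R\to\mathbb R^n$ be measurable, bounded, $T$-periodic and zero-mean. Suppose that its zero-mean antiderivative $\boldsymbol U=(U^1,\dots,U^n)$ satisfies $\frac1T\int_0^T U^i(\tau)U^j(\tau)\,\mathrm d\tau=\delta_{ij}$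 for all $i,j$. Let $\alpha\colon\mathbb R\to\mathbb R$ be smooth such that $\alpha\alpha'$ is strictly increasing and attains only positive values. Let $a,\lambda,b,\kappa,h>0$ with $a\lambda-b\kappa>0$. Let $(e_1,\dots,e_n)$ be an $\mathbb I$-orthonormal basis of $\mathfrak g$ and put $\mu:=\sum_{i=1}^n\stackrel{\mathfrak g}{\nabla}_{e_i}e_i$. A vector $\boldsymbol w\in\mathbb R^n$ and the element $w=\sum_i w^ie_i$ of $\mathfrak g$ are denoted by the same letter, bold and light; likewise $\boldsymbol u,u$ and $\boldsymbol U,U$. For $\omega>0$ consider on $M:=G\times\mathfrak g\times\mathbb R^n\times\mathbb R$, an embedded submanifold of Euclidean space with Euclidean norm $|\cdot|$, the closed-loop system $$\begin{aligned} \dot g&=T_eL_g(v),\\ \dot v+\stackrel{\mathfrak g}{\nabla}_v v&=-Rv-b\,\big(w-\kappa\,\alpha(\psi(g)-\eta)\,U(\omega t)\big)+\lambda\,\alpha(\psi(g)-\eta)\,\omega\,u(\omega t)+\lambda^2\,\alpha^2(\psi(g)-\eta)\,\mu,\\ \dot{\boldsymbol w}&=-a\,\big(\boldsymbol w-\kappa\,\alpha(\psi(g)-\eta)\,\boldsymbol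 U(\omega t)\big)+\kappa\,\alpha(\psi(g)-\eta)\,\omega\,\boldsymbol u(\omega t),\\ \dot\eta&=-h\,\eta+h\,\psi(g), \end{aligned}$$ and the change of variables $\phi^\omega_t(g,v,\boldsymbol w,\eta)=\big(g,\;v-\lambda\,\alpha(\psi(g)-\eta)\,U(\omega t),\;\boldsymbol w-\kappa\,\alpha(\psi(g)-\eta)\,\boldsymbol U(\omega t),\;\eta\big)$. Suppose that $\psi$ attains a local minimum at $g_\ast\in G$ and that the Hessian of $\psi$ at $g_\ast$ is positive definite. Then the point $x_\ast:=(g_\ast,0,\boldsymbol 0,\psi(g_\ast))$ of $M$ is locally practically uniformly asymptotically stable for the closed-loop system in the variables $\tilde x=\phi^\omega_t(x)$; that is: 1. for every $\varepsilon>0$ there exist $\omega_0,\delta>0$ such that, for all $\omega\ge\omega_0$, $t_0\in\mathbb R$ and $\tilde x_0\in M$ with $|\tilde x_0-x_\ast|\le\delta$, the maximal solution $x$ of the closed-loop system with $x(t_0)=(\phi^\omega_{t_0})^{-1}(\tilde x_0)$ is unique, exists for all $t\ge t_0$ and satisfies $|\phi^\omega_t(x(t))-x_\ast|\le\varepsilon$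 for all $t\ge t_0$; 2. there is a neighborhood $S$ of $x_\ast$ in $M$ such that for all $r,\varepsilon>0$ there exist $\omega_0,\Delta,\rho>0$ such that, for all $\omega\ge\omega_0$, $t_0\in\mathbb R$ and $\tilde x_0\in S$ with $|\tilde x_0-x_\ast|\le r$, the maximal solution $x$ of the closed-loop system with $x(t_0)=(\phi^\omega_{t_0})^{-1}(\tilde x_0)$ is unique, exists for all $t\ge t_0$ and satisfies $|\phi^\omega_t(x(t))-x_\ast|\le\rho$ for all $t\ge t_0$ and $|\phi^\omega_t(x(t))-x_\ast|\le\varepsilon$ for all $t\ge t_0+\Delta$. -/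

import Mathlib

open scoped Manifold ContDiff Topology

noncomputable section

namespace ExtremumSeeking

/-! ### Practical stability of systems on an embedded manifold -/

section PracticalStability

/-- `x` is a (Caratheodory) solution, on the open interval `J`, of the system `x' = f t x` on a
manifold `X`. Points of `X` and tangent vectors are represented in the ambient space `F` of an
embedding `Φ : X → F`; thus `f t x` is the ambient representative of a tangent vector at `x`. The
equation is required in integrated form, since `f` may be merely measurable in `t`. -/
structure IsSolutionOn {X F : Type*} [NormedAddCommGroup F] [NormedSpace ℝ F]
    (Φ : X → F) (f : ℝ → X → F) (J : Set ℝ) (x : ℝ → X) : Prop where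
  isOpen : IsOpen J
  ordConnected : J.OrdConnected
  intervalIntegrable : ∀ s ∈ J, ∀ t ∈ J,
    IntervalIntegrable (fun τ => f τ (x τ)) MeasureTheory.volume s t
  integral_eq : ∀ s ∈ J, ∀ t ∈ J, Φ (x t) - Φ (x s) = ∫ τ in s..t, f τ (x τ)

/-- `x`, defined on `J`, is a maximal solution with initial condition `x t₀ = x₀`. -/
structure IsMaximalSolution {X F : Type*} [NormedAddCommGroup F] [NormedSpace ℝ F]
    (Φ : X → F) (f : ℝ → X → F) (t₀ : ℝ) (x₀ : X) (J : Set ℝ) (x : ℝ → X) : Prop where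
  isSolutionOn : IsSolutionOn Φ f J x
  mem : t₀ ∈ J
  initial : x t₀ = x₀
  maximal : ∀ (J' : Set ℝ) (x' : ℝ → X), IsSolutionOn Φ f J' x' → J ⊆ J' →
    Set.EqOn x' x J → J' = J

/-- There is a unique maximal solution with initial condition `x t₀ = x₀`, it is defined for all
`t ≥ t₀`, and it satisfies `P` there. -/
def MaximalSolutionSatisfies {X F : Type*} [NormedAddCommGroup F] [NormedSpace ℝ F]
    (Φ : X → F) (f : ℝ → X → F) (t₀ : ℝ) (x₀ : X) (P : (ℝ → X) → Prop) : Prop :=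
  ∃ (J : Set ℝ) (x : ℝ → X), IsMaximalSolution Φ f t₀ x₀ J x ∧
    (∀ (J' : Set ℝ) (x' : ℝ → X), IsMaximalSolution Φ f t₀ x₀ J' x' →
      J' = J ∧ Set.EqOn x' x J) ∧
    Set.Ici t₀ ⊆ J ∧ P x

/-- Practical uniform stability of `xs` for the systems `x' = f Ω t x` (with parameter `Ω > 0`) in
the variables `φ Ω t x`. -/
def PracticallyUniformlyStable {X F : Type*} [NormedAddCommGroup F] [NormedSpace ℝ F]
    (Φ : X → F) (f : ℝ → ℝ → X → F) (φ : ℝ → ℝ → X ≃ X) (xs : X) : Prop :=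
  ∀ ε > 0, ∃ Ω₀ > 0, ∃ δ > 0, ∀ Ω ≥ Ω₀, ∀ (t₀ : ℝ) (x₀ : X), ‖Φ x₀ - Φ xs‖ ≤ δ →
    MaximalSolutionSatisfies Φ (f Ω) t₀ ((φ Ω t₀).symm x₀) fun x =>
      ∀ t ≥ t₀, ‖Φ (φ Ω t (x t)) - Φ xs‖ ≤ ε

/-- `S`-practical uniform attractivity of `xs` for the systems `x' = f Ω t x` in the variables
`φ Ω t x`. -/
def PracticallyUniformlyAttractive {X F : Type*} [NormedAddCommGroup F] [NormedSpace ℝ F]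
    (Φ : X → F) (f : ℝ → ℝ → X → F) (φ : ℝ → ℝ → X ≃ X) (xs : X) (S : Set X) : Prop :=
  ∀ r > 0, ∀ ε > 0, ∃ Ω₀ > 0, ∃ Δ > 0, ∃ ρ > 0, ∀ Ω ≥ Ω₀, ∀ t₀ : ℝ, ∀ x₀ ∈ S,
    ‖Φ x₀ - Φ xs‖ ≤ r →
    MaximalSolutionSatisfies Φ (f Ω) t₀ ((φ Ω t₀).symm x₀) fun x =>
      (∀ t ≥ t₀, ‖Φ (φ Ω t (x t)) - Φ xs‖ ≤ ρ) ∧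
      ∀ t ≥ t₀ + Δ, ‖Φ (φ Ω t (x t)) - Φ xs‖ ≤ ε

/-- Local practical uniform asymptotic stability: practical uniform stability together with
`S`-practical uniform attractivity for some neighborhood `S` of `xs`. -/
def LocallyPracticallyUniformlyAsymptoticallyStable {X F : Type*} [TopologicalSpace X]
    [NormedAddCommGroup F] [NormedSpace ℝ F]
    (Φ : X → F) (f : ℝ → ℝ → X → F) (φ : ℝ → ℝ → X ≃ X) (xs : X) : Prop :=
  PracticallyUniformlyStable Φ f φ xs ∧
    ∃ S ∈ 𝓝 xs, PracticallyUniformlyAttractive Φ f φ xs S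

end PracticalStability

/-! ### The left-invariant Levi-Civita connection of a Lie group -/

/-- An inner product on a real vector space. -/
structure InnerProd (V : Type*) [AddCommGroup V] [Module ℝ V] where
  /-- The underlying bilinear form. -/
  form : LinearMap.BilinForm ℝ V
  symm : ∀ v w, form v w = form w v
  pos : ∀ v, v ≠ 0 → 0 < form v v

theorem InnerProd.nondegenerate {V : Type*} [AddCommGroup V] [Module ℝ V] (B : InnerProd V) :
    B.form.Nondegenerate := by
  constructor
  · intro v hv
    by_contra h
    exact (B.pos v h).ne' (hv v)
  · intro v hv
    by_contra h
    exact (B.pos v h).ne' (hv v)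

section LieGroup

variable {n : ℕ} {G : Type*} [TopologicalSpace G] [ChartedSpace (EuclideanSpace ℝ (Fin n)) G]
  [Group G]

/-- The tangent map `T_e L_g` of the left translation by `g`, from the Lie algebra to `T_g G`. -/
def leftTranslate (g : G) : GroupLieAlgebra (𝓡 n) G →L[ℝ] TangentSpace (𝓡 n) g :=
  mfderiv (𝓡 n) (𝓡 n) (fun x : G => g * x) 1

/-- The inverse of `T_e L_g`. -/
def leftUntranslate (g : G) : TangentSpace (𝓡 n) g →L[ℝ] GroupLieAlgebra (𝓡 n) G :=
  mfderiv (𝓡 n) (𝓡 n) (fun x : G => g⁻¹ * x) g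

/-- `g ↦ T_e L_g v` is the left-invariant vector field generated by `v`. -/
theorem leftTranslate_eq (g : G) (v : GroupLieAlgebra (𝓡 n) G) :
    leftTranslate g v = mulInvariantVectorField v g := rfl

/-- A vector field, read as a function with values in the Lie algebra by left translation. -/
def bodyCoord (σ : (g : G) → TangentSpace (𝓡 n) g) : G → EuclideanSpace ℝ (Fin n) :=
  fun x => leftUntranslate x (σ x)

/-- The derivative of `bodyCoord σ`. -/
def bodyDeriv (σ : (g : G) → TangentSpace (𝓡 n) g) (g : G) :
    TangentSpace (𝓡 n) g →L[ℝ] GroupLieAlgebra (𝓡 n) G :=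
  mvfderiv (𝓡 n) (bodyCoord σ) g

/-- The left-invariant Riemannian metric induced by an inner product on the Lie algebra. -/
def leftMetric (B : InnerProd (GroupLieAlgebra (𝓡 n) G)) (g : G) (X Y : TangentSpace (𝓡 n) g) : ℝ :=
  B.form (leftUntranslate g X) (leftUntranslate g Y)

variable [LieGroup (𝓡 n) ∞ G]

instance lieGroup_minSmoothness : LieGroup (𝓡 n) (minSmoothness ℝ 3) G := by
  rw [minSmoothness_of_isRCLikeNormedField]; infer_instance

instance finiteDimensional_groupLieAlgebra : FiniteDimensional ℝ (GroupLieAlgebra (𝓡 n) G) :=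
  inferInstanceAs (FiniteDimensional ℝ (EuclideanSpace ℝ (Fin n)))

instance finiteDimensional_tangentSpace (g : G) : FiniteDimensional ℝ (TangentSpace (𝓡 n) g) :=
  inferInstanceAs (FiniteDimensional ℝ (EuclideanSpace ℝ (Fin n)))

instance t2Space_tangentSpace (g : G) : T2Space (TangentSpace (𝓡 n) g) :=
  inferInstanceAs (T2Space (EuclideanSpace ℝ (Fin n)))

theorem leftTranslate_leftUntranslate (g : G) (X : TangentSpace (𝓡 n) g) :
    leftTranslate g (leftUntranslate g X) = X := by
  have h1 : HasMFDerivAt (𝓡 n) (𝓡 n) (fun x : G => g⁻¹ * x) g (leftUntranslate g) :=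
    ((contMDiff_mul_left (I := 𝓡 n) (n := ∞)).mdifferentiable (by simp) g).hasMFDerivAt
  have h2 : HasMFDerivAt (𝓡 n) (𝓡 n) (fun x : G => g * x) (g⁻¹ * g) (leftTranslate g) := by
    rw [inv_mul_cancel]
    exact ((contMDiff_mul_left (I := 𝓡 n) (n := ∞)).mdifferentiable (by simp) 1).hasMFDerivAt
  have h3 := HasMFDerivAt.comp g h2 h1
  have h4 : ((fun x : G => g * x) ∘ fun x : G => g⁻¹ * x) = id := by ext x; simp
  rw [h4] at h3
  have h5 := hasMFDerivAt_unique h3 (hasMFDerivAt_id g)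
  exact congrArg (fun L : TangentSpace (𝓡 n) g →L[ℝ] TangentSpace (𝓡 n) g => L X) h5

theorem leftUntranslate_leftTranslate (g : G) (v : GroupLieAlgebra (𝓡 n) G) :
    leftUntranslate g (leftTranslate g v) = v := by
  have h2 : HasMFDerivAt (𝓡 n) (𝓡 n) (fun x : G => g⁻¹ * x) (g * 1) (leftUntranslate g) := by
    rw [mul_one]
    exact ((contMDiff_mul_left (I := 𝓡 n) (n := ∞)).mdifferentiable (by simp) g).hasMFDerivAt
  have h1 : HasMFDerivAt (𝓡 n) (𝓡 n) (fun x : G => g * x) 1 (leftTranslate g) :=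
    ((contMDiff_mul_left (I := 𝓡 n) (n := ∞)).mdifferentiable (by simp) 1).hasMFDerivAt
  have h3 := HasMFDerivAt.comp 1 h2 h1
  have h4 : ((fun x : G => g⁻¹ * x) ∘ fun x : G => g * x) = id := by ext x; simp
  rw [h4] at h3
  have h5 := hasMFDerivAt_unique h3 (hasMFDerivAt_id 1)
  exact congrArg (fun L : TangentSpace (𝓡 n) (1:G) →L[ℝ] TangentSpace (𝓡 n) (1:G) => L v) h5

theorem mdifferentiableAt_bodyCoord {σ : (g : G) → TangentSpace (𝓡 n) g} {g : G}
    (hσ : MDifferentiableAt (𝓡 n) (𝓡 n).tangent (fun x => (⟨x, σ x⟩ : TangentBundle (𝓡 n) G)) g) :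
    MDifferentiableAt (𝓡 n) 𝓘(ℝ, EuclideanSpace ℝ (Fin n)) (bodyCoord σ) g := by
  let P : G × G → G := fun p => p.1⁻¹ * p.2
  have hP : ContMDiff ((𝓡 n).prod (𝓡 n)) (𝓡 n) ∞ P := contMDiff_fst.inv.mul contMDiff_snd
  let F₁ : G → TangentBundle (𝓡 n) G × TangentBundle (𝓡 n) G := fun x => (⟨x, 0⟩, ⟨x, σ x⟩)
  have h0 : MDifferentiable (𝓡 n) (𝓡 n).tangent
      (fun x : G => (⟨x, 0⟩ : TangentBundle (𝓡 n) G)) :=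
    (Bundle.contMDiff_zeroSection (n := 1) ℝ (TangentSpace (𝓡 n) : G → Type _)).mdifferentiable (by simp)
  have h1 : MDifferentiableAt (𝓡 n) ((𝓡 n).tangent.prod (𝓡 n).tangent) F₁ g := (h0 g).prodMk hσ
  have h2 : MDifferentiable ((𝓡 n).tangent.prod (𝓡 n).tangent) ((𝓡 n).prod (𝓡 n)).tangent
    (equivTangentBundleProd (𝓡 n) G (𝓡 n) G).symm :=
    (contMDiff_equivTangentBundleProd_symm (n := 1)).mdifferentiable (by simp)
  have h3 : MDifferentiable ((𝓡 n).prod (𝓡 n)).tangent (𝓡 n).tangent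
    (tangentMap ((𝓡 n).prod (𝓡 n)) (𝓡 n) P) :=
    (ContMDiff.contMDiff_tangentMap (m := 1) hP (by norm_cast)).mdifferentiable (by simp)
  have h4 := (h3 _).comp g ((h2 _).comp g h1)
  have key : ((tangentMap ((𝓡 n).prod (𝓡 n)) (𝓡 n) P) ∘
      (equivTangentBundleProd (𝓡 n) G (𝓡 n) G).symm ∘ F₁) =
      fun x => (⟨1, leftUntranslate x (σ x)⟩ : TangentBundle (𝓡 n) G) := by
    funext x
    have e1 : ∀ (h : G), h = 1 → ∀ w : EuclideanSpace ℝ (Fin n),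
      (⟨h, w⟩ : TangentBundle (𝓡 n) G) = ⟨1, w⟩ := by rintro _ rfl _; rfl
    refine Eq.trans ?_ (e1 _ (inv_mul_cancel x) _)
    simp only [F₁, Function.comp_apply, tangentMap]
    have hp := mfderiv_prod_eq_add_apply (v := (((0 : TangentSpace (𝓡 n) x), σ x) : TangentSpace ((𝓡 n).prod (𝓡 n)) (x, x)))
      (hP.mdifferentiable (by simp) (x, x))
    refine congrArg (Bundle.TotalSpace.mk (F := EuclideanSpace ℝ (Fin n))
      (E := (TangentSpace (𝓡 n) : G → Type _)) (x⁻¹ * x)) (Eq.trans hp ?_)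
    rw [map_zero, zero_add]
    rfl
  rw [key] at h4
  rw [mdifferentiableAt_totalSpace] at h4
  have h5 := h4.2
  refine h5.congr_of_eventuallyEq (Filter.Eventually.of_forall fun x => ?_)
  exact ((tangentBundleCore (𝓡 n) G).coordChange_self _ _ (mem_chart_source _ _) _).symm

variable (B : InnerProd (GroupLieAlgebra (𝓡 n) G))

/-- The Koszul functional on the Lie algebra. -/
def koszulFunctional (v w : GroupLieAlgebra (𝓡 n) G) : Module.Dual ℝ (GroupLieAlgebra (𝓡 n) G) where
  toFun z := (1 / 2 : ℝ) * (B.form ⁅v, w⁆ z - B.form ⁅w, z⁆ v + B.form ⁅z, v⁆ w)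
  map_add' x y := by simp; ring
  map_smul' c x := by simp; ring

/-- The restriction of the Levi-Civita connection to the Lie algebra; see `leviCivita_leftInvariant`
for the defining relation with the Levi-Civita connection of the left-invariant metric. -/
def restrictedConnection : GroupLieAlgebra (𝓡 n) G →ₗ[ℝ] GroupLieAlgebra (𝓡 n) G →ₗ[ℝ] GroupLieAlgebra (𝓡 n) G :=
  LinearMap.mk₂ ℝ (fun v w => (B.form.toDual B.nondegenerate).symm (koszulFunctional B v w))
    (fun v v' w => by rw [← map_add]; congr 1; ext z; simp [koszulFunctional]; ring)
    (fun c v w => by rw [← map_smul]; congr 1; ext z; simp [koszulFunctional]; ring)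
    (fun v w w' => by rw [← map_add]; congr 1; ext z; simp [koszulFunctional]; ring)
    (fun c v w => by rw [← map_smul]; congr 1; ext z; simp [koszulFunctional]; ring)

theorem form_restrictedConnection (v w z : GroupLieAlgebra (𝓡 n) G) :
    B.form (restrictedConnection B v w) z =
      (1 / 2 : ℝ) * (B.form ⁅v, w⁆ z - B.form ⁅w, z⁆ v + B.form ⁅z, v⁆ w) := by
  simp [restrictedConnection, koszulFunctional]

theorem restrictedConnection_torsion (v w : GroupLieAlgebra (𝓡 n) G) :
    restrictedConnection B v w - restrictedConnection B w v = ⁅v, w⁆ := by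
  apply (B.form.toDual B.nondegenerate).injective
  ext z
  simp only [LinearMap.BilinForm.toDual_def, map_sub, LinearMap.sub_apply, form_restrictedConnection]
  rw [← lie_skew v w, ← lie_skew z w, ← lie_skew z v]
  simp only [map_neg, LinearMap.neg_apply]
  ring

theorem restrictedConnection_metric (v w z : GroupLieAlgebra (𝓡 n) G) :
    B.form (restrictedConnection B v w) z + B.form w (restrictedConnection B v z) = 0 := by
  rw [B.symm w, form_restrictedConnection, form_restrictedConnection]
  rw [← lie_skew v w, ← lie_skew z v, ← lie_skew w z]
  simp only [map_neg, LinearMap.neg_apply]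
  ring

/-- Covariant differentiation of vector fields, written in the trivialization of the tangent bundle
by left translations. -/
def covFun (σ : (g : G) → TangentSpace (𝓡 n) g) (g : G) :
    TangentSpace (𝓡 n) g →L[ℝ] TangentSpace (𝓡 n) g :=
  (leftTranslate g).comp (bodyDeriv σ g + LinearMap.toContinuousLinearMap
    ((restrictedConnection B).flip (leftUntranslate g (σ g)) ∘ₗ (leftUntranslate g).toLinearMap))

theorem covFun_apply (σ : (g : G) → TangentSpace (𝓡 n) g) (g : G) (X : TangentSpace (𝓡 n) g) :
    covFun B σ g X = leftTranslate g (bodyDeriv σ g X + restrictedConnection B (leftUntranslate g X) (leftUntranslate g (σ g))) :=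
  rfl

theorem isCovariantDerivativeOn_covFun : IsCovariantDerivativeOn (EuclideanSpace ℝ (Fin n))
    (V := (TangentSpace (𝓡 n) : G → Type _)) (covFun B) Set.univ where
  add {σ σ' g} hσ hσ' _ := by
    ext1 X
    have h : bodyDeriv (σ + σ') g = bodyDeriv σ g + bodyDeriv σ' g := by
      have : bodyCoord (σ + σ') = bodyCoord σ + bodyCoord σ' := by
        funext x; exact map_add (leftUntranslate x) (σ x) (σ' x)
      unfold bodyDeriv
      rw [this]
      exact mvfderiv_add (mdifferentiableAt_bodyCoord hσ) (mdifferentiableAt_bodyCoord hσ')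
    simp only [covFun_apply, add_apply, h, Pi.add_apply, map_add]
    abel
  leibniz {σ f g} hσ hf _ := by
    ext1 X
    have h : bodyDeriv (f • σ) g X = f g • bodyDeriv σ g X +
        mvfderiv (𝓡 n) f g X • leftUntranslate g (σ g) := by
      have : bodyCoord (f • σ) = f • bodyCoord σ := by
        funext x; exact map_smul (leftUntranslate x) (f x) (σ x)
      unfold bodyDeriv
      rw [this, mvfderiv_smul hf (mdifferentiableAt_bodyCoord hσ)]
      rfl
    simp only [covFun_apply, h, add_apply, Pi.smul_apply', map_smul, map_add,
      smul_apply, ContinuousLinearMap.smulRight_apply, leftTranslate_leftUntranslate]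
    module

/-- The Levi-Civita connection of the left-invariant metric: it is torsion-free
(`leviCivita_torsion`) and compatible with the metric (`leviCivita_metric`). -/
def leviCivita : CovariantDerivative (𝓡 n) (EuclideanSpace ℝ (Fin n))
    (TangentSpace (𝓡 n) : G → Type _) where
  toFun := covFun B
  isCovariantDerivativeOnUniv := isCovariantDerivativeOn_covFun B

theorem bodyDeriv_leftInvariant (v : GroupLieAlgebra (𝓡 n) G) (g : G) :
    bodyDeriv (mulInvariantVectorField v) g = 0 := by
  have : bodyCoord (mulInvariantVectorField (I := 𝓡 n) (G := G) v) = fun _ => v := by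
    funext x; exact leftUntranslate_leftTranslate x v
  unfold bodyDeriv
  rw [this]
  exact mvfderiv_const (F := EuclideanSpace ℝ (Fin n)) (I := 𝓡 n) (M := G) v

/-- The restriction of the Levi-Civita connection to left-invariant vector fields. -/
theorem leviCivita_leftInvariant (v w : GroupLieAlgebra (𝓡 n) G) (g : G) :
    leviCivita B (mulInvariantVectorField w) g (mulInvariantVectorField v g) =
      mulInvariantVectorField (restrictedConnection B v w) g := by
  change covFun B _ _ _ = _
  rw [covFun_apply, bodyDeriv_leftInvariant]
  simp only [← leftTranslate_eq, leftUntranslate_leftTranslate, zero_apply, zero_add]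

/-- The connection is torsion-free. -/
theorem leviCivita_torsion : (leviCivita B).torsion = 0 := by
  ext g X Y
  have h (v w : GroupLieAlgebra (𝓡 n) G) := (leviCivita B).torsion_apply
    (mdifferentiableAt_mulInvariantVectorField (I := 𝓡 n) (G := G) v (g := g))
    (mdifferentiableAt_mulInvariantVectorField (I := 𝓡 n) (G := G) w (g := g))
  specialize h (leftUntranslate g X) (leftUntranslate g Y)
  rw [leviCivita_leftInvariant, leviCivita_leftInvariant] at h
  rw [← mulInvariantVector_mlieBracket, ← GroupLieAlgebra.bracket_def] at h
  simp only [← leftTranslate_eq, leftTranslate_leftUntranslate, ← map_sub, restrictedConnection_torsion, sub_self] at h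
  simpa using h

/-- The connection is compatible with the left-invariant metric. -/
theorem leviCivita_metric {σ τ : (g : G) → TangentSpace (𝓡 n) g} {g : G}
    (hσ : MDifferentiableAt (𝓡 n) (𝓡 n).tangent (fun x => (⟨x, σ x⟩ : TangentBundle (𝓡 n) G)) g)
    (hτ : MDifferentiableAt (𝓡 n) (𝓡 n).tangent (fun x => (⟨x, τ x⟩ : TangentBundle (𝓡 n) G)) g)
    (X : TangentSpace (𝓡 n) g) :
    mvfderiv (𝓡 n) (fun x => leftMetric B x (σ x) (τ x)) g X =
      leftMetric B g (leviCivita B σ g X) (τ g) + leftMetric B g (σ g) (leviCivita B τ g X) := by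
  have h1 := (mdifferentiableAt_bodyCoord hσ).hasMFDerivAt
  have h2 := (mdifferentiableAt_bodyCoord hτ).hasMFDerivAt
  let b : LinearMap.BilinForm ℝ (EuclideanSpace ℝ (Fin n)) := B.form
  let L : EuclideanSpace ℝ (Fin n) →L[ℝ] EuclideanSpace ℝ (Fin n) →L[ℝ] ℝ := b.toContinuousBilinearMap
  let s' : EuclideanSpace ℝ (Fin n) →L[ℝ] EuclideanSpace ℝ (Fin n) := bodyDeriv σ g
  let t' : EuclideanSpace ℝ (Fin n) →L[ℝ] EuclideanSpace ℝ (Fin n) := bodyDeriv τ g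
  have h1' : HasFDerivWithinAt _ s' _ _ := h1.2
  have h2' : HasFDerivWithinAt _ t' _ _ := h2.2
  have h3 : HasMFDerivAt (𝓡 n) 𝓘(ℝ, ℝ) (fun x => L (bodyCoord σ x) (bodyCoord τ x)) g
      (L.precompR _ (bodyCoord σ g) t' + L.precompL _ s' (bodyCoord τ g)) := by
    refine ⟨L.continuous₂.continuousAt.comp (h1.1.prodMk h2.1), ?_⟩
    convert! L.hasFDerivWithinAt_of_bilinear h1' h2' using 1
    simp [writtenInExtChartAt, chartAt_self_eq, Function.comp_def]
    rfl
  have h4 : mvfderiv (𝓡 n) (fun x => leftMetric B x (σ x) (τ x)) g X =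
      B.form (bodyCoord σ g) (bodyDeriv τ g X) + B.form (bodyDeriv σ g X) (bodyCoord τ g) := by
    have := congrArg (fun A : EuclideanSpace ℝ (Fin n) →L[ℝ] ℝ => A X) h3.mfderiv
    exact this
  have h5 := restrictedConnection_metric B (leftUntranslate g X) (leftUntranslate g (σ g)) (leftUntranslate g (τ g))
  have e1 : leftMetric B g (leviCivita B σ g X) (τ g) =
      B.form (bodyDeriv σ g X + restrictedConnection B (leftUntranslate g X) (leftUntranslate g (σ g)))
        (leftUntranslate g (τ g)) := by
    change B.form (leftUntranslate g (covFun B σ g X)) _ = _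
    rw [covFun_apply, leftUntranslate_leftTranslate]
  have e2 : leftMetric B g (σ g) (leviCivita B τ g X) =
      B.form (leftUntranslate g (σ g))
        (bodyDeriv τ g X + restrictedConnection B (leftUntranslate g X) (leftUntranslate g (τ g))) := by
    change B.form _ (leftUntranslate g (covFun B τ g X)) = _
    rw [covFun_apply, leftUntranslate_leftTranslate]
  rw [h4, e1, e2, map_add, map_add, LinearMap.add_apply]
  change B.form (leftUntranslate g (σ g)) (bodyDeriv τ g X) + B.form (bodyDeriv σ g X) (leftUntranslate g (τ g)) = _
  linarith

/-- The Hessian of `ψ` at `g` with respect to the Levi-Civita connection,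
`Hess ψ (X, Y) = X (Y ψ) - (∇_X Y) ψ`, where `Y` is extended to a left-invariant vector field. -/
def hessian (ψ : G → ℝ) (g : G) (X Y : TangentSpace (𝓡 n) g) : ℝ :=
  mvfderiv (𝓡 n) (fun x : G => mvfderiv (𝓡 n) ψ x
      (mulInvariantVectorField (leftUntranslate g Y) x)) g X -
    mvfderiv (𝓡 n) ψ g (leviCivita B (mulInvariantVectorField (leftUntranslate g Y)) g X)

end LieGroup

/-! ### The closed-loop system -/

/-- The antiderivative of `u` whose mean over `[0, T]` is zero. -/
def zeroMeanAntiderivative {n : ℕ} (T : ℝ) (u : ℝ → EuclideanSpace ℝ (Fin n)) (τ : ℝ) :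
    EuclideanSpace ℝ (Fin n) :=
  (∫ s in (0 : ℝ)..τ, u s) - T⁻¹ • ∫ r in (0 : ℝ)..T, ∫ s in (0 : ℝ)..r, u s

section ClosedLoop

variable {n : ℕ} {G : Type*} [TopologicalSpace G] [ChartedSpace (EuclideanSpace ℝ (Fin n)) G]
  [Group G]

variable (n G) in
/-- The state manifold, with points `(g, v, w, η)`: configuration, body velocity, state of the
phase-lead compensator, state of the high-pass filter. -/
abbrev ClosedLoopState : Type _ :=
  G × GroupLieAlgebra (𝓡 n) G × EuclideanSpace ℝ (Fin n) × ℝ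

/-- The Euclidean space that contains the state manifold when `G` is embedded in `ℝ^N`. -/
abbrev AmbientSpace (n N : ℕ) : Type :=
  WithLp 2 (EuclideanSpace ℝ (Fin N) × WithLp 2 (EuclideanSpace ℝ (Fin N) ×
    WithLp 2 (EuclideanSpace ℝ (Fin n) × ℝ)))

/-- A point of `ℝ^N × ℝ^N × ℝ^n × ℝ`, with the Euclidean norm. -/
def ambientPoint {N : ℕ} (p q : EuclideanSpace ℝ (Fin N)) (w : EuclideanSpace ℝ (Fin n)) (η : ℝ) :
    AmbientSpace n N :=
  WithLp.toLp 2 (p, WithLp.toLp 2 (q, WithLp.toLp 2 (w, η)))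

/-- The embedding of the state manifold into Euclidean space that is induced by an embedding `ι` of
`G`; an element of the Lie algebra, the tangent space at the identity, is identified with a vector
of the ambient space of `G` by the tangent map of `ι`. -/
def stateEmbedding {N : ℕ} (ι : G → EuclideanSpace ℝ (Fin N)) :
    ClosedLoopState n G → AmbientSpace n N :=
  fun x => ambientPoint (ι x.1) (mvfderiv (𝓡 n) ι 1 x.2.1) x.2.2.1 x.2.2.2

/-- The isomorphism from `ℝ^n` to the Lie algebra that is given by a basis `e`. -/
def fromCoords (e : Module.Basis (Fin n) ℝ (GroupLieAlgebra (𝓡 n) G))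
    (w : EuclideanSpace ℝ (Fin n)) : GroupLieAlgebra (𝓡 n) G :=
  ∑ i, w i • e i

/-- The change of variables `(g, v, w, η) ↦ (g, v - λ α(ψ(g) - η) U(Ωt), w - κ α(ψ(g) - η) U(Ωt), η)`,
where `U` is the zero-mean antiderivative of `u`. -/
def changeOfVariables (ψ : G → ℝ) (α : ℝ → ℝ) (lam kap : ℝ)
    (e : Module.Basis (Fin n) ℝ (GroupLieAlgebra (𝓡 n) G))
    (T : ℝ) (u : ℝ → EuclideanSpace ℝ (Fin n)) (Ω t : ℝ) :
    ClosedLoopState n G ≃ ClosedLoopState n G where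
  toFun := fun (g, v, w, η) =>
    (g, v - (lam * α (ψ g - η)) • fromCoords e (zeroMeanAntiderivative T u (Ω * t)),
      w - (kap * α (ψ g - η)) • zeroMeanAntiderivative T u (Ω * t), η)
  invFun := fun (g, v, w, η) =>
    (g, v + (lam * α (ψ g - η)) • fromCoords e (zeroMeanAntiderivative T u (Ω * t)),
      w + (kap * α (ψ g - η)) • zeroMeanAntiderivative T u (Ω * t), η)
  left_inv := fun x => by simp
  right_inv := fun x => by simp

variable [LieGroup (𝓡 n) ∞ G]

/-- The output feedback applied to the Euler-Poincare system, as an element of the Lie algebra,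
in the state `(g, v, w, η)` at time `t`. The argument `u` is the perturbation signal, which
enters together with its zero-mean antiderivative. -/
def feedback (B : InnerProd (GroupLieAlgebra (𝓡 n) G)) (ψ : G → ℝ) (α : ℝ → ℝ) (lam b kap : ℝ)
    (e : Module.Basis (Fin n) ℝ (GroupLieAlgebra (𝓡 n) G))
    (T : ℝ) (u : ℝ → EuclideanSpace ℝ (Fin n)) (Ω t : ℝ) :
    ClosedLoopState n G → GroupLieAlgebra (𝓡 n) G :=
  fun (g, _, w, η) =>
    -(b • (fromCoords e w - (kap * α (ψ g - η)) •
        fromCoords e (zeroMeanAntiderivative T u (Ω * t)))) +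
      (lam * α (ψ g - η) * Ω) • fromCoords e (u (Ω * t)) +
      (lam ^ 2 * α (ψ g - η) ^ 2) • ∑ i, restrictedConnection B (e i) (e i)

/-- The closed-loop vector field at time `t`, as a vector of the ambient Euclidean space. Its
components are `g' = T_e L_g v`, `v' = -∇_v v - R v + feedback`, the phase-lead compensator
`w' = -a (w - κ α U(Ωt)) + κ α Ω u(Ωt)` and the high-pass filter `η' = -h η + h ψ(g)`. -/
def closedLoop {N : ℕ} (ι : G → EuclideanSpace ℝ (Fin N))
    (B : InnerProd (GroupLieAlgebra (𝓡 n) G))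
    (R : GroupLieAlgebra (𝓡 n) G →ₗ[ℝ] GroupLieAlgebra (𝓡 n) G)
    (ψ : G → ℝ) (α : ℝ → ℝ) (a lam b kap h : ℝ)
    (e : Module.Basis (Fin n) ℝ (GroupLieAlgebra (𝓡 n) G))
    (T : ℝ) (u : ℝ → EuclideanSpace ℝ (Fin n)) (Ω t : ℝ) :
    ClosedLoopState n G → AmbientSpace n N :=
  fun (g, v, w, η) => ambientPoint
    (mvfderiv (𝓡 n) ι g (leftTranslate g v))
    (mvfderiv (𝓡 n) ι 1 (-restrictedConnection B v v - R v +
      feedback B ψ α lam b kap e T u Ω t (g, v, w, η)))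
    (-(a • (w - (kap * α (ψ g - η)) • zeroMeanAntiderivative T u (Ω * t))) +
      (kap * α (ψ g - η) * Ω) • u (Ω * t))
    (-(h * η) + h * ψ g)

end ClosedLoop

end ExtremumSeeking

end

open ExtremumSeeking

set_option autoImplicit false

/-! ### Uniqueness of Caratheodory solutions and the unique maximal solution -/

section Solutions

open Set Filter MeasureTheory

variable {X F : Type*} [NormedAddCommGroup F] [NormedSpace ℝ F] {Φ : X → F} {f : ℝ → X → F}

/-! Since `U` is an antiderivative of `u`, differentiating `α U(ωt)` reproduces the large terms `α ω
u(ωt)`. So these terms vanish in the variables `x̃` (`hasDerivAt_shiftState`), and what remains is a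
field of degree at most two in `U(ωt)`. Averaging replaces `Uᵢ Uⱼ` by `δᵢⱼ`. The connection term
then averages to `-λ² α² μ`, which the last term of the feedback cancels. The terms that contain
`α'` leave `-λ² α α' grad ψ` in the `v`-equation and `-κ λ α α' grad ψ` in the `w`-equation
(`averagedField_apply`).

Let `H` be the Hessian at the minimizer and `c₀ = (α α')(0) > 0`. In suitable coordinates the
linearized average is `q' = v`, `v' = -R v - b w - λ² c₀ H q`, `w' = -a w - κ λ c₀ H q`, `η' = -h
η`; the last equation decouples because `dψ` vanishes at the minimizer. Put `z = q + γ H⁻¹ w` with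
`γ = a / (κ λ c₀)`. Then `z' = v - a z` and `v' = -R v - λ² c₀ H (θ q + (1 - θ) z)` with `θ = 1 - b
κ / (a λ)`, and the gain condition says that `0 < θ < 1`. Hence the energy `|v|² + λ² c₀ (θ ⟨q, H q⟩
+ (1 - θ) ⟨z, H z⟩)` is dissipated through `z` even if `R = 0`. Small cross terms `⟨z, v⟩` and `⟨q,
v⟩` carry the dissipation over to `v` and `q`, which gives a strict quadratic Lyapunov function
(`exists_lyapunov_of_phaseLead`).

A correction of order `1/ω` to this function absorbs the oscillating terms, so the transformed
solutions decay exponentially up to an error of order `1/ω` (`exists_decay_of_averaged_lyapunov`,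
`exists_solution_of_averaged_lyapunov`). Stability and attractivity both follow from this estimate.

It remains to pass from coordinates to the manifold. A chart at the minimizer is normalized so that
the left-invariant frame is the identity at the origin; at a critical point the Hessian is then an
ordinary second derivative. Since `u` is only bounded and measurable, a coordinate solution gives a
Lipschitz curve that satisfies the closed loop almost everywhere, and the fundamental theorem of
calculus yields the integral equation (`isSolutionOn_closedLoopInto`). A Lipschitz bound measured in
the ambient space gives uniqueness, so this curve is a restriction of the unique maximal solution.
-/

theorem ExtremumSeeking.IsSolutionOn.continuousOn_comp {J : Set ℝ} {x : ℝ → X}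
    (hx : IsSolutionOn Φ f J x) : ContinuousOn (fun t => Φ (x t)) J := by
  intro t ht
  refine ContinuousAt.continuousWithinAt ?_
  obtain ⟨ε, hε, hb⟩ := Metric.isOpen_iff.1 hx.isOpen t ht
  have hsub : Icc (t - ε / 2) (t + ε / 2) ⊆ J := fun s hs => hb (by
    rw [Metric.mem_ball, Real.dist_eq, abs_lt]; constructor <;> linarith [hs.1, hs.2])
  have h1 : t - ε / 2 ∈ J := hsub ⟨le_rfl, by linarith⟩
  have h2 : t + ε / 2 ∈ J := hsub ⟨by linarith, le_rfl⟩
  have hc := intervalIntegral.continuousOn_primitive_interval'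
    (hx.intervalIntegrable _ h1 _ h2) (left_mem_uIcc)
  rw [uIcc_of_le (by linarith)] at hc
  have hc' : ContinuousAt (fun b => ∫ τ in (t - ε / 2)..b, f τ (x τ)) t :=
    hc.continuousAt (Icc_mem_nhds (by linarith) (by linarith))
  have hc'' := hc'.add (continuousAt_const (y := Φ (x (t - ε / 2))))
  refine hc''.congr ?_
  filter_upwards [Icc_mem_nhds (show t - ε / 2 < t by linarith) (show t < t + ε / 2 by linarith)]
    with s hs
  change (∫ τ in (t - ε / 2)..s, f τ (x τ)) + Φ (x (t - ε / 2)) = _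
  rw [← hx.integral_eq _ h1 _ (hsub hs)]
  abel

/-- The vector field is Lipschitz near every point, uniformly in time, when distances are measured
in the ambient space of the embedding. -/
def LocallyLipschitzAlong [TopologicalSpace X] (Φ : X → F) (f : ℝ → X → F) : Prop :=
  ∀ p : X, ∃ N ∈ 𝓝 p, ∃ C : ℝ, ∀ t, ∀ x ∈ N, ∀ y ∈ N, ‖f t x - f t y‖ ≤ C * ‖Φ x - Φ y‖

variable [TopologicalSpace X]

/-- Contraction on a short interval: the integral equations bound the largest distance between the
two curves by half of itself. -/
theorem IsSolutionOn.eventually_eq (hΦ : Topology.IsInducing Φ) (hinj : Function.Injective Φ)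
    (hf : LocallyLipschitzAlong Φ f) {J J' : Set ℝ} {x y : ℝ → X} (hx : IsSolutionOn Φ f J x)
    (hy : IsSolutionOn Φ f J' y) {t₁ : ℝ} (ht : t₁ ∈ J ∩ J') (heq : x t₁ = y t₁) :
    ∀ᶠ t in 𝓝 t₁, x t = y t := by
  have hJ : J ∩ J' ∈ 𝓝 t₁ := (hx.isOpen.inter hy.isOpen).mem_nhds ht
  have cx : ContinuousAt x t₁ := by
    rw [hΦ.continuousAt_iff]
    exact (hx.continuousOn_comp).continuousAt (hx.isOpen.mem_nhds ht.1)
  have cy : ContinuousAt y t₁ := by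
    rw [hΦ.continuousAt_iff]
    exact (hy.continuousOn_comp).continuousAt (hy.isOpen.mem_nhds ht.2)
  obtain ⟨N, hN, C, hC⟩ := hf (x t₁)
  have hxN := cx.preimage_mem_nhds hN
  have hyN := cy.preimage_mem_nhds (heq ▸ hN)
  obtain ⟨ε, hε, hb⟩ := Metric.mem_nhds_iff.1 (inter_mem (inter_mem hxN hyN) hJ)
  -- The Lipschitz constant of the hypothesis may be zero or negative, and `δ` has to be of order `1
  -- / C'`.
  set C' := |C| + 1 with hC'
  have hC'0 : 0 < C' := by positivity
  set δ := min (ε / 2) (1 / (2 * C')) with hδ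
  have hδ0 : 0 < δ := by positivity
  have hδε : δ < ε := (min_le_left _ _).trans_lt (by linarith)
  have hδC : C' * δ ≤ 1 / 2 := by
    calc C' * δ ≤ C' * (1 / (2 * C')) := by gcongr; exact min_le_right _ _
      _ = 1 / 2 := by field_simp
  have hsub : Icc (t₁ - δ) (t₁ + δ) ⊆ x ⁻¹' N ∩ y ⁻¹' N ∩ (J ∩ J') := fun s hs => hb (by
    rw [Metric.mem_ball, Real.dist_eq, abs_lt]; constructor <;> linarith [hs.1, hs.2])
  set d : ℝ → ℝ := fun t => ‖Φ (x t) - Φ (y t)‖ with hd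
  have hdc : ContinuousOn d (Icc (t₁ - δ) (t₁ + δ)) :=
    ((hx.continuousOn_comp.mono fun s hs => (hsub hs).2.1).sub
      (hy.continuousOn_comp.mono fun s hs => (hsub hs).2.2)).norm
  obtain ⟨m, hm, hmax⟩ := isCompact_Icc.exists_isMaxOn ⟨t₁, by constructor <;> linarith⟩ hdc
  have ht₁ : t₁ ∈ Icc (t₁ - δ) (t₁ + δ) := by constructor <;> linarith
  -- The integrand is bounded by `C'` times the maximal distance `d m`, so the distance at `m`
  -- itself satisfies this bound; `C' * δ ≤ 1 / 2` then forces `d m = 0`.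
  have key : d m ≤ C' * d m * |m - t₁| := by
    have e1 := hx.integral_eq t₁ ht.1 m (hsub hm).2.1
    have e2 := hy.integral_eq t₁ ht.2 m (hsub hm).2.2
    have e3 : Φ (x m) - Φ (y m) = ∫ τ in t₁..m, (f τ (x τ) - f τ (y τ)) := by
      rw [intervalIntegral.integral_sub (hx.intervalIntegrable _ ht.1 _ (hsub hm).2.1)
        (hy.intervalIntegrable _ ht.2 _ (hsub hm).2.2), ← e1, ← e2, heq]
      abel
    have e4 : d m = ‖∫ τ in t₁..m, (f τ (x τ) - f τ (y τ))‖ := by rw [← e3]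
    refine e4.le.trans ?_
    refine intervalIntegral.norm_integral_le_of_norm_le_const fun τ hτ => ?_
    have hτ' : τ ∈ Icc (t₁ - δ) (t₁ + δ) := by
      have := uIoc_subset_uIcc hτ
      exact (convex_Icc _ _).ordConnected.uIcc_subset ht₁ hm this
    refine (hC τ _ (hsub hτ').1.1 _ (hsub hτ').1.2).trans ?_
    have h1 : d τ ≤ d m := hmax hτ'
    have h2 : 0 ≤ d τ := norm_nonneg _
    have h3 : C ≤ C' := by rw [hC']; linarith [le_abs_self C]
    calc C * ‖Φ (x τ) - Φ (y τ)‖ ≤ C' * d τ := by gcongr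
      _ ≤ C' * d m := by gcongr
  have hdm0 : 0 ≤ d m := norm_nonneg _
  have habs : |m - t₁| ≤ δ := by rw [abs_le]; constructor <;> linarith [hm.1, hm.2]
  have hdm : d m = 0 := by
    have : C' * d m * |m - t₁| ≤ d m * (1 / 2) := by
      calc C' * d m * |m - t₁| ≤ C' * d m * δ := by gcongr
        _ = d m * (C' * δ) := by ring
        _ ≤ d m * (1 / 2) := by gcongr
    linarith
  filter_upwards [Icc_mem_nhds (show t₁ - δ < t₁ by linarith) (show t₁ < t₁ + δ by linarith)]
    with s hs
  have h1 : d s ≤ d m := hmax hs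
  rw [hdm] at h1
  exact hinj (sub_eq_zero.1 (norm_le_zero_iff.1 h1))

/-- The common domain is an interval. The set where the curves agree is open by local uniqueness and
the set where they differ is open by continuity, so connectedness leaves only the former. -/
theorem IsSolutionOn.eqOn_inter (hΦ : Topology.IsInducing Φ) (hinj : Function.Injective Φ)
    (hf : LocallyLipschitzAlong Φ f) {J J' : Set ℝ} {x y : ℝ → X} (hx : IsSolutionOn Φ f J x)
    (hy : IsSolutionOn Φ f J' y) {t₀ : ℝ} (ht : t₀ ∈ J ∩ J') (heq : x t₀ = y t₀) :
    EqOn x y (J ∩ J') := by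
  have hpre : IsPreconnected (J ∩ J') :=
    (hx.ordConnected.inter hy.ordConnected).isPreconnected
  have hopen : IsOpen (J ∩ J') := hx.isOpen.inter hy.isOpen
  set u := {t | t ∈ J ∩ J' ∧ x t = y t} with hu
  set v := {t | t ∈ J ∩ J' ∧ x t ≠ y t} with hv
  have hu' : IsOpen u := by
    rw [isOpen_iff_mem_nhds]
    rintro t ⟨h1, h2⟩
    filter_upwards [hopen.mem_nhds h1,
      IsSolutionOn.eventually_eq hΦ hinj hf hx hy h1 h2] with s hs hs' using ⟨hs, hs'⟩
  have hv' : IsOpen v := by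
    have h1 : ContinuousOn (fun t => Φ (x t) - Φ (y t)) (J ∩ J') :=
      (hx.continuousOn_comp.mono inter_subset_left).sub
        (hy.continuousOn_comp.mono inter_subset_right)
    have h2 := h1.isOpen_inter_preimage hopen (isOpen_compl_singleton (x := (0 : F)))
    convert h2 using 1
    ext t
    simp only [hv, mem_ofPred_eq, mem_inter_iff, mem_preimage, mem_compl_iff, mem_singleton_iff,
      sub_eq_zero, hinj.eq_iff, ne_eq]
  have hsub := hpre.subset_left_of_subset_union hu' hv'
    (by rw [Set.disjoint_left]; exact fun t h1 h2 => h2.2 h1.2)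
    (fun t h => (em (x t = y t)).imp (fun h' => ⟨h, h'⟩) (fun h' => ⟨h, h'⟩))
    ⟨t₀, ht, ht, heq⟩
  exact fun t h => (hsub h).2

/-- If solutions are unique, a solution that exists on `[t₀, ∞)` is the restriction of the unique
maximal solution. -/
theorem maximalSolutionSatisfies_of_isSolutionOn (hΦ : Topology.IsInducing Φ)
    (hinj : Function.Injective Φ) (hf : LocallyLipschitzAlong Φ f) {J : Set ℝ} {z : ℝ → X}
    (hz : IsSolutionOn Φ f J z) {t₀ : ℝ} (hJ : Ici t₀ ⊆ J) {P : (ℝ → X) → Prop}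
    (hP : ∀ x : ℝ → X, EqOn x z (Ici t₀) → P x) :
    MaximalSolutionSatisfies Φ f t₀ (z t₀) P := by
  classical
  -- The maximal solution is the union of all solutions through the initial point; by `huniq` they
  -- agree on overlaps. No Zorn argument is needed.
  let 𝒮 : Set (Set ℝ × (ℝ → X)) :=
    {p | IsSolutionOn Φ f p.1 p.2 ∧ t₀ ∈ p.1 ∧ p.2 t₀ = z t₀}
  have huniq : ∀ p ∈ 𝒮, ∀ r ∈ 𝒮, EqOn p.2 r.2 (p.1 ∩ r.1) := fun p hp r hr =>
    IsSolutionOn.eqOn_inter hΦ hinj hf hp.1 hr.1 ⟨hp.2.1, hr.2.1⟩ (hp.2.2.trans hr.2.2.symm)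
  let K : Set ℝ := {t | ∃ p ∈ 𝒮, t ∈ p.1}
  let x : ℝ → X := fun t => if h : t ∈ K then (h.choose).2 t else z t
  have hx : ∀ p ∈ 𝒮, EqOn x p.2 p.1 := by
    intro p hp t ht
    have h : t ∈ K := ⟨p, hp, ht⟩
    simp only [x, dif_pos h]
    exact huniq _ h.choose_spec.1 _ hp ⟨h.choose_spec.2, ht⟩
  have hz0 : t₀ ∈ J := hJ self_mem_Ici
  have hzS : (J, z) ∈ 𝒮 := ⟨hz, hz0, rfl⟩
  have ht₀K : t₀ ∈ K := ⟨_, hzS, hz0⟩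
  have hx0 : x t₀ = z t₀ := hx _ hzS hz0
  -- Two points of `K` may come from different members of `𝒮`, but the segment from `t₀` to one
  -- point always lies in a single domain. The general equation is a difference of two of these.
  have base : ∀ s ∈ K, IntervalIntegrable (fun τ => f τ (x τ)) volume t₀ s ∧
      Φ (x s) - Φ (x t₀) = ∫ τ in t₀..s, f τ (x τ) := by
    rintro s ⟨p, hp, hs⟩
    have hsub : uIcc t₀ s ⊆ p.1 := hp.1.ordConnected.uIcc_subset hp.2.1 hs
    have e : EqOn (fun τ => f τ (p.2 τ)) (fun τ => f τ (x τ)) (uIcc t₀ s) := fun τ hτ => by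
      simp only [hx p hp (hsub hτ)]
    refine ⟨(hp.1.intervalIntegrable _ hp.2.1 _ hs).congr (e.mono uIoc_subset_uIcc), ?_⟩
    rw [hx p hp hs, hx p hp hp.2.1, hp.1.integral_eq _ hp.2.1 _ hs]
    exact intervalIntegral.integral_congr e
  have hsol : IsSolutionOn Φ f K x := by
    refine ⟨?_, ?_, ?_, ?_⟩
    · have : K = ⋃ p ∈ 𝒮, p.1 := by ext t; simp [K]
      rw [this]
      exact isOpen_biUnion fun p hp => hp.1.isOpen
    · have : K = ⋃ p ∈ 𝒮, p.1 := by ext t; simp [K]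
      rw [← isPreconnected_iff_ordConnected, this]
      rw [← sUnion_image]
      refine isPreconnected_sUnion t₀ (Prod.fst '' 𝒮) ?_ ?_
      · rintro _ ⟨p, hp, rfl⟩
        exact hp.2.1
      · rintro _ ⟨p, hp, rfl⟩
        exact hp.1.ordConnected.isPreconnected
    · exact fun s hs t ht => (base s hs).1.symm.trans (base t ht).1
    · intro s hs t ht
      rw [← intervalIntegral.integral_interval_sub_left (base t ht).1 (base s hs).1,
        ← (base t ht).2, ← (base s hs).2]
      abel
  have hmaxl : ∀ (J' : Set ℝ) (x' : ℝ → X), IsSolutionOn Φ f J' x' → K ⊆ J' →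
      EqOn x' x K → J' = K := by
    intro J' x' h1 h2 h3
    refine Subset.antisymm (fun t ht => ?_) h2
    exact ⟨(J', x'), ⟨h1, h2 ht₀K, (h3 ht₀K).trans hx0⟩, ht⟩
  refine ⟨K, x, ⟨hsol, ht₀K, hx0, hmaxl⟩, ?_, fun t ht => ⟨_, hzS, hJ ht⟩,
    hP x fun t ht => hx _ hzS (hJ ht)⟩
  intro J' x' h
  have hm : (J', x') ∈ 𝒮 := ⟨h.isSolutionOn, h.mem, h.initial⟩
  have hsub : J' ⊆ K := fun t ht => ⟨_, hm, ht⟩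
  have he : K = J' := h.maximal K x hsol hsub (hx _ hm)
  exact ⟨he.symm, fun t ht => (hx _ hm (he ▸ ht)).symm⟩

end Solutions

/-! ### Fundamental theorem of calculus for Lipschitz curves -/

section FundamentalTheorem

open Set MeasureTheory

variable {F : Type*} [NormedAddCommGroup F] [NormedSpace ℝ F]

/-- The fundamental theorem of calculus for a Lipschitz function that is differentiable almost
everywhere with bounded measurable derivative. -/
theorem LipschitzOnWith.integral_eq_sub_of_ae_hasDerivAt [CompleteSpace F] {K : NNReal}
    {c c' : ℝ → F} {s t : ℝ} (hc : LipschitzOnWith K c (uIcc s t))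
    (hc' : IntervalIntegrable c' volume s t) {M : ℝ} (hM : ∀ τ ∈ uIcc s t, ‖c' τ‖ ≤ M)
    (h : ∀ᵐ τ, τ ∈ uIcc s t → HasDerivAt c (c' τ) τ) : c t - c s = ∫ τ in s..t, c' τ := by
  have hint : AbsolutelyContinuousOnInterval (fun x => ∫ τ in s..x, c' τ) s t := by
    refine LipschitzOnWith.absolutelyContinuousOnInterval (K := M.toNNReal) ?_
    refine LipschitzOnWith.of_dist_le_mul fun x hx y hy => ?_
    have hsub : ∀ z ∈ uIcc s t, IntervalIntegrable c' volume s z := fun z hz =>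
      hc'.mono_set (uIcc_subset_uIcc_left hz)
    rw [dist_eq_norm, intervalIntegral.integral_interval_sub_left (hsub x hx) (hsub y hy),
      Real.dist_eq]
    refine intervalIntegral.norm_integral_le_of_norm_le_const fun τ hτ => ?_
    exact (hM τ (uIcc_subset_uIcc hy hx (uIoc_subset_uIcc hτ))).trans (Real.le_coe_toNNReal M)
  -- The difference of `c` and the primitive of `c'` is absolutely continuous with zero derivative
  -- almost everywhere, hence constant.
  have hg : AbsolutelyContinuousOnInterval (fun x => c x - ∫ τ in s..x, c' τ) s t :=
    hc.absolutelyContinuousOnInterval.sub hint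
  have hz : ∀ᵐ x, x ∈ uIcc s t → HasDerivAt (fun x => c x - ∫ τ in s..x, c' τ) 0 x := by
    filter_upwards [h, hc'.ae_hasDerivAt_integral] with x h1 h2 h3
    have := (h1 h3).sub (h2 h3 s (by simp))
    rwa [sub_self] at this
  obtain ⟨C, hC⟩ := hg.const_of_ae_hasDerivAt_zero hz
  have h1 := hC s (by simp)
  have h2 := hC t (by simp)
  simp only [intervalIntegral.integral_same, sub_zero] at h1
  rw [h1, ← h2]
  abel

end FundamentalTheorem

/-! ### Global solutions of bounded Lipschitz systems -/

section GlobalExistence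

open Set

variable {Y : Type*} [NormedAddCommGroup Y] [NormedSpace ℝ Y]

/-- A bounded, globally Lipschitz, time-dependent vector field has global solutions. -/
theorem exists_forall_hasDerivAt_of_lipschitzWith [CompleteSpace Y] {f : ℝ → Y → Y} {K : NNReal}
    (hK : ∀ t, LipschitzWith K (f t)) (hf : ∀ x, Continuous fun t => f t x) {B : NNReal}
    (hB : ∀ t x, ‖f t x‖ ≤ B) (t₀ : ℝ) (y₀ : Y) :
    ∃ y : ℝ → Y, y t₀ = y₀ ∧ ∀ t, HasDerivAt y (f t (y t)) t := by
  have loc : ∀ n : ℕ, ∃ y : ℝ → Y, y t₀ = y₀ ∧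
      ∀ t ∈ Ioo (t₀ - (n + 1)) (t₀ + (n + 1)), HasDerivAt y (f t (y t)) t := by
    intro n
    have hmem : t₀ ∈ Icc (t₀ - (n + 1)) (t₀ + (n + 1)) := by
      constructor <;> linarith [(Nat.cast_nonneg n : (0 : ℝ) ≤ n)]
    -- At speed at most `B`, a ball of radius `B * (n + 1)` cannot be left within time `n + 1`, so
    -- Picard-Lindelöf applies on the whole interval.
    have hpl : IsPicardLindelof f (⟨t₀, hmem⟩ : Icc (t₀ - (n + 1 : ℝ)) (t₀ + (n + 1))) y₀
        (B * (n + 1)) 0 B K :=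
      { lipschitzOnWith := fun t _ => (hK t).lipschitzOnWith
        continuousOn := fun x _ => (hf x).continuousOn
        norm_le := fun t _ x _ => hB t x
        mul_max_le := by simp }
    obtain ⟨y, h1, h2⟩ := hpl.exists_eq_forall_mem_Icc_hasDerivWithinAt₀
    exact ⟨y, h1, fun t ht => (h2 t (Ioo_subset_Icc_self ht)).hasDerivAt (Icc_mem_nhds ht.1 ht.2)⟩
  choose y hy0 hy using loc
  have agree : ∀ n k : ℕ, n ≤ k → EqOn (y n) (y k) (Ioo (t₀ - (n + 1)) (t₀ + (n + 1))) := by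
    intro n k hnk
    have hnk' : (n : ℝ) ≤ k := by exact_mod_cast hnk
    refine ODE_solution_unique_of_mem_Ioo (v := f) (s := fun _ => univ) (K := K) (t₀ := t₀)
      (fun t _ => (hK t).lipschitzOnWith) ?_ (fun t ht => ⟨hy n t ht, mem_univ _⟩)
      (fun t ht => ⟨hy k t ⟨?_, ?_⟩, mem_univ _⟩) ((hy0 n).trans (hy0 k).symm)
    · constructor <;> linarith [(Nat.cast_nonneg n : (0 : ℝ) ≤ n)]
    · linarith [ht.1]
    · linarith [ht.2]
  -- At time `t`, use the first of the nested local solutions whose open interval is certain to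
  -- contain `t`.
  let z : ℝ → Y := fun t => y ⌈|t - t₀|⌉₊ t
  have hz : ∀ n : ℕ, EqOn z (y n) (Ioo (t₀ - (n + 1)) (t₀ + (n + 1))) := by
    intro n t ht
    have h1 : |t - t₀| ≤ ⌈|t - t₀|⌉₊ := Nat.le_ceil _
    have h2 : t ∈ Ioo (t₀ - ((⌈|t - t₀|⌉₊ : ℝ) + 1)) (t₀ + (⌈|t - t₀|⌉₊ + 1)) := by
      have := abs_le.1 h1
      constructor <;> linarith [this.1, this.2]
    rcases le_total n ⌈|t - t₀|⌉₊ with h | h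
    · exact (agree _ _ h ht).symm
    · exact agree _ _ h h2
  refine ⟨z, by rw [hz 0 (by constructor <;> simp), hy0], fun t => ?_⟩
  set n := ⌈|t - t₀|⌉₊ with hn
  have h1 : |t - t₀| ≤ n := Nat.le_ceil _
  have ht : t ∈ Ioo (t₀ - ((n : ℝ) + 1)) (t₀ + (n + 1)) := by
    have := abs_le.1 h1
    constructor <;> linarith [this.1, this.2]
  have h := hy n t ht
  rw [← hz n ht] at h
  exact h.congr_of_eventuallyEq
    (Filter.eventuallyEq_of_mem (Ioo_mem_nhds ht.1 ht.2) (hz n))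

end GlobalExistence

/-! ### Averaging with a quadratic Lyapunov function -/

section Averaging

open Set

variable {Y : Type*} [NormedAddCommGroup Y] [NormedSpace ℝ Y] {κ : Type*} [Fintype κ]

/-- A differential inequality `W' ≤ -k W + b` on an interval gives exponential decay. -/
theorem le_exp_neg_mul_of_deriv_le {W W' : ℝ → ℝ} {k b t₀ t₁ : ℝ} (hk : 0 < k) (hb : 0 ≤ b)
    (hW : ∀ t ∈ Icc t₀ t₁, HasDerivAt W (W' t) t)
    (h : ∀ t ∈ Icc t₀ t₁, W' t ≤ -k * W t + b) {t : ℝ} (ht : t ∈ Icc t₀ t₁) :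
    W t ≤ Real.exp (-k * (t - t₀)) * W t₀ + b / k := by
  -- Integrating factor for `W - b / k`; the differential inequality says that `Z` is nonincreasing.
  let Z : ℝ → ℝ := fun s => Real.exp (k * (s - t₀)) * (W s - b / k)
  have hZ : ∀ s ∈ Icc t₀ t₁, HasDerivAt Z
      (Real.exp (k * (s - t₀)) * k * (W s - b / k) + Real.exp (k * (s - t₀)) * W' s) s := by
    intro s hs
    have h1 : HasDerivAt (fun s => k * (s - t₀)) k s := by
      simpa using ((hasDerivAt_id s).sub_const t₀).const_mul k
    exact h1.exp.mul ((hW s hs).sub_const _)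
  have hanti : AntitoneOn Z (Icc t₀ t₁) := by
    refine antitoneOn_of_deriv_nonpos (convex_Icc _ _)
      (fun s hs => (hZ s hs).continuousAt.continuousWithinAt)
      (fun s hs => (hZ s (interior_subset hs)).differentiableAt.differentiableWithinAt)
      (fun s hs => ?_)
    rw [(hZ s (interior_subset hs)).deriv]
    have h1 := h s (interior_subset hs)
    have h2 := Real.exp_pos (k * (s - t₀))
    have h3 : k * (W s - b / k) + W' s ≤ 0 := by
      have : k * (b / k) = b := by field_simp
      nlinarith
    nlinarith
  have h1 := hanti ⟨le_rfl, ht.1.trans ht.2⟩ ht ht.1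
  simp only [Z, sub_self, mul_zero, Real.exp_zero, one_mul] at h1
  have h2 : Real.exp (-k * (t - t₀)) * Real.exp (k * (t - t₀)) = 1 := by
    rw [← Real.exp_add]; simp
  have h3 := Real.exp_pos (-k * (t - t₀))
  have h4 : W t - b / k ≤ Real.exp (-k * (t - t₀)) * (W t₀ - b / k) := by
    calc W t - b / k = Real.exp (-k * (t - t₀)) *
          (Real.exp (k * (t - t₀)) * (W t - b / k)) := by rw [← mul_assoc, h2, one_mul]
      _ ≤ _ := by gcongr
  have h5 : 0 ≤ Real.exp (-k * (t - t₀)) * (b / k) := by positivity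
  linarith

/-- The a priori estimate for a system with rapidly oscillating coefficients whose average has the
quadratic Lyapunov function `P`. -/
theorem exists_decay_of_averaged_lyapunov [FiniteDimensional ℝ Y] {F₀ : Y → Y} {F : κ → Y → Y}
    (hF₀ : ContDiff ℝ 1 F₀) (hF : ∀ i, ContDiff ℝ 1 (F i)) {m M : κ → ℝ → ℝ}
    (hM : ∀ i t, HasDerivAt (M i) (m i t) t) {C : ℝ} (hmC : ∀ i t, |m i t| ≤ C)
    (hMC : ∀ i t, |M i t| ≤ C) {P : Y →L[ℝ] Y →L[ℝ] ℝ} (hsymm : ∀ x y, P x y = P y x)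
    {c : ℝ} (hc : 0 < c) (hP : ∀ y, c * ‖y‖ ^ 2 ≤ P y y) {r : ℝ}
    (hdec : ∀ y, ‖y‖ ≤ r → P y (F₀ y) ≤ -c * ‖y‖ ^ 2) :
    ∃ K > 0, ∃ k > 0, ∀ Ω > 0, ∀ (t₀ t₁ : ℝ) (y : ℝ → Y),
      (∀ t ∈ Icc t₀ t₁, ‖y t‖ ≤ r ∧
        HasDerivAt y (F₀ (y t) + ∑ i, m i (Ω * t) • F i (y t)) t) →
      ∀ t ∈ Icc t₀ t₁, ‖y t‖ ^ 2 ≤ K * (Real.exp (-k * (t - t₀)) * ‖y t₀‖ ^ 2 + 1 / Ω) := by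
  let l : κ → Y → ℝ := fun i y => P y (F i y)
  have hl : ∀ i, ContDiff ℝ 1 (l i) := fun i => P.contDiff.clm_apply (hF i)
  have bound : ∀ g : Y → ℝ, Continuous g → ∃ b, 0 ≤ b ∧ ∀ y, ‖y‖ ≤ r → g y ≤ b := by
    intro g hg
    obtain ⟨b, hb⟩ := (isCompact_closedBall (0 : Y) r).exists_bound_of_continuousOn hg.continuousOn
    exact ⟨max b 0, le_max_right _ _, fun y hy => (le_abs_self _).trans
      ((hb y (mem_closedBall_zero_iff.2 hy)).trans (le_max_left _ _))⟩
  obtain ⟨b₀, hb₀, hB₀⟩ := bound (fun y => ‖F₀ y‖) hF₀.continuous.norm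
  choose b₁ hb₁ hB₁ using fun i => bound (fun y => ‖F i y‖) (hF i).continuous.norm
  choose b₂ hb₂ hB₂ using fun i => bound (fun y => ‖l i y‖) (hl i).continuous.norm
  choose b₃ hb₃ hB₃ using fun i => bound (fun y => ‖fderiv ℝ (l i) y‖)
    ((hl i).continuous_fderiv one_ne_zero).norm
  set v := b₀ + ∑ i, |C| * b₁ i with hv
  have hv0 : 0 ≤ v := by
    have : 0 ≤ ∑ i, |C| * b₁ i := Finset.sum_nonneg fun i _ => mul_nonneg (abs_nonneg _) (hb₁ i)
    linarith
  set D := ∑ i, |C| * b₂ i + ∑ i, |C| * (b₃ i * v) with hD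
  have hD1 : 0 ≤ ∑ i, |C| * b₂ i :=
    Finset.sum_nonneg fun i _ => mul_nonneg (abs_nonneg _) (hb₂ i)
  have hD2 : 0 ≤ ∑ i, |C| * (b₃ i * v) :=
    Finset.sum_nonneg fun i _ => mul_nonneg (abs_nonneg _) (mul_nonneg (hb₃ i) hv0)
  have hD0 : 0 ≤ D := by linarith
  set p := ‖P‖ + 1 with hp
  have hp0 : 0 < p := by positivity
  have hPp : ∀ y, P y y ≤ p * ‖y‖ ^ 2 := fun y => by
    have h1 := (le_abs_self _).trans (P.le_opNorm₂ y y)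
    nlinarith [sq_nonneg ‖y‖]
  -- Chosen so that `k * (p / 2) = c`: the dissipation `c ‖y‖²` dominates `k` times `P y y / 2`.
  set k := 2 * c / p with hk
  have hk0 : 0 < k := by positivity
  -- The summand `2` pays for comparing `W` with `P y y / 2` at the two end points, and `(k + 1) /
  -- k` for the forcing in the differential inequality; the factor `2 / c` comes from coercivity of
  -- `P`.
  refine ⟨2 / c * (p / 2 + (2 + (k + 1) / k) * D), by positivity, k, hk0, ?_⟩
  intro Ω hΩ t₀ t₁ y hy
  -- Differentiating `M i (Ω * t) / Ω` gives `m i (Ω * t)`, so the correction cancels the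
  -- oscillating part of the derivative of `P y y / 2`. What is left is `P y (F₀ y)` and a remainder
  -- of order `1 / Ω`.
  let W : ℝ → ℝ := fun t => 1 / 2 * P (y t) (y t) - 1 / Ω * ∑ i, M i (Ω * t) * l i (y t)
  let y' : ℝ → Y := fun t => F₀ (y t) + ∑ i, m i (Ω * t) • F i (y t)
  let W' : ℝ → ℝ := fun t => P (y t) (F₀ (y t)) -
    1 / Ω * ∑ i, M i (Ω * t) * fderiv ℝ (l i) (y t) (y' t)
  have hCC : ∀ x, |x| ≤ C → |x| ≤ |C| := fun x hx => hx.trans (le_abs_self C)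
  have hy' : ∀ t ∈ Icc t₀ t₁, ‖y' t‖ ≤ v := by
    intro t ht
    refine (norm_add_le _ _).trans (add_le_add (hB₀ _ (hy t ht).1) ?_)
    refine (norm_sum_le _ _).trans (Finset.sum_le_sum fun i _ => ?_)
    rw [norm_smul, Real.norm_eq_abs]
    exact mul_le_mul (hCC _ (hmC i _)) (hB₁ i _ (hy t ht).1) (norm_nonneg _) (abs_nonneg _)
  have hW : ∀ t ∈ Icc t₀ t₁, HasDerivAt W (W' t) t := by
    intro t ht
    have hyt : HasDerivAt y (y' t) t := (hy t ht).2
    have h1 : HasDerivAt (fun t => P (y t) (y t)) (P (y' t) (y t) + P (y t) (y' t)) t := by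
      have hPy : HasDerivAt (fun t => P (y t)) (P (y' t)) t := P.hasFDerivAt.comp_hasDerivAt t hyt
      exact hPy.clm_apply hyt
    have h2 : ∀ i, HasDerivAt (fun t => M i (Ω * t) * l i (y t))
        (m i (Ω * t) * Ω * l i (y t) + M i (Ω * t) * fderiv ℝ (l i) (y t) (y' t)) t := by
      intro i
      have h3 : HasDerivAt (fun t => M i (Ω * t)) (m i (Ω * t) * Ω) t := by
        have h4 : HasDerivAt (fun t => Ω * t) Ω t := by
          simpa using (hasDerivAt_id t).const_mul Ω
        exact (hM i (Ω * t)).comp t h4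
      have h5 : HasDerivAt (fun t => l i (y t)) (fderiv ℝ (l i) (y t) (y' t)) t :=
        ((hl i).differentiable one_ne_zero (y t)).hasFDerivAt.comp_hasDerivAt t hyt
      exact h3.mul h5
    have h3 := (h1.const_mul (1 / 2 : ℝ)).sub
      ((HasDerivAt.fun_sum (u := Finset.univ) fun i _ => h2 i).const_mul (1 / Ω))
    refine h3.congr_deriv ?_
    simp only [W', Finset.sum_add_distrib, mul_add]
    have e1 : P (y t) (y' t) = P (y t) (F₀ (y t)) + ∑ i, m i (Ω * t) * l i (y t) := by
      simp only [y', map_add, map_sum, map_smul, smul_eq_mul, l]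
    have e2 : 1 / Ω * ∑ i, m i (Ω * t) * Ω * l i (y t) = ∑ i, m i (Ω * t) * l i (y t) := by
      rw [Finset.mul_sum]
      refine Finset.sum_congr rfl fun i _ => ?_
      field_simp
    rw [e2, hsymm (y' t), e1]
    ring
  have hl' : ∀ t ∈ Icc t₀ t₁, |1 / Ω * ∑ i, M i (Ω * t) * l i (y t)| ≤ D / Ω := by
    intro t ht
    rw [abs_mul, abs_of_pos (show 0 < 1 / Ω by positivity), div_mul_eq_mul_div, one_mul]
    refine div_le_div_of_nonneg_right ?_ hΩ.le
    refine (Finset.abs_sum_le_sum_abs _ _).trans ?_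
    refine (Finset.sum_le_sum fun i _ => ?_).trans (show ∑ i, |C| * b₂ i ≤ D by linarith)
    rw [abs_mul]
    exact mul_le_mul (hCC _ (hMC i _)) (hB₂ i _ (hy t ht).1) (abs_nonneg _) (abs_nonneg _)
  have hWV : ∀ t ∈ Icc t₀ t₁, |W t - 1 / 2 * P (y t) (y t)| ≤ D / Ω := by
    intro t ht
    have : W t - 1 / 2 * P (y t) (y t) = -(1 / Ω * ∑ i, M i (Ω * t) * l i (y t)) := by
      simp only [W]; ring
    rw [this, abs_neg]
    exact hl' t ht
  have hW' : ∀ t ∈ Icc t₀ t₁, W' t ≤ -k * W t + (k + 1) * D / Ω := by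
    intro t ht
    have h1 : -(1 / Ω * ∑ i, M i (Ω * t) * fderiv ℝ (l i) (y t) (y' t)) ≤ D / Ω := by
      refine (neg_le_abs _).trans ?_
      rw [abs_mul, abs_of_pos (show 0 < 1 / Ω by positivity), div_mul_eq_mul_div, one_mul]
      refine div_le_div_of_nonneg_right ?_ hΩ.le
      refine (Finset.abs_sum_le_sum_abs _ _).trans ?_
      refine (Finset.sum_le_sum fun i _ => ?_).trans
        (show ∑ i, |C| * (b₃ i * v) ≤ D by linarith)
      rw [abs_mul]
      refine mul_le_mul (hCC _ (hMC i _)) ?_ (abs_nonneg _) (abs_nonneg _)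
      rw [← Real.norm_eq_abs]
      refine ((fderiv ℝ (l i) (y t)).le_opNorm _).trans ?_
      exact mul_le_mul (hB₃ i _ (hy t ht).1) (hy' t ht) (norm_nonneg _) (hb₃ i)
    have h2 := hdec _ (hy t ht).1
    have h3 := (abs_le.1 (hWV t ht)).2
    have h4 : k * W t ≤ c * ‖y t‖ ^ 2 + k * (D / Ω) := by
      have h5 : W t ≤ p / 2 * ‖y t‖ ^ 2 + D / Ω := by linarith [hPp (y t)]
      calc k * W t ≤ k * (p / 2 * ‖y t‖ ^ 2 + D / Ω) := by gcongr
        _ = c * ‖y t‖ ^ 2 + k * (D / Ω) := by rw [hk]; field_simp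
    have h6 : (k + 1) * D / Ω = k * (D / Ω) + D / Ω := by ring
    simp only [W']
    linarith
  intro t ht
  have hmain := le_exp_neg_mul_of_deriv_le hk0 (by positivity) hW hW' ht
  have h1 := (abs_le.1 (hWV t ht)).1
  have ht₀ : t₀ ∈ Icc t₀ t₁ := ⟨le_rfl, ht.1.trans ht.2⟩
  have h2 := (abs_le.1 (hWV t₀ ht₀)).2
  have h3 : W t₀ ≤ p / 2 * ‖y t₀‖ ^ 2 + D / Ω := by linarith [hPp (y t₀)]
  have h4 := hP (y t)
  set E := Real.exp (-k * (t - t₀)) with hE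
  have hE0 : 0 < E := Real.exp_pos _
  have hE1 : E ≤ 1 := Real.exp_le_one_iff.2 (by nlinarith [ht.1])
  have hDΩ : 0 ≤ D / Ω := by positivity
  have h5 : E * W t₀ ≤ p / 2 * (E * ‖y t₀‖ ^ 2) + D / Ω := by
    calc E * W t₀ ≤ E * (p / 2 * ‖y t₀‖ ^ 2 + D / Ω) := by gcongr
      _ = p / 2 * (E * ‖y t₀‖ ^ 2) + E * (D / Ω) := by ring
      _ ≤ _ := by nlinarith
  have h6 : (k + 1) * D / Ω / k = (k + 1) / k * (D / Ω) := by field_simp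
  have h7 : c / 2 * ‖y t‖ ^ 2 ≤ p / 2 * (E * ‖y t₀‖ ^ 2) + (2 + (k + 1) / k) * (D / Ω) := by
    nlinarith
  have hN : 0 ≤ E * ‖y t₀‖ ^ 2 := by positivity
  have hΩ' : 0 < 1 / Ω := by positivity
  have h8 : c / 2 * ‖y t‖ ^ 2 ≤
      (p / 2 + (2 + (k + 1) / k) * D) * (E * ‖y t₀‖ ^ 2 + 1 / Ω) := by
    have h9 : D / Ω = D * (1 / Ω) := by ring
    have h10 : 0 ≤ (2 + (k + 1) / k) * D := by positivity
    rw [h9] at h7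
    nlinarith
  calc ‖y t‖ ^ 2 = 2 / c * (c / 2 * ‖y t‖ ^ 2) := by field_simp
    _ ≤ 2 / c * ((p / 2 + (2 + (k + 1) / k) * D) * (E * ‖y t₀‖ ^ 2 + 1 / Ω)) := by gcongr
    _ = _ := by ring

/-- Practical exponential stability of a system with rapidly oscillating coefficients whose average
has the quadratic Lyapunov function `P`. -/
theorem exists_solution_of_averaged_lyapunov [FiniteDimensional ℝ Y] {F₀ : Y → Y} {F : κ → Y → Y}
    (hF₀ : ContDiff ℝ 1 F₀) (hF : ∀ i, ContDiff ℝ 1 (F i)) {m M : κ → ℝ → ℝ}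
    (hm : ∀ i, Continuous (m i))
    (hM : ∀ i t, HasDerivAt (M i) (m i t) t) {C : ℝ} (hmC : ∀ i t, |m i t| ≤ C)
    (hMC : ∀ i t, |M i t| ≤ C) {P : Y →L[ℝ] Y →L[ℝ] ℝ} (hsymm : ∀ x y, P x y = P y x)
    {c : ℝ} (hc : 0 < c) (hP : ∀ y, c * ‖y‖ ^ 2 ≤ P y y) {r : ℝ} (hr : 0 < r)
    (hdec : ∀ y, ‖y‖ ≤ r → P y (F₀ y) ≤ -c * ‖y‖ ^ 2) :
    ∃ ρ > 0, ∃ K > 0, ∃ k > 0, ∃ Ω₀ > 0, ∀ Ω ≥ Ω₀, ∀ (t₀ : ℝ) (y₀ : Y), ‖y₀‖ ≤ ρ →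
      ∃ y : ℝ → Y, y t₀ = y₀ ∧ Continuous y ∧ (∀ t ≥ t₀, ‖y t‖ < r) ∧
        (∀ t, ‖y t‖ ≤ r → HasDerivAt y (F₀ (y t) + ∑ i, m i (Ω * t) • F i (y t)) t) ∧
        ∀ t ≥ t₀, ‖y t‖ ^ 2 ≤ K * (Real.exp (-k * (t - t₀)) * ‖y₀‖ ^ 2 + 1 / Ω) := by
  classical
  obtain ⟨K, hK, k, hk, hest⟩ :=
    exists_decay_of_averaged_lyapunov hF₀ hF hM hmC hMC hsymm hc hP hdec
  -- The cutoff makes the field bounded and globally Lipschitz without changing it on the ball of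
  -- radius `r`, so a global curve exists at once.
  let χ : ContDiffBump (0 : Y) := ⟨r, r + 1, hr, by linarith⟩
  have hχ : ∀ y, ‖y‖ ≤ r → χ y = 1 := fun y hy =>
    χ.one_of_mem_closedBall (mem_closedBall_zero_iff.2 hy)
  have cut : ∀ g : Y → Y, ContDiff ℝ 1 g → ∃ L B : NNReal,
      LipschitzWith L (fun y => χ y • g y) ∧ ∀ y, ‖χ y • g y‖ ≤ B := by
    intro g hg
    have h1 : ContDiff ℝ 1 (fun y => χ y • g y) := χ.contDiff.smul hg
    have h2 : HasCompactSupport (fun y => χ y • g y) := χ.hasCompactSupport.smul_right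
    obtain ⟨L, hL⟩ := ContDiff.lipschitzWith_of_hasCompactSupport h2 h1 one_ne_zero
    obtain ⟨B, hB⟩ := h2.exists_bound_of_continuous h1.continuous
    exact ⟨L, B.toNNReal, hL, fun y => (hB y).trans (Real.le_coe_toNNReal B)⟩
  obtain ⟨L₀, B₀, hL₀, hB₀⟩ := cut F₀ hF₀
  choose L₁ B₁ hL₁ hB₁ using fun i => cut (F i) (hF i)
  set C' : NNReal := C.toNNReal with hC'
  have hmC' : ∀ i t, ‖m i t‖ ≤ C' := fun i t => (hmC i t).trans (Real.le_coe_toNNReal C)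
  -- If `‖y₀‖²` and `1 / Ω` are both at most `R`, the decay estimate keeps `‖y‖²` strictly below
  -- `r²`; this fixes the witnesses for `ρ` and `Ω₀`.
  obtain ⟨R, hR, hRr⟩ : ∃ R > 0, K * (2 * R) < r ^ 2 :=
    ⟨r ^ 2 / (4 * K), by positivity, by
      have : K * (2 * (r ^ 2 / (4 * K))) = r ^ 2 / 2 := by field_simp; norm_num
      rw [this]; linarith [pow_pos hr 2]⟩
  refine ⟨min (Real.sqrt R) (r / 2), by positivity, K, hK, k, hk, 1 / R, by positivity, ?_⟩
  intro Ω hΩ t₀ y₀ hy₀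
  have hΩ0 : 0 < Ω := lt_of_lt_of_le (by positivity) hΩ
  have hΩR : 1 / Ω ≤ R := by
    rw [div_le_iff₀ hΩ0]
    have := mul_le_mul_of_nonneg_left hΩ hR.le
    rwa [mul_one_div_cancel hR.ne'] at this
  have hy₀R : ‖y₀‖ ^ 2 ≤ R := by
    have h1 : ‖y₀‖ ≤ Real.sqrt R := hy₀.trans (min_le_left _ _)
    calc ‖y₀‖ ^ 2 ≤ Real.sqrt R ^ 2 := by gcongr
      _ = R := Real.sq_sqrt hR.le
  have hy₀r : ‖y₀‖ < r := (hy₀.trans (min_le_right _ _)).trans_lt (by linarith)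
  let f : ℝ → Y → Y := fun t y => χ y • F₀ y + ∑ i, m i (Ω * t) • (χ y • F i y)
  have hf : ∀ t y, ‖y‖ ≤ r → f t y = F₀ y + ∑ i, m i (Ω * t) • F i y := fun t y hy => by
    simp only [f, hχ y hy, one_smul]
  have hfL : ∀ t, LipschitzWith (L₀ + ∑ i, C' * L₁ i) (f t) := by
    intro t
    refine hL₀.add ?_
    refine LipschitzWith.of_dist_le_mul fun x y => ?_
    rw [dist_eq_norm, ← Finset.sum_sub_distrib]
    push_cast
    rw [Finset.sum_mul]
    refine (norm_sum_le _ _).trans (Finset.sum_le_sum fun i _ => ?_)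
    rw [← smul_sub, norm_smul, mul_assoc]
    refine mul_le_mul (hmC' i _) ?_ (norm_nonneg _) C'.2
    rw [← dist_eq_norm]
    exact (hL₁ i).dist_le_mul x y
  have hfB : ∀ t y, ‖f t y‖ ≤ (B₀ + ∑ i, C' * B₁ i : NNReal) := by
    intro t y
    push_cast
    refine (norm_add_le _ _).trans (add_le_add (hB₀ y) ?_)
    refine (norm_sum_le _ _).trans (Finset.sum_le_sum fun i _ => ?_)
    rw [norm_smul]
    exact mul_le_mul (hmC' i _) (hB₁ i y) (norm_nonneg _) C'.2
  have hfc : ∀ y, Continuous fun t => f t y := fun y =>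
    continuous_const.add (continuous_finsetSum _ fun i _ =>
      ((hm i).comp (continuous_const.mul continuous_id)).smul continuous_const)
  obtain ⟨y, hy0, hy⟩ := exists_forall_hasDerivAt_of_lipschitzWith hfL hfc hfB t₀ y₀
  have hyc : Continuous y := continuous_iff_continuousAt.2 fun t => (hy t).continuousAt
  have hyd : ∀ t, ‖y t‖ ≤ r → HasDerivAt y (F₀ (y t) + ∑ i, m i (Ω * t) • F i (y t)) t :=
    fun t ht => hf t (y t) ht ▸ hy t
  have hstay : ∀ t ≥ t₀, ‖y t‖ < r := by
    by_contra! hcon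
    obtain ⟨t₂, ht₂, hr₂⟩ := hcon
    let S := {t | t ∈ Icc t₀ t₂ ∧ r ≤ ‖y t‖}
    have hSc : IsCompact S := by
      have : S = Icc t₀ t₂ ∩ {t | r ≤ ‖y t‖} := rfl
      rw [this]
      exact isCompact_Icc.inter_right (isClosed_le continuous_const hyc.norm)
    -- `t₁` is the first time at which the norm reaches `r`. The estimate holds up to and including
    -- `t₁`, where it contradicts `‖y t₁‖ ≥ r`.
    obtain ⟨t₁, ⟨ht₁, hr₁⟩, hmin⟩ := hSc.exists_isLeast ⟨t₂, ⟨ht₂, le_rfl⟩, hr₂⟩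
    have hlt : ∀ t ∈ Ico t₀ t₁, ‖y t‖ < r := by
      intro t ht
      by_contra! h
      exact absurd (hmin ⟨⟨ht.1, ht.2.le.trans ht₁.2⟩, h⟩) (not_le.2 ht.2)
    have hne : t₀ < t₁ := by
      rcases eq_or_lt_of_le ht₁.1 with h | h
      · rw [← h, hy0] at hr₁
        linarith
      · exact h
    have hle : ∀ t ∈ Icc t₀ t₁, ‖y t‖ ≤ r := by
      have hcl : closure (Ico t₀ t₁) ⊆ {t | ‖y t‖ ≤ r} :=
        closure_minimal (fun t ht => (hlt t ht).le) (isClosed_le hyc.norm continuous_const)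
      rwa [closure_Ico hne.ne] at hcl
    have h := hest Ω hΩ0 t₀ t₁ y (fun t ht => ⟨hle t ht, hyd t (hle t ht)⟩) t₁ ⟨hne.le, le_rfl⟩
    rw [hy0] at h
    have hE1 : Real.exp (-k * (t₁ - t₀)) ≤ 1 := Real.exp_le_one_iff.2 (by nlinarith)
    have h2 : Real.exp (-k * (t₁ - t₀)) * ‖y₀‖ ^ 2 ≤ R := by
      calc _ ≤ 1 * ‖y₀‖ ^ 2 := by gcongr
        _ ≤ R := by linarith
    have h3 : ‖y t₁‖ ^ 2 ≤ K * (2 * R) := h.trans (by gcongr; linarith)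
    have h4 : r ^ 2 ≤ ‖y t₁‖ ^ 2 := by gcongr
    linarith
  refine ⟨y, hy0, hyc, hstay, hyd, fun t ht => ?_⟩
  have := hest Ω hΩ0 t₀ t y
    (fun s hs => ⟨(hstay s hs.1).le, hyd s (hstay s hs.1).le⟩) t ⟨ht, le_rfl⟩
  rwa [hy0] at this

end Averaging

/-! ### Lyapunov function of the linearized averaged system -/

section LinearLyapunov

/-- By Young's inequality the cross terms cost at most `2 s` times the sum of squares, which is half
of `k`. It gives positivity of the Lyapunov form. -/
theorem lyapunov_scalar_pos {k s X V Q : ℝ} (hs : 0 < s) (hs1 : s ≤ 1) (hk : 4 * s ≤ k)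
    (hX : 0 ≤ X) (hV : 0 ≤ V) (hQ : 0 ≤ Q) :
    k / 2 * (X ^ 2 + V ^ 2 + Q ^ 2) ≤
      k * (X ^ 2 + V ^ 2 + Q ^ 2) - 2 * s ^ 4 * (X * V) - 2 * s ^ 6 * (Q * V) := by
  have h4 : s ^ 4 ≤ s := by simpa using pow_le_pow_of_le_one hs.le hs1 (show 1 ≤ 4 by norm_num)
  have h6 : s ^ 6 ≤ s := by simpa using pow_le_pow_of_le_one hs.le hs1 (show 1 ≤ 6 by norm_num)
  have e1 : s ^ 4 * (X * V) ≤ s * (X * V) := by gcongr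
  have e2 : s ^ 6 * (Q * V) ≤ s * (Q * V) := by gcongr
  have e3 : s * (X * V) ≤ s * ((X ^ 2 + V ^ 2) / 2) := by gcongr; linarith [sq_nonneg (X - V)]
  have e4 : s * (Q * V) ≤ s * ((Q ^ 2 + V ^ 2) / 2) := by gcongr; linarith [sq_nonneg (Q - V)]
  have e5 : 0 ≤ (k / 2 - 2 * s) * (X ^ 2 + V ^ 2 + Q ^ 2) := by
    apply mul_nonneg <;> [linarith; positivity]
  linarith [mul_nonneg hs.le (sq_nonneg X), mul_nonneg hs.le (sq_nonneg Q),
    mul_nonneg hs.le (sq_nonneg V)]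

/-- In the rescaled variables `s² V` and `s³ Q` the three dissipation terms are squares with
coefficients at least `k`, while every error term keeps a factor `s`. This is what dictates the
exponents 4 and 6. There are six error terms, at total cost at most `6 (D + 1) s` times the sum of
squares, and half of `k` absorbs them. -/
theorem lyapunov_scalar_decay {k s D X V Q : ℝ} (hs : 0 < s) (hs1 : s ≤ 1) (hD : 0 ≤ D)
    (hk1 : k ≤ 1) (hk : 12 * (D + 1) * s ≤ k) (hX : 0 ≤ X) (hV : 0 ≤ V) (hQ : 0 ≤ Q) :
    -k * X ^ 2 - s ^ 4 * V ^ 2 - k * (s ^ 6 * Q ^ 2) + s ^ 6 * V ^ 2 +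
      D * (s ^ 4 * (X * V) + s ^ 4 * (X * Q) + s ^ 4 * X ^ 2 + s ^ 6 * (Q * V) + s ^ 6 * (Q * X))
      ≤ -(k / 2 * s ^ 6) * (X ^ 2 + V ^ 2 + Q ^ 2) := by
  set y := s ^ 2 * V with hy
  set z := s ^ 3 * Q with hz
  have hy0 : 0 ≤ y := by positivity
  have hz0 : 0 ≤ z := by positivity
  have hk0 : 0 ≤ k := le_trans (by positivity) hk
  have h2 : s ^ 2 ≤ s := by simpa using pow_le_pow_of_le_one hs.le hs1 (show 1 ≤ 2 by norm_num)
  have h3 : s ^ 3 ≤ s := by simpa using pow_le_pow_of_le_one hs.le hs1 (show 1 ≤ 3 by norm_num)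
  have h4 : s ^ 4 ≤ s := by simpa using pow_le_pow_of_le_one hs.le hs1 (show 1 ≤ 4 by norm_num)
  have h6 : s ^ 6 ≤ 1 := pow_le_one₀ hs.le hs1
  have e1 : s ^ 4 * (X * V) = s ^ 2 * (X * y) := by rw [hy]; ring
  have e2 : s ^ 4 * (X * Q) = s * (X * z) := by rw [hz]; ring
  have e3 : s ^ 6 * (Q * V) = s * (z * y) := by rw [hz, hy]; ring
  have e4 : s ^ 6 * (Q * X) = s ^ 3 * (z * X) := by rw [hz]; ring
  have e5 : s ^ 6 * V ^ 2 = s ^ 2 * y ^ 2 := by rw [hy]; ring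
  have e6 : s ^ 4 * V ^ 2 = y ^ 2 := by rw [hy]; ring
  have e7 : s ^ 6 * Q ^ 2 = z ^ 2 := by rw [hz]; ring
  set S := X ^ 2 + y ^ 2 + z ^ 2 with hS
  have hS0 : 0 ≤ S := by positivity
  have f1 : s ^ 2 * (X * y) ≤ s * S := by gcongr; linarith [sq_nonneg (X - y), sq_nonneg z, sq_nonneg X, sq_nonneg y]
  have f2 : s * (X * z) ≤ s * S := by gcongr; linarith [sq_nonneg (X - z), sq_nonneg z, sq_nonneg X, sq_nonneg y]
  have f3 : s * (z * y) ≤ s * S := by gcongr; linarith [sq_nonneg (z - y), sq_nonneg z, sq_nonneg X, sq_nonneg y]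
  have f4 : s ^ 3 * (z * X) ≤ s * S := by gcongr; linarith [sq_nonneg (X - z), sq_nonneg z, sq_nonneg X, sq_nonneg y]
  have f5 : s ^ 4 * X ^ 2 ≤ s * S := by gcongr; linarith [sq_nonneg z, sq_nonneg y]
  have f6 : s ^ 2 * y ^ 2 ≤ s * S := by gcongr; linarith [sq_nonneg z, sq_nonneg X]
  have f7 : D * (s ^ 2 * (X * y) + s * (X * z) + s ^ 4 * X ^ 2 + s * (z * y) + s ^ 3 * (z * X))
      ≤ D * (5 * (s * S)) := by gcongr; linarith
  have f8 : 12 * (D + 1) * s * S ≤ k * S := by gcongr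
  have hsS : 0 ≤ s * S := by positivity
  have f9 : s ^ 6 * (X ^ 2 + V ^ 2 + Q ^ 2) ≤ S := by
    have g1 : s ^ 6 * X ^ 2 ≤ X ^ 2 := mul_le_of_le_one_left (sq_nonneg X) h6
    have g2 : s ^ 6 * V ^ 2 ≤ y ^ 2 := by
      rw [e5]; exact mul_le_of_le_one_left (sq_nonneg y) (pow_le_one₀ hs.le hs1)
    rw [hS]; linarith [e7]
  have f10 : k / 2 * (s ^ 6 * (X ^ 2 + V ^ 2 + Q ^ 2)) ≤ k / 2 * S := by gcongr
  have f11 : k * y ^ 2 ≤ y ^ 2 := mul_le_of_le_one_left (sq_nonneg y) hk1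
  rw [e1, e2, e3, e4, e5, e6, e7]
  have f12 : k * S = k * X ^ 2 + k * y ^ 2 + k * z ^ 2 := by rw [hS]; ring
  have f13 := mul_nonneg hD hsS
  clear_value S y z
  linarith

variable {E : Type*} [NormedAddCommGroup E] [InnerProductSpace ℝ E] [FiniteDimensional ℝ E]

set_option maxHeartbeats 1600000 in
/-- A quadratic Lyapunov function for a mechanical system with potential force `β H q`, dissipation
`R`, and a phase-lead compensator in the feedback loop. -/
theorem exists_lyapunov_of_phaseLead {H R : E →L[ℝ] E}
    (hH : ∀ x y, inner ℝ (H x) y = inner ℝ x (H y)) {m : ℝ} (hm : 0 < m)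
    (hHpos : ∀ x, m * ‖x‖ ^ 2 ≤ inner ℝ (H x) x) (hR : ∀ x, 0 ≤ inner ℝ (R x) x)
    {a lam b kap h c₀ : ℝ} (ha : 0 < a) (hlam : 0 < lam) (hb : 0 < b) (hkap : 0 < kap)
    (hh : 0 < h) (hgains : 0 < a * lam - b * kap) (hc₀ : 0 < c₀)
    {A : E × E × E × ℝ → E × E × E × ℝ}
    (hA : ∀ q v w η, A (q, v, w, η) = (v, -R v - b • w - (lam ^ 2 * c₀) • H q,
      -(a • w) - (kap * lam * c₀) • H q, -(h * η))) :
    ∃ (P : (E × E × E × ℝ) →L[ℝ] (E × E × E × ℝ) →L[ℝ] ℝ) (c : ℝ), 0 < c ∧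
      (∀ x y, P x y = P y x) ∧ (∀ y, c * ‖y‖ ^ 2 ≤ P y y) ∧ ∀ y, P y (A y) ≤ -c * ‖y‖ ^ 2 := by
  obtain ⟨Hi, hHi⟩ : ∃ Hi : E →L[ℝ] E, ∀ x, H (Hi x) = x := by
    have hinj : Function.Injective (H : E →ₗ[ℝ] E) := by
      rw [← LinearMap.ker_eq_bot, LinearMap.ker_eq_bot']
      intro x hx
      have h1 := hHpos x
      have hx' : H x = 0 := hx
      rw [hx', inner_zero_left] at h1
      have : ‖x‖ ^ 2 ≤ 0 := by nlinarith
      exact norm_eq_zero.1 (pow_eq_zero_iff (two_ne_zero) |>.1 (le_antisymm this (sq_nonneg _)))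
    let e := LinearEquiv.ofInjectiveEndo (H : E →ₗ[ℝ] E) hinj
    exact ⟨LinearMap.toContinuousLinearMap (e.symm : E →ₗ[ℝ] E), fun x => e.apply_symm_apply x⟩
  set β := lam ^ 2 * c₀ with hβ
  set γ := a / (kap * lam * c₀) with hγ
  -- The share of the potential force carried by `q`; the rest is carried by the auxiliary variable
  -- `z`. The gain condition is positivity of this share.
  set θ := (a * lam - b * kap) / (a * lam) with hθ
  have hβ0 : 0 < β := by positivity
  have hγ0 : 0 < γ := by positivity
  have hθ0 : 0 < θ := by positivity
  have hθ1 : 1 - θ = b * kap / (a * lam) := by rw [hθ]; field_simp; ring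
  have hθ1' : 0 < 1 - θ := by rw [hθ1]; positivity
  -- A common lower bound for the coercivity constants of the energy and of the dissipation terms.
  set k := min 1 (min (min (β * θ * m) (β * (1 - θ) * m)) (β * (1 - θ) * m * a)) with hk
  have hk0 : 0 < k := by positivity
  have hk1 : k ≤ 1 := min_le_left _ _
  have hk2 : k ≤ β * θ * m := (min_le_right _ _).trans ((min_le_left _ _).trans (min_le_left _ _))
  have hk3 : k ≤ β * (1 - θ) * m :=
    (min_le_right _ _).trans ((min_le_left _ _).trans (min_le_right _ _))
  have hk4 : k ≤ β * (1 - θ) * m * a := (min_le_right _ _).trans (min_le_right _ _)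
  set D := ‖R‖ + a + β * ‖H‖ with hD
  have hD0 : 0 ≤ D := by positivity
  set s := k / (12 * (D + 1)) with hs
  have hs0 : 0 < s := by positivity
  have hsk : 12 * (D + 1) * s = k := by rw [hs]; field_simp
  have hs12 : 12 * s ≤ k := by linarith [mul_nonneg hD0 hs0.le]
  have hs1 : s ≤ 1 := by linarith
  -- `γ` is chosen so that the `H q` term of the compensator contributes `-a q` to the derivative of
  -- `z`, whence `z' = v - a z` along `A` (`hzA`).
  let z : E × E × E × ℝ → E := fun y => y.1 + γ • Hi y.2.2.1
  have hz_add : ∀ x y, z (x + y) = z x + z y := fun x y => by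
    simp only [z, Prod.fst_add, Prod.snd_add, map_add, smul_add]; abel
  have hz_smul : ∀ (r : ℝ) x, z (r • x) = r • z x := fun r x => by
    simp only [z, Prod.smul_fst, Prod.smul_snd, map_smul, smul_add]; rw [smul_comm r γ]
  -- The energy dissipates only in `z` when `R = 0`. The derivative of `-s⁴ ⟨z, v⟩` supplies `-s⁴
  -- ‖v‖²`, and that of `s⁶ ⟨q, v⟩` supplies a negative multiple of `⟨q, H q⟩` at the smaller cost
  -- `s⁶ ‖v‖²`.
  let p : E × E × E × ℝ → E × E × E × ℝ → ℝ := fun x y =>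
    inner ℝ x.2.1 y.2.1 + β * (θ * inner ℝ x.1 (H y.1) + (1 - θ) * inner ℝ (z x) (H (z y))) -
      s ^ 4 * (inner ℝ (z x) y.2.1 + inner ℝ x.2.1 (z y)) +
      s ^ 6 * (inner ℝ x.1 y.2.1 + inner ℝ x.2.1 y.1) + x.2.2.2 * y.2.2.2
  let Pl : LinearMap.BilinForm ℝ (E × E × E × ℝ) := LinearMap.mk₂ ℝ p
    (fun x x' y => by
      simp only [p, hz_add, Prod.fst_add, Prod.snd_add, inner_add_left]; ring)
    (fun r x y => by
      simp only [p, hz_smul, Prod.smul_fst, Prod.smul_snd, real_inner_smul_left, smul_eq_mul]; ring)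
    (fun x y y' => by
      simp only [p, hz_add, Prod.fst_add, Prod.snd_add, inner_add_right, map_add]; ring)
    (fun r x y => by
      simp only [p, hz_smul, Prod.smul_fst, Prod.smul_snd, real_inner_smul_right, smul_eq_mul,
        map_smul]; ring)
  have hsym : ∀ x y, p x y = p y x := by
    intro x y
    simp only [p]
    rw [real_inner_comm y.2.1 x.2.1, ← hH, real_inner_comm y.1 (H x.1), ← hH (z x),
      real_inner_comm (z y) (H (z x)), real_inner_comm y.2.1 (z x), real_inner_comm (z y) x.2.1,
      real_inner_comm y.2.1 x.1, real_inner_comm y.1 x.2.1]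
    ring
  set μ := 1 + 2 * (‖H‖ / γ) ^ 2 with hμ
  have hμ0 : 0 < μ := by positivity
  -- The product carries the maximum norm; its component `w` is recovered from `γ w = H (z - q)`.
  have hnorm : ∀ y : E × E × E × ℝ,
      ‖y‖ ^ 2 ≤ μ * (‖z y‖ ^ 2 + ‖y.2.1‖ ^ 2 + ‖y.1‖ ^ 2) + y.2.2.2 ^ 2 := by
    rintro ⟨q, v, w, η⟩
    have hw : ‖w‖ ^ 2 ≤ 2 * (‖H‖ / γ) ^ 2 * (‖z (q, v, w, η)‖ ^ 2 + ‖q‖ ^ 2) := by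
      have e1 : γ • w = H (z (q, v, w, η) - q) := by
        simp only [z, add_sub_cancel_left, map_smul, hHi]
      have e2 : γ * ‖w‖ ≤ ‖H‖ * (‖z (q, v, w, η)‖ + ‖q‖) := by
        calc γ * ‖w‖ = ‖γ • w‖ := by rw [norm_smul, Real.norm_of_nonneg hγ0.le]
          _ ≤ ‖H‖ * ‖z (q, v, w, η) - q‖ := by rw [e1]; exact H.le_opNorm _
          _ ≤ _ := by gcongr; exact norm_sub_le _ _
      have e3 : ‖w‖ ≤ ‖H‖ / γ * (‖z (q, v, w, η)‖ + ‖q‖) := by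
        rw [div_mul_eq_mul_div, le_div_iff₀ hγ0]; linarith
      calc ‖w‖ ^ 2 ≤ (‖H‖ / γ * (‖z (q, v, w, η)‖ + ‖q‖)) ^ 2 := by gcongr
        _ = (‖H‖ / γ) ^ 2 * (‖z (q, v, w, η)‖ + ‖q‖) ^ 2 := by ring
        _ ≤ (‖H‖ / γ) ^ 2 * (2 * (‖z (q, v, w, η)‖ ^ 2 + ‖q‖ ^ 2)) := by
          gcongr; linarith [sq_nonneg (‖z (q, v, w, η)‖ - ‖q‖)]
        _ = _ := by ring
    have hq0 := sq_nonneg ‖q‖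
    have hv0 := sq_nonneg ‖v‖
    have hw0 := sq_nonneg ‖w‖
    have hz0 := sq_nonneg ‖z (q, v, w, η)‖
    have hη0 := sq_nonneg η
    have hB0 := sq_nonneg (‖H‖ / γ)
    have htot : ‖q‖ ^ 2 + ‖v‖ ^ 2 + ‖w‖ ^ 2 + η ^ 2 ≤
        μ * (‖z (q, v, w, η)‖ ^ 2 + ‖v‖ ^ 2 + ‖q‖ ^ 2) + η ^ 2 := by
      rw [hμ]; linarith [mul_nonneg hB0 hv0]
    refine le_trans ?_ htot
    simp only [Prod.norm_def]
    rcases max_choice ‖q‖ (max ‖v‖ (max ‖w‖ ‖η‖)) with h1 | h1 <;> rw [h1]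
    · linarith
    rcases max_choice ‖v‖ (max ‖w‖ ‖η‖) with h2 | h2 <;> rw [h2]
    · linarith
    rcases max_choice ‖w‖ ‖η‖ with h3 | h3 <;> rw [h3]
    · linarith
    rw [Real.norm_eq_abs, sq_abs]
    linarith
  -- The three entries serve the decay in `z`, `v`, `q`, the decay in `η`, and the positivity in
  -- `η`.
  set c₁ := min (k / 2 * s ^ 6) (min h 1) with hc₁
  have hc₁0 : 0 < c₁ := by positivity
  have hfin : ∀ y : E × E × E × ℝ, c₁ / (μ + 1) * ‖y‖ ^ 2 ≤
      c₁ * (‖z y‖ ^ 2 + ‖y.2.1‖ ^ 2 + ‖y.1‖ ^ 2) + c₁ * y.2.2.2 ^ 2 := by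
    intro y
    rw [div_mul_eq_mul_div, div_le_iff₀ (by positivity)]
    have h1 : 0 ≤ ‖z y‖ ^ 2 + ‖y.2.1‖ ^ 2 + ‖y.1‖ ^ 2 := by positivity
    have h2 := sq_nonneg y.2.2.2
    have h3 := mul_le_mul_of_nonneg_left (hnorm y) hc₁0.le
    have h4 := mul_nonneg hc₁0.le h1
    have h5 := mul_nonneg hμ0.le (mul_nonneg hc₁0.le h2)
    generalize ‖z y‖ ^ 2 + ‖y.2.1‖ ^ 2 + ‖y.1‖ ^ 2 = S at *
    linarith
  refine ⟨Pl.toContinuousBilinearMap, c₁ / (μ + 1), by positivity, hsym, ?_, ?_⟩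
  · intro y
    change _ ≤ p y y
    refine (hfin y).trans ?_
    have h1 := lyapunov_scalar_pos hs0 hs1 (by linarith : 4 * s ≤ k) (norm_nonneg (z y))
      (norm_nonneg y.2.1) (norm_nonneg y.1)
    have h2 : c₁ ≤ k / 2 := (min_le_left _ _).trans
      (mul_le_of_le_one_right (by positivity) (pow_le_one₀ hs0.le hs1))
    have h3 : c₁ ≤ 1 := (min_le_right _ _).trans (min_le_right _ _)
    have h4 : c₁ * (‖z y‖ ^ 2 + ‖y.2.1‖ ^ 2 + ‖y.1‖ ^ 2) ≤
      k / 2 * (‖z y‖ ^ 2 + ‖y.2.1‖ ^ 2 + ‖y.1‖ ^ 2) := by gcongr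
    have h5 : c₁ * y.2.2.2 ^ 2 ≤ y.2.2.2 * y.2.2.2 := by
      rw [← sq]; exact mul_le_of_le_one_left (sq_nonneg _) h3
    have h6 := real_inner_le_norm (z y) y.2.1
    have h7 := (abs_le.1 (abs_real_inner_le_norm y.1 y.2.1)).1
    have h6' := real_inner_comm (z y) y.2.1
    have h7' := real_inner_comm y.1 y.2.1
    have h8 := hHpos y.1
    have h9 := hHpos (z y)
    rw [hH] at h8 h9
    have h10 : k * ‖y.1‖ ^ 2 ≤ β * θ * inner ℝ y.1 (H y.1) := by
      calc k * ‖y.1‖ ^ 2 ≤ β * θ * m * ‖y.1‖ ^ 2 := by gcongr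
        _ = β * θ * (m * ‖y.1‖ ^ 2) := by ring
        _ ≤ _ := by gcongr
    have h11 : k * ‖z y‖ ^ 2 ≤ β * (1 - θ) * inner ℝ (z y) (H (z y)) := by
      calc k * ‖z y‖ ^ 2 ≤ β * (1 - θ) * m * ‖z y‖ ^ 2 := by gcongr
        _ = β * (1 - θ) * (m * ‖z y‖ ^ 2) := by ring
        _ ≤ _ := by gcongr
    have h12 : k * ‖y.2.1‖ ^ 2 ≤ ‖y.2.1‖ ^ 2 := mul_le_of_le_one_left (sq_nonneg _) hk1
    have h13 := mul_le_mul_of_nonneg_left h6 (pow_pos hs0 4).le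
    have h14 := mul_le_mul_of_nonneg_left h7 (pow_pos hs0 6).le
    simp only [p]
    rw [h6', h7', real_inner_self_eq_norm_sq]
    linarith
  · rintro ⟨q, v, w, η⟩
    change p _ _ ≤ _
    rw [neg_mul]
    refine le_trans ?_ (neg_le_neg (hfin _))
    set x := z (q, v, w, η) with hx
    have hwx : b • w = (β * (1 - θ)) • H (x - q) := by
      have e1 : H (x - q) = γ • w := by
        simp only [hx, z, add_sub_cancel_left, map_smul, hHi]
      rw [e1, smul_smul, hθ1, hβ, hγ]
      congr 1
      field_simp
    have hv' : -R v - b • w - β • H q = -R v - β • H (θ • q + (1 - θ) • x) := by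
      rw [hwx]
      simp only [map_add, map_sub, map_smul]
      module
    have hzA : z (A (q, v, w, η)) = v - a • x := by
      have e2 : Hi (H q) = q := by
        have e3 : H (Hi (H q) - q) = 0 := by rw [map_sub, hHi, sub_self]
        have h1 := hHpos (Hi (H q) - q)
        rw [e3, inner_zero_left] at h1
        have : ‖Hi (H q) - q‖ ^ 2 ≤ 0 := by nlinarith
        exact sub_eq_zero.1 (norm_eq_zero.1
          (pow_eq_zero_iff (two_ne_zero) |>.1 (le_antisymm this (sq_nonneg _))))
      have e4 : γ * (kap * lam * c₀) = a := by rw [hγ]; field_simp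
      simp only [hA, hx, z, map_sub, map_neg, map_smul, e2, smul_sub, smul_smul, smul_neg, e4,
        smul_add]
      rw [mul_comm a γ]
      abel
    have hAe := hA q v w η
    rw [hv'] at hAe
    rw [hAe] at hzA
    simp only [p, hzA, hAe, ← hx]
    -- The potential terms here cancel those from `q' = v` and from the `v` in `z' = v - a z`; `-⟨R
    -- v, v⟩` and a negative multiple of `⟨z, H z⟩` survive.
    have i1 : inner ℝ v (-R v - β • H (θ • q + (1 - θ) • x)) =
        -inner ℝ (R v) v - β * (θ * inner ℝ q (H v) + (1 - θ) * inner ℝ x (H v)) := by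
      simp only [inner_sub_right, inner_neg_right, map_add, map_smul, inner_add_right,
        real_inner_smul_right]
      rw [← hH v q, ← hH v x, real_inner_comm q, real_inner_comm x, real_inner_comm v]
    have i2 : inner ℝ x (-R v - β • H (θ • q + (1 - θ) • x)) =
        -inner ℝ x (R v) - β * (θ * inner ℝ x (H q) + (1 - θ) * inner ℝ x (H x)) := by
      simp only [inner_sub_right, inner_neg_right, map_add, map_smul, inner_add_right,
        real_inner_smul_right]
    have i3 : inner ℝ q (-R v - β • H (θ • q + (1 - θ) • x)) =
        -inner ℝ q (R v) - β * (θ * inner ℝ q (H q) + (1 - θ) * inner ℝ q (H x)) := by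
      simp only [inner_sub_right, inner_neg_right, map_add, map_smul, inner_add_right,
        real_inner_smul_right]
    rw [i1, i2, i3]
    simp only [map_sub, map_smul, inner_sub_right, real_inner_smul_right,
      real_inner_self_eq_norm_sq]
    have j0 := hR v
    have j1 := hHpos q
    have j2 := hHpos x
    rw [hH] at j1 j2
    have bd : ∀ (T : E →L[ℝ] E) (y y' : E), |inner ℝ y (T y')| ≤ ‖T‖ * (‖y‖ * ‖y'‖) :=
      fun T y y' => (abs_real_inner_le_norm _ _).trans (by
        calc ‖y‖ * ‖T y'‖ ≤ ‖y‖ * (‖T‖ * ‖y'‖) := by gcongr; exact T.le_opNorm _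
          _ = _ := by ring)
    have j3 := (abs_le.1 (bd R x v)).2
    have j4 := (abs_le.1 (bd H x q)).2
    have j5 := (abs_le.1 (bd H x x)).2
    have j6 := (abs_le.1 (bd R q v)).1
    have j7 := (abs_le.1 (bd H q x)).1
    have j8 := (real_inner_comm v x).trans_le ((real_inner_le_norm v x))
    have k1 := lyapunov_scalar_decay hs0 hs1 hD0 hk1 hsk.le (norm_nonneg x) (norm_nonneg v)
      (norm_nonneg q)
    set X := ‖x‖ with hX
    set V := ‖v‖ with hV
    set Q := ‖q‖ with hQ
    have hX0 : 0 ≤ X := norm_nonneg _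
    have hV0 : 0 ≤ V := norm_nonneg _
    have hQ0 : 0 ≤ Q := norm_nonneg _
    have hθ1'' : θ ≤ 1 := by linarith
    have hθ0' : 1 - θ ≤ 1 := by linarith
    have hRD : ‖R‖ + a ≤ D := by rw [hD]; linarith [mul_nonneg hβ0.le (norm_nonneg H)]
    have hRD' : ‖R‖ ≤ D := by linarith
    have hHD : β * ‖H‖ ≤ D := by rw [hD]; linarith [norm_nonneg R]
    have weight : ∀ {d i N : ℝ}, 0 ≤ d → d ≤ 1 → 0 ≤ N → i ≤ ‖H‖ * N → β * (d * i) ≤ D * N := by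
      intro d i N hd hd1 hN hi
      calc β * (d * i) ≤ β * (d * (‖H‖ * N)) := by gcongr
        _ = d * (β * ‖H‖ * N) := by ring
        _ ≤ 1 * (β * ‖H‖ * N) := by gcongr
        _ ≤ D * N := by rw [one_mul]; gcongr
    -- `t1` to `t5` bound the five products that carry the factor `D` in `lyapunov_scalar_decay`;
    -- `t6` and `t7` supply its dissipation in `q` and `z`.
    have t1 : s ^ 4 * (inner ℝ x (R v) + a * inner ℝ v x) ≤ D * (s ^ 4 * (X * V)) := by
      calc s ^ 4 * (inner ℝ x (R v) + a * inner ℝ v x)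
          ≤ s ^ 4 * (‖R‖ * (X * V) + a * (V * X)) := by
            gcongr; exact real_inner_le_norm v x
        _ = (‖R‖ + a) * (s ^ 4 * (X * V)) := by ring
        _ ≤ _ := by gcongr
    have t2 : s ^ 4 * (β * (θ * inner ℝ x (H q))) ≤ s ^ 4 * (D * (X * Q)) := by
      exact mul_le_mul_of_nonneg_left (weight hθ0.le hθ1'' (by positivity) j4) (by positivity)
    have t3 : s ^ 4 * (β * ((1 - θ) * inner ℝ x (H x))) ≤ s ^ 4 * (D * (X * X)) := by
      exact mul_le_mul_of_nonneg_left (weight hθ1'.le hθ0' (by positivity) j5) (by positivity)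
    have t4 : s ^ 6 * (-inner ℝ q (R v)) ≤ s ^ 6 * (D * (Q * V)) := by
      gcongr
      calc -inner ℝ q (R v) ≤ ‖R‖ * (Q * V) := by linarith
        _ ≤ _ := by gcongr
    have t5 : s ^ 6 * (β * ((1 - θ) * (-inner ℝ q (H x)))) ≤ s ^ 6 * (D * (Q * X)) := by
      exact mul_le_mul_of_nonneg_left (weight hθ1'.le hθ0' (by positivity) (by linarith)) (by positivity)
    have t6 : s ^ 6 * (k * Q ^ 2) ≤ s ^ 6 * (β * (θ * inner ℝ q (H q))) := by
      refine mul_le_mul_of_nonneg_left ?_ (by positivity)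
      calc k * Q ^ 2 ≤ β * θ * m * Q ^ 2 := by gcongr
        _ = β * (θ * (m * Q ^ 2)) := by ring
        _ ≤ _ := by gcongr
    have t7 : k * X ^ 2 ≤ β * ((1 - θ) * (a * inner ℝ x (H x))) := by
      calc k * X ^ 2 ≤ β * (1 - θ) * m * a * X ^ 2 := by gcongr
        _ = β * ((1 - θ) * (a * (m * X ^ 2))) := by ring
        _ ≤ _ := by gcongr
    have t8 : c₁ * (X ^ 2 + V ^ 2 + Q ^ 2) ≤ k / 2 * s ^ 6 * (X ^ 2 + V ^ 2 + Q ^ 2) := by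
      gcongr; exact min_le_left _ _
    have t9 : c₁ * η ^ 2 ≤ h * η ^ 2 := by
      gcongr; exact (min_le_right _ _).trans (min_le_left _ _)
    clear_value X V Q c₁
    generalize inner ℝ x (R v) = r1 at *
    generalize inner ℝ v x = r2 at *
    generalize inner ℝ x (H q) = r3 at *
    generalize inner ℝ x (H x) = r4 at *
    generalize inner ℝ q (R v) = r5 at *
    generalize inner ℝ q (H x) = r6 at *
    generalize inner ℝ q (H q) = r7 at *
    generalize inner ℝ q (H v) = r8 at *
    generalize inner ℝ x (H v) = r9 at *
    generalize inner ℝ (R v) v = r10 at *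
    clear i1 i2 i3 hAe hfin hnorm
    linarith

end LinearLyapunov

/-! ### Zero-mean antiderivatives of periodic signals -/

section PeriodicSignals

open Set MeasureTheory

/-- A continuous periodic function with zero mean has a bounded antiderivative. -/
theorem Function.Periodic.exists_bounded_antiderivative {m : ℝ → ℝ} {T : ℝ}
    (hper : Function.Periodic m T) (hT : 0 < T) (hm : Continuous m)
    (hmean : ∫ τ in (0 : ℝ)..T, m τ = 0) :
    ∃ (M : ℝ → ℝ) (C : ℝ), (∀ t, HasDerivAt M (m t) t) ∧ (∀ t, |m t| ≤ C) ∧ ∀ t, |M t| ≤ C := by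
  have hint : ∀ a b, IntervalIntegrable m volume a b := fun a b => hm.intervalIntegrable a b
  let M : ℝ → ℝ := fun t => ∫ τ in (0 : ℝ)..t, m τ
  have hM : ∀ t, HasDerivAt M (m t) t := fun t => hm.integral_hasStrictDerivAt 0 t |>.hasDerivAt
  have hMper : Function.Periodic M T := fun t => by
    have h1 := hper.intervalIntegral_add_eq t 0
    rw [zero_add, hmean] at h1
    simp only [M]
    rw [← intervalIntegral.integral_add_adjacent_intervals (hint 0 t) (hint t (t + T)), h1,
      add_zero]
  have hMc : Continuous M := continuous_iff_continuousAt.2 fun t => (hM t).continuousAt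
  have bound : ∀ g : ℝ → ℝ, Function.Periodic g T → Continuous g → ∃ C, ∀ t, |g t| ≤ C := by
    intro g hg hgc
    obtain ⟨C, hC⟩ := (isCompact_Icc (a := (0 : ℝ)) (b := T)).exists_bound_of_continuousOn
      hgc.continuousOn
    refine ⟨C, fun t => ?_⟩
    obtain ⟨s, hs, hst⟩ := hg.exists_mem_Ico₀ hT t
    rw [hst]
    exact hC s (Ico_subset_Icc_self hs)
  obtain ⟨C₁, hC₁⟩ := bound m hper hm
  obtain ⟨C₂, hC₂⟩ := bound M hMper hMc
  exact ⟨M, max C₁ C₂, hM, fun t => (hC₁ t).trans (le_max_left _ _),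
    fun t => (hC₂ t).trans (le_max_right _ _)⟩

variable {n : ℕ} {T : ℝ} {u : ℝ → EuclideanSpace ℝ (Fin n)}

theorem intervalIntegrable_of_measurable_bounded (hu_meas : Measurable u) {C : ℝ}
    (hC : ∀ τ, ‖u τ‖ ≤ C) (a b : ℝ) : IntervalIntegrable u volume a b :=
  (intervalIntegrable_const (c := C)).mono_fun' hu_meas.aestronglyMeasurable
    (Filter.Eventually.of_forall hC)

theorem lipschitzWith_zeroMeanAntiderivative (hu_meas : Measurable u) {C : ℝ}
    (hC : ∀ τ, ‖u τ‖ ≤ C) : LipschitzWith C.toNNReal (zeroMeanAntiderivative T u) := by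
  have hint := intervalIntegrable_of_measurable_bounded hu_meas hC
  refine LipschitzWith.of_dist_le_mul fun x y => ?_
  rw [dist_eq_norm, zeroMeanAntiderivative, zeroMeanAntiderivative, sub_sub_sub_cancel_right,
    intervalIntegral.integral_interval_sub_left (hint _ _) (hint _ _), Real.dist_eq]
  exact (intervalIntegral.norm_integral_le_of_norm_le_const fun τ _ => hC τ).trans (by
    gcongr; exact Real.le_coe_toNNReal C)

theorem periodic_zeroMeanAntiderivative (hu_meas : Measurable u) {C : ℝ}
    (hC : ∀ τ, ‖u τ‖ ≤ C) (hu_per : Function.Periodic u T)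
    (hu_mean : ∫ τ in (0 : ℝ)..T, u τ = 0) :
    Function.Periodic (zeroMeanAntiderivative T u) T := by
  have hint := intervalIntegrable_of_measurable_bounded hu_meas hC
  intro t
  have h1 := hu_per.intervalIntegral_add_eq t 0
  rw [zero_add, hu_mean] at h1
  simp only [zeroMeanAntiderivative]
  rw [← intervalIntegral.integral_add_adjacent_intervals (hint 0 t) (hint t (t + T)), h1,
    add_zero]

theorem integral_zeroMeanAntiderivative (hT : 0 < T) (hu_meas : Measurable u) {C : ℝ}
    (hC : ∀ τ, ‖u τ‖ ≤ C) : ∫ τ in (0 : ℝ)..T, zeroMeanAntiderivative T u τ = 0 := by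
  have hint := intervalIntegrable_of_measurable_bounded hu_meas hC
  simp only [zeroMeanAntiderivative]
  rw [intervalIntegral.integral_sub
    ((intervalIntegral.continuous_primitive hint 0).intervalIntegrable _ _)
    intervalIntegrable_const, intervalIntegral.integral_const, sub_zero, smul_smul,
    mul_inv_cancel₀ hT.ne', one_smul, sub_self]

theorem ae_hasDerivAt_zeroMeanAntiderivative (hu_meas : Measurable u) {C : ℝ}
    (hC : ∀ τ, ‖u τ‖ ≤ C) : ∀ᵐ τ, HasDerivAt (zeroMeanAntiderivative T u) (u τ) τ := by
  have hloc : LocallyIntegrable u volume := fun x => by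
    refine ⟨Icc (x - 1) (x + 1), Icc_mem_nhds (by linarith) (by linarith), ?_⟩
    have := (intervalIntegrable_of_measurable_bounded hu_meas hC (x - 1) (x + 1))
    rwa [intervalIntegrable_iff_integrableOn_Icc_of_le (by linarith)] at this
  filter_upwards [LocallyIntegrable.ae_hasDerivAt_integral hloc] with τ hτ
  exact (hτ 0).sub_const _

theorem exists_norm_zeroMeanAntiderivative_le (hT : 0 < T) (hu_meas : Measurable u) {C : ℝ}
    (hC : ∀ τ, ‖u τ‖ ≤ C) (hu_per : Function.Periodic u T)
    (hu_mean : ∫ τ in (0 : ℝ)..T, u τ = 0) : ∃ C', ∀ τ, ‖zeroMeanAntiderivative T u τ‖ ≤ C' := by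
  obtain ⟨C', hC'⟩ := (isCompact_Icc (a := (0 : ℝ)) (b := T)).exists_bound_of_continuousOn
    (lipschitzWith_zeroMeanAntiderivative (T := T) hu_meas hC).continuous.continuousOn
  refine ⟨C', fun t => ?_⟩
  obtain ⟨s, hs, hst⟩ :=
    (periodic_zeroMeanAntiderivative hu_meas hC hu_per hu_mean).exists_mem_Ico₀ hT t
  rw [hst]
  exact hC' s (Ico_subset_Icc_self hs)

/-- The zero-mean signals that remain after averaging: the components of the perturbation and the
deviations of their products from the mean. -/
def residualSignal (U : ℝ → EuclideanSpace ℝ (Fin n)) : Fin n ⊕ Fin n × Fin n → ℝ → ℝ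
  | Sum.inl i, τ => U τ i
  | Sum.inr p, τ => U τ p.1 * U τ p.2 - if p.1 = p.2 then 1 else 0

theorem continuous_residualSignal {U : ℝ → EuclideanSpace ℝ (Fin n)} (hU : Continuous U)
    (k : Fin n ⊕ Fin n × Fin n) : Continuous (residualSignal U k) := by
  have h : ∀ i, Continuous fun τ => U τ i := fun i =>
    (PiLp.continuous_apply 2 _ i).comp hU
  rcases k with i | p
  · exact h i
  · exact ((h p.1).mul (h p.2)).sub continuous_const

/-- The zero mean of `U` and its normalized second moments say that every residual signal has zero
mean over a period, so its primitive is periodic and therefore bounded. Finiteness of the index set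
gives one constant for all. -/
theorem exists_antiderivative_residualSignal (hT : 0 < T)
    {U : ℝ → EuclideanSpace ℝ (Fin n)} (hU : Continuous U) (hper : Function.Periodic U T)
    (hmean : ∫ τ in (0 : ℝ)..T, U τ = 0)
    (hcov : ∀ i j, T⁻¹ * (∫ τ in (0 : ℝ)..T, U τ i * U τ j) = if i = j then 1 else 0) :
    ∃ (M : Fin n ⊕ Fin n × Fin n → ℝ → ℝ) (C : ℝ),
      (∀ k t, HasDerivAt (M k) (residualSignal U k t) t) ∧
      (∀ k t, |residualSignal U k t| ≤ C) ∧ ∀ k t, |M k t| ≤ C := by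
  have key : ∀ k, ∃ (M : ℝ → ℝ) (C : ℝ), (∀ t, HasDerivAt M (residualSignal U k t) t) ∧
      (∀ t, |residualSignal U k t| ≤ C) ∧ ∀ t, |M t| ≤ C := by
    intro k
    refine Function.Periodic.exists_bounded_antiderivative ?_ hT
      (continuous_residualSignal hU k) ?_
    · rcases k with i | p <;> intro t <;> simp only [residualSignal, hper t]
    · rcases k with i | p
      · have h1 := (EuclideanSpace.proj (𝕜 := ℝ) i).intervalIntegral_comp_comm
          (hU.intervalIntegrable (μ := volume) 0 T)
        rw [hmean, map_zero] at h1
        exact h1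
      · have h : ∀ i, Continuous fun τ => U τ i := fun i => (PiLp.continuous_apply 2 _ i).comp hU
        simp only [residualSignal]
        rw [intervalIntegral.integral_sub
            ((show Continuous fun τ => U τ p.1 * U τ p.2 from (h p.1).mul (h p.2)).intervalIntegrable _ _)
          intervalIntegrable_const, intervalIntegral.integral_const, sub_zero, smul_eq_mul,
          ← hcov p.1 p.2, mul_inv_cancel_left₀ hT.ne', sub_self]
  choose M C hM hm hMb using key
  refine ⟨M, ∑ k, |C k|, hM, fun k t => (hm k t).trans ?_, fun k t => (hMb k t).trans ?_⟩ <;>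
    exact (le_abs_self _).trans
      (Finset.single_le_sum (f := fun k => |C k|) (fun _ _ => abs_nonneg _) (Finset.mem_univ k))

end PeriodicSignals

noncomputable section

/-! ### Injectivity of the differential of the embedding -/

section Immersion

open Filter

variable {n N : ℕ} {G : Type*} [TopologicalSpace G] [ChartedSpace (EuclideanSpace ℝ (Fin n)) G]

/-- The differential of an immersion is injective. -/
theorem injective_mvfderiv_of_isSmoothEmbedding {ι : G → EuclideanSpace ℝ (Fin N)}
    (hι : Manifold.IsSmoothEmbedding (𝓡 n) (𝓡 N) ∞ ι) (g : G) :
    Function.Injective (mvfderiv (𝓡 n) ι g) := by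
  have h := hι.isImmersion.isImmersionAt g
  have hdom := h.domChart_mem_maximalAtlas
  have hcod := h.codChart_mem_maximalAtlas
  have hsrc := h.source_subset_preimage_source
  have hw := h.writtenInCharts
  have hg := h.mem_domChart_source
  have hιg := h.mem_codChart_source
  -- In adapted charts the embedding is `x ↦ (x, 0)`. Projecting to the first factor therefore gives
  -- a local left inverse `s`, and the chain rule gives a left inverse of the differential.
  let c : EuclideanSpace ℝ (Fin N) → EuclideanSpace ℝ (Fin n) := fun y => (h.equiv.symm y).1
  have hc : ∀ y, MDifferentiableAt (𝓡 N) (𝓡 n) c y := fun y => by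
    have : DifferentiableAt ℝ c y :=
      DifferentiableAt.comp y differentiableAt_fst h.equiv.symm.differentiableAt
    exact this.mdifferentiableAt
  have hc1 : ∀ g' ∈ h.domChart.source, c (h.codChart (ι g')) = h.domChart g' := by
    intro g' hg'
    have h1 := hw (x := h.domChart g') (by
      simp only [OpenPartialHomeomorph.extend, PartialEquiv.trans_target]
      simpa using h.domChart.map_source hg')
    simp only [Function.comp_apply, OpenPartialHomeomorph.extend_coe,
      OpenPartialHomeomorph.extend_coe_symm] at h1
    have h2 : h.codChart (ι g') = h.equiv (h.domChart g', 0) := by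
      simpa [h.domChart.left_inv hg'] using h1
    simp [c, h2]
  let s : EuclideanSpace ℝ (Fin N) → G := fun y => h.domChart.symm (c (h.codChart y))
  have hs : s ∘ ι =ᶠ[𝓝 g] id := by
    filter_upwards [h.domChart.open_source.mem_nhds hg] with g' hg'
    simp only [s, Function.comp_apply, hc1 g' hg', h.domChart.left_inv hg', id]
  have hι' : MDifferentiableAt (𝓡 n) (𝓡 N) ι g :=
    (hι.isImmersion.contMDiff.mdifferentiable (by simp)) g
  have hs' : MDifferentiableAt (𝓡 N) (𝓡 n) s (ι g) := by
    have h1 : MDifferentiableAt (𝓡 N) (𝓡 N) h.codChart (ι g) :=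
      mdifferentiableAt_of_mem_maximalAtlas
        (IsManifold.maximalAtlas_subset_of_le (by norm_cast) hcod) hιg
    have h2 : MDifferentiableAt (𝓡 n) (𝓡 n) h.domChart.symm (c (h.codChart (ι g))) := by
      rw [hc1 g hg]
      exact mdifferentiableAt_symm_of_mem_maximalAtlas
        (IsManifold.maximalAtlas_subset_of_le (by norm_cast) hdom)
        (h.domChart.map_source hg)
    exact MDifferentiableAt.comp (g := h.domChart.symm) (f := c ∘ h.codChart) (ι g) h2
      (MDifferentiableAt.comp (g := c) (f := h.codChart) (ι g) (hc _) h1)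
  have h3 := (HasMFDerivAt.comp g hs'.hasMFDerivAt hι'.hasMFDerivAt).congr_of_eventuallyEq hs.symm
  have h4 := hasMFDerivAt_unique h3 (hasMFDerivAt_id g)
  intro X Y hXY
  have h5 := congrArg (fun A : EuclideanSpace ℝ (Fin n) →L[ℝ] EuclideanSpace ℝ (Fin n) => A X) h4
  have h6 := congrArg (fun A : EuclideanSpace ℝ (Fin n) →L[ℝ] EuclideanSpace ℝ (Fin n) => A Y) h4
  refine h5.symm.trans (Eq.trans ?_ h6)
  exact congrArg (fun Z : EuclideanSpace ℝ (Fin N) => (mfderiv (𝓡 N) (𝓡 n) s (ι g) :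
    EuclideanSpace ℝ (Fin N) →L[ℝ] EuclideanSpace ℝ (Fin n)) Z) hXY

end Immersion

/-! ### Local coordinates adapted to the left-invariant frame -/

section LocalCoordinates

open Set Filter

variable {n : ℕ} {G : Type*} [TopologicalSpace G] [ChartedSpace (EuclideanSpace ℝ (Fin n)) G]
  [Group G]

/-- The continuous linear equivalence between `ℝ^n` and the Lie algebra that is given by a basis. -/
def fromCoordsEquiv (e : Module.Basis (Fin n) ℝ (GroupLieAlgebra (𝓡 n) G)) :
    EuclideanSpace ℝ (Fin n) ≃L[ℝ] GroupLieAlgebra (𝓡 n) G :=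
  LinearEquiv.toContinuousLinearEquiv
    ((WithLp.linearEquiv 2 ℝ (Fin n → ℝ)).trans e.equivFun.symm :
      EuclideanSpace ℝ (Fin n) ≃ₗ[ℝ] EuclideanSpace ℝ (Fin n))

theorem fromCoordsEquiv_apply (e : Module.Basis (Fin n) ℝ (GroupLieAlgebra (𝓡 n) G))
    (v : EuclideanSpace ℝ (Fin n)) : fromCoordsEquiv e v = fromCoords e v := by
  change e.equivFun.symm (WithLp.ofLp v) = _
  rw [Module.Basis.equivFun_symm_apply]
  rfl

variable [LieGroup (𝓡 n) ∞ G]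

instance isManifold_of_lieGroup : IsManifold (𝓡 n) ∞ G :=
  (inferInstance : ContMDiffMul (𝓡 n) ∞ G).toIsManifold

instance isManifold_one_of_lieGroup : IsManifold (𝓡 n) 1 G :=
  IsManifold.of_le (n := ∞) (by norm_cast)

/-- The frame of left-invariant vector fields that is given by a basis of the Lie algebra. -/
def leftFrame (e : Module.Basis (Fin n) ℝ (GroupLieAlgebra (𝓡 n) G)) (g : G) :
    EuclideanSpace ℝ (Fin n) ≃L[ℝ] EuclideanSpace ℝ (Fin n) :=
  (fromCoordsEquiv e).trans (ContinuousLinearEquiv.equivOfInverse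
    (leftTranslate (n := n) g) (leftUntranslate g) (leftUntranslate_leftTranslate g)
    (leftTranslate_leftUntranslate g))

theorem leftFrame_apply (e : Module.Basis (Fin n) ℝ (GroupLieAlgebra (𝓡 n) G)) (g : G)
    (v : EuclideanSpace ℝ (Fin n)) : leftFrame e g v = leftTranslate g (fromCoords e v) := by
  rw [← fromCoordsEquiv_apply]
  rfl

variable (e : Module.Basis (Fin n) ℝ (GroupLieAlgebra (𝓡 n) G)) (g₀ : G)

/-- Local coordinates centered at `g₀`, whose differential at `g₀` inverts the left frame. -/
def coordMap (g : G) : EuclideanSpace ℝ (Fin n) :=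
  (leftFrame e g₀).symm (extChartAt (𝓡 n) g₀ g - extChartAt (𝓡 n) g₀ g₀)

/-- The local parametrization that inverts `coordMap`. -/
def coordInv (q : EuclideanSpace ℝ (Fin n)) : G :=
  (extChartAt (𝓡 n) g₀).symm (extChartAt (𝓡 n) g₀ g₀ + leftFrame e g₀ q)

/-- The domain of the local parametrization `coordInv`. -/
def coordDomain : Set (EuclideanSpace ℝ (Fin n)) :=
  {q | extChartAt (𝓡 n) g₀ g₀ + leftFrame e g₀ q ∈ (extChartAt (𝓡 n) g₀).target}

/-- The left frame in local coordinates. -/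
def coordFrame (q : EuclideanSpace ℝ (Fin n)) :
    EuclideanSpace ℝ (Fin n) →L[ℝ] EuclideanSpace ℝ (Fin n) :=
  ((leftFrame e g₀).symm : EuclideanSpace ℝ (Fin n) →L[ℝ] EuclideanSpace ℝ (Fin n)).comp
    ((mfderiv (𝓡 n) (𝓡 n) (extChartAt (𝓡 n) g₀) (coordInv e g₀ q) :
      EuclideanSpace ℝ (Fin n) →L[ℝ] EuclideanSpace ℝ (Fin n)).comp
        (leftFrame e (coordInv e g₀ q) : EuclideanSpace ℝ (Fin n) →L[ℝ] EuclideanSpace ℝ (Fin n)))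

theorem isOpen_coordDomain : IsOpen (coordDomain e g₀) :=
  (isOpen_extChartAt_target g₀).preimage (by fun_prop)

theorem zero_mem_coordDomain : (0 : EuclideanSpace ℝ (Fin n)) ∈ coordDomain e g₀ := by
  simp [coordDomain]

theorem coordInv_zero : coordInv e g₀ 0 = g₀ := by
  simp [coordInv]

theorem coordMap_self : coordMap e g₀ g₀ = 0 := by
  simp [coordMap]

theorem coordInv_mem_source {q : EuclideanSpace ℝ (Fin n)} (hq : q ∈ coordDomain e g₀) :
    coordInv e g₀ q ∈ (extChartAt (𝓡 n) g₀).source :=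
  (extChartAt (𝓡 n) g₀).map_target hq

theorem coordMap_coordInv {q : EuclideanSpace ℝ (Fin n)} (hq : q ∈ coordDomain e g₀) :
    coordMap e g₀ (coordInv e g₀ q) = q := by
  rw [coordMap, coordInv, (extChartAt (𝓡 n) g₀).right_inv hq, add_sub_cancel_left,
    ContinuousLinearEquiv.symm_apply_apply]

theorem coordInv_coordMap {g : G} (hg : g ∈ (extChartAt (𝓡 n) g₀).source) :
    coordInv e g₀ (coordMap e g₀ g) = g := by
  rw [coordMap, coordInv, ContinuousLinearEquiv.apply_symm_apply, add_sub_cancel,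
    (extChartAt (𝓡 n) g₀).left_inv hg]

theorem coordMap_mem_domain {g : G} (hg : g ∈ (extChartAt (𝓡 n) g₀).source) :
    coordMap e g₀ g ∈ coordDomain e g₀ := by
  simp only [coordDomain, mem_ofPred_eq]
  rw [coordMap, ContinuousLinearEquiv.apply_symm_apply, add_sub_cancel]
  exact (extChartAt (𝓡 n) g₀).map_source hg

theorem hasMFDerivAt_coordMap {g : G} (hg : g ∈ (extChartAt (𝓡 n) g₀).source) :
    HasMFDerivAt (𝓡 n) (𝓡 n) (coordMap e g₀) g
      (((leftFrame e g₀).symm : EuclideanSpace ℝ (Fin n) →L[ℝ] EuclideanSpace ℝ (Fin n)).comp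
        (mfderiv (𝓡 n) (𝓡 n) (extChartAt (𝓡 n) g₀) g)) := by
  have h1 : HasMFDerivAt (𝓡 n) (𝓡 n) (extChartAt (𝓡 n) g₀) g
      (mfderiv (𝓡 n) (𝓡 n) (extChartAt (𝓡 n) g₀) g) :=
    (mdifferentiableAt_extChartAt (by simpa using hg)).hasMFDerivAt
  let A : EuclideanSpace ℝ (Fin n) → EuclideanSpace ℝ (Fin n) := fun x =>
    (leftFrame e g₀).symm (x - extChartAt (𝓡 n) g₀ g₀)
  have h2 : HasFDerivAt A
      ((leftFrame e g₀).symm : EuclideanSpace ℝ (Fin n) →L[ℝ] EuclideanSpace ℝ (Fin n))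
      (extChartAt (𝓡 n) g₀ g) :=
    (ContinuousLinearEquiv.hasFDerivAt _).comp _ ((hasFDerivAt_id _).sub_const _)
  exact HasMFDerivAt.comp (g := A) g h2.hasMFDerivAt h1

/-- The differential of the preferred chart at its own centre is the identity, and `coordMap` was
composed with the inverse of the left frame there. This normalization keeps the linearization free
of frame coefficients. -/
theorem coordFrame_zero : coordFrame e g₀ 0 = ContinuousLinearMap.id ℝ _ := by
  ext1 v
  -- Stated for a variable base point because the tangent space depends on it, so that `coordInv e
  -- g₀ 0 = g₀` can be substituted.
  have key : ∀ g, g = g₀ → (leftFrame e g₀).symm ((mfderiv (𝓡 n) (𝓡 n) (extChartAt (𝓡 n) g₀) g :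
      EuclideanSpace ℝ (Fin n) →L[ℝ] EuclideanSpace ℝ (Fin n)) (leftFrame e g v)) = v := by
    intro g hg
    rw [hg]
    have h := mfderiv_extChartAt_self (I := 𝓡 n) (x := g₀)
    have h' : (mfderiv (𝓡 n) (𝓡 n) (extChartAt (𝓡 n) g₀) g₀ :
      EuclideanSpace ℝ (Fin n) →L[ℝ] EuclideanSpace ℝ (Fin n)) = ContinuousLinearMap.id ℝ _ := h
    rw [h']
    exact (leftFrame e g₀).symm_apply_apply v
  exact key _ (coordInv_zero e g₀)

theorem contMDiffOn_coordInv :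
    ContMDiffOn (𝓡 n) (𝓡 n) ∞ (coordInv e g₀) (coordDomain e g₀) := by
  have h1 : ContMDiffOn (𝓡 n) (𝓡 n) ∞ (extChartAt (𝓡 n) g₀).symm (extChartAt (𝓡 n) g₀).target :=
    contMDiffOn_extChartAt_symm g₀
  have h2 : ContMDiff (𝓡 n) (𝓡 n) ∞
      (fun q => extChartAt (𝓡 n) g₀ g₀ + leftFrame e g₀ q) :=
    (contDiff_const.add (leftFrame e g₀).contDiff).contMDiff
  exact h1.comp h2.contMDiffOn (fun q hq => hq)

theorem contDiffOn_comp_coordInv {F : Type*} [NormedAddCommGroup F] [NormedSpace ℝ F] {f : G → F}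
    {k : WithTop ℕ∞} (hk : k ≤ ∞) (hf : ContMDiff (𝓡 n) 𝓘(ℝ, F) k f) :
    ContDiffOn ℝ k (fun q => f (coordInv e g₀ q)) (coordDomain e g₀) :=
  (hf.comp_contMDiffOn ((contMDiffOn_coordInv e g₀).of_le hk)).contDiffOn

/-- Near `g`, the function `f` is the composition of `f ∘ coordInv` with `coordMap`, and the
differential of `coordMap` takes the left frame to `coordFrame`. Thus derivatives along
left-invariant fields become derivatives along `coordFrame`. -/
theorem fderiv_comp_coordInv {F : Type*} [NormedAddCommGroup F] [NormedSpace ℝ F] {f : G → F}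
    (hf : ContMDiff (𝓡 n) 𝓘(ℝ, F) ∞ f) {q : EuclideanSpace ℝ (Fin n)}
    (hq : q ∈ coordDomain e g₀) (v : EuclideanSpace ℝ (Fin n)) :
    fderiv ℝ (fun q => f (coordInv e g₀ q)) q (coordFrame e g₀ q v) =
      mvfderiv (𝓡 n) f (coordInv e g₀ q) (leftTranslate (coordInv e g₀ q) (fromCoords e v)) := by
  set g := coordInv e g₀ q with hg
  have hgs : g ∈ (extChartAt (𝓡 n) g₀).source := coordInv_mem_source e g₀ hq
  have hκ := hasMFDerivAt_coordMap e g₀ hgs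
  have hκg : coordMap e g₀ g = q := coordMap_coordInv e g₀ hq
  have hd : DifferentiableAt ℝ (fun q => f (coordInv e g₀ q)) (coordMap e g₀ g) := by
    rw [hκg]
    exact ((contDiffOn_comp_coordInv e g₀ le_rfl hf).differentiableOn (by simp)).differentiableAt
      ((isOpen_coordDomain e g₀).mem_nhds hq)
  have h1 := HasMFDerivAt.comp g hd.hasFDerivAt.hasMFDerivAt hκ
  have h2 : f =ᶠ[𝓝 g] (fun q => f (coordInv e g₀ q)) ∘ coordMap e g₀ := by
    filter_upwards [extChartAt_source_mem_nhds' hgs] with g' hg'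
    simp only [Function.comp_apply, coordInv_coordMap e g₀ hg']
  have h3 := h1.congr_of_eventuallyEq h2
  have h4 := congrArg (fun A : EuclideanSpace ℝ (Fin n) →L[ℝ] F => A (leftFrame e g v)) h3.mfderiv
  rw [hκg] at h4
  rw [← leftFrame_apply]
  exact h4.symm

/-- On the chart domain, applying the differential of the chart is the fibre component of the
trivialization at `g₀`, so smoothness of the left-invariant fields as sections carries over. -/
theorem contDiffOn_coordFrame : ContDiffOn ℝ 2 (coordFrame e g₀) (coordDomain e g₀) := by
  rw [contDiffOn_clm_apply]
  intro v
  have h1 : ContMDiffOn (𝓡 n) (𝓡 n) 2 (fun g : G =>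
      (mfderiv (𝓡 n) (𝓡 n) (extChartAt (𝓡 n) g₀) g (leftTranslate g (fromCoords e v)) :
        EuclideanSpace ℝ (Fin n))) (extChartAt (𝓡 n) g₀).source := by
    intro g hg
    have hg' : g ∈ (chartAt (EuclideanSpace ℝ (Fin n)) g₀).source := by simpa using hg
    have h2 := (contMDiffAt_mulInvariantVectorField (I := 𝓡 n) (G := G) (fromCoords e v)
      (g := g)).of_le (m := 2) (by rw [minSmoothness_of_isRCLikeNormedField])
    have h3 := ((trivializationAt (EuclideanSpace ℝ (Fin n)) (TangentSpace (𝓡 n)) g₀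
      ).contMDiffAt_section_iff (by simpa using hg')).1 h2
    refine (h3.congr_of_eventuallyEq ?_).contMDiffWithinAt
    filter_upwards [extChartAt_source_mem_nhds' hg] with g' hg''
    have hg3 : g' ∈ (chartAt (EuclideanSpace ℝ (Fin n)) g₀).source := by simpa using hg''
    have h5 := TangentBundle.continuousLinearMapAt_trivializationAt (I := 𝓡 n) hg3
    have h6 := congrArg (fun A : EuclideanSpace ℝ (Fin n) →L[ℝ] EuclideanSpace ℝ (Fin n) =>
      A (leftTranslate g' (fromCoords e v))) h5
    refine h6.symm.trans ?_
    exact Bundle.Trivialization.continuousLinearMapAt_apply_of_mem _ _ (by simpa using hg3) _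
  have h2 : ContDiffOn ℝ 2 (fun q => (mfderiv (𝓡 n) (𝓡 n) (extChartAt (𝓡 n) g₀) (coordInv e g₀ q)
      (leftTranslate (coordInv e g₀ q) (fromCoords e v)) : EuclideanSpace ℝ (Fin n)))
      (coordDomain e g₀) :=
    (h1.comp ((contMDiffOn_coordInv e g₀).of_le (by norm_cast))
      (fun q hq => coordInv_mem_source e g₀ hq)).contDiffOn
  refine ((leftFrame e g₀).symm.contDiff.comp_contDiffOn h2).congr fun q hq => ?_
  exact congrArg (fun w => (leftFrame e g₀).symm ((mfderiv (𝓡 n) (𝓡 n) (extChartAt (𝓡 n) g₀)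
    (coordInv e g₀ q) : EuclideanSpace ℝ (Fin n) →L[ℝ] EuclideanSpace ℝ (Fin n)) w))
    (leftFrame_apply e _ v)

theorem isLocalMin_comp_coordInv {ψ : G → ℝ} (hmin : IsLocalMin ψ g₀) :
    IsLocalMin (fun q => ψ (coordInv e g₀ q)) 0 := by
  have hc : ContinuousAt (coordInv e g₀) 0 :=
    ((contMDiffOn_coordInv e g₀).continuousOn).continuousAt
      ((isOpen_coordDomain e g₀).mem_nhds (zero_mem_coordDomain e g₀))
  have h : Tendsto (coordInv e g₀) (𝓝 0) (𝓝 g₀) := by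
    have := hc.tendsto
    rwa [coordInv_zero] at this
  have h2 := h.eventually hmin
  simpa only [IsLocalMin, IsMinFilter, coordInv_zero] using h2

theorem mvfderiv_eq_zero_of_isLocalMin (e : Module.Basis (Fin n) ℝ (GroupLieAlgebra (𝓡 n) G))
    (g₀ : G) {ψ : G → ℝ} (hψ : ContMDiff (𝓡 n) 𝓘(ℝ, ℝ) ∞ ψ)
    (hmin : IsLocalMin ψ g₀) : mvfderiv (𝓡 n) ψ g₀ = 0 := by
  have key : ∀ g, g = g₀ → fderiv ℝ (fun q => ψ (coordInv e g₀ q)) 0 = 0 →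
      (∀ v, fderiv ℝ (fun q => ψ (coordInv e g₀ q)) 0 (coordFrame e g₀ 0 v) =
        mvfderiv (𝓡 n) ψ g (leftTranslate g (fromCoords e v))) → mvfderiv (𝓡 n) ψ g₀ = 0 := by
    intro g hg h0 h
    rw [hg] at h
    ext X
    have h1 := h ((leftFrame e g₀).symm X)
    rw [← leftFrame_apply, h0] at h1
    have h2 : leftFrame e g₀ ((leftFrame e g₀).symm X) = X :=
      (leftFrame e g₀).apply_symm_apply X
    rw [h2] at h1
    exact h1.symm
  exact key _ (coordInv_zero e g₀) (isLocalMin_comp_coordInv e g₀ hmin).fderiv_eq_zero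
    (fun v => fderiv_comp_coordInv e g₀ hψ (zero_mem_coordDomain e g₀) v)

/-- The Hessian at a critical point in local coordinates. -/
theorem hessian_eq_of_isLocalMin (B : InnerProd (GroupLieAlgebra (𝓡 n) G)) {ψ : G → ℝ}
    (hψ : ContMDiff (𝓡 n) 𝓘(ℝ, ℝ) ∞ ψ) (hmin : IsLocalMin ψ g₀) (v : EuclideanSpace ℝ (Fin n)) :
    hessian B ψ g₀ (leftTranslate g₀ (fromCoords e v)) (leftTranslate g₀ (fromCoords e v)) =
      fderiv ℝ (fun q => fderiv ℝ (fun q => ψ (coordInv e g₀ q)) q (coordFrame e g₀ q v)) 0 v := by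
  have h0 := mvfderiv_eq_zero_of_isLocalMin e g₀ hψ hmin
  unfold hessian
  -- At a critical point the connection term of the Hessian drops out; only the second derivative
  -- along the left-invariant field remains.
  rw [h0, leftUntranslate_leftTranslate]
  let k : G → ℝ := fun x => mvfderiv (𝓡 n) ψ x (leftTranslate x (fromCoords e v))
  let F : EuclideanSpace ℝ (Fin n) → ℝ := fun q =>
    fderiv ℝ (fun q => ψ (coordInv e g₀ q)) q (coordFrame e g₀ q v)
  have hk : k =ᶠ[𝓝 g₀] F ∘ coordMap e g₀ := by
    filter_upwards [extChartAt_source_mem_nhds (I := 𝓡 n) g₀] with x hx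
    have h1 : F (coordMap e g₀ x) = k (coordInv e g₀ (coordMap e g₀ x)) :=
      fderiv_comp_coordInv e g₀ hψ (coordMap_mem_domain e g₀ hx) v
    rw [coordInv_coordMap e g₀ hx] at h1
    exact h1.symm
  have hF : DifferentiableAt ℝ F (coordMap e g₀ g₀) := by
    rw [coordMap_self]
    have hmem := (isOpen_coordDomain e g₀).mem_nhds (zero_mem_coordDomain e g₀)
    have h2 := (contDiffOn_comp_coordInv e g₀ le_rfl hψ).fderiv_of_isOpen (m := 1)
      (isOpen_coordDomain e g₀) (by norm_cast)
    exact ((h2.differentiableOn (by simp)).differentiableAt hmem).clm_apply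
      ((((contDiffOn_coordFrame e g₀).differentiableOn (by simp)).differentiableAt hmem).clm_apply
        (differentiableAt_const v))
  have hg₀ : g₀ ∈ (extChartAt (𝓡 n) g₀).source := mem_extChartAt_source g₀
  have h1 := (HasMFDerivAt.comp (g := F) g₀ hF.hasFDerivAt.hasMFDerivAt
    (hasMFDerivAt_coordMap e g₀ hg₀)).congr_of_eventuallyEq hk
  have h4 := congrArg (fun A : EuclideanSpace ℝ (Fin n) →L[ℝ] ℝ => A (leftFrame e g₀ v)) h1.mfderiv
  have h5 : (leftFrame e g₀).symm ((mfderiv (𝓡 n) (𝓡 n) (extChartAt (𝓡 n) g₀) g₀ :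
      EuclideanSpace ℝ (Fin n) →L[ℝ] EuclideanSpace ℝ (Fin n)) (leftFrame e g₀ v)) = v := by
    have h' : (mfderiv (𝓡 n) (𝓡 n) (extChartAt (𝓡 n) g₀) g₀ :
      EuclideanSpace ℝ (Fin n) →L[ℝ] EuclideanSpace ℝ (Fin n)) = ContinuousLinearMap.id ℝ _ :=
      mfderiv_extChartAt_self (I := 𝓡 n) (x := g₀)
    rw [h']
    exact (leftFrame e g₀).symm_apply_apply v
  rw [coordMap_self] at h4
  have h6 : mvfderiv (𝓡 n) k g₀ (leftTranslate g₀ (fromCoords e v)) = fderiv ℝ F 0 v := by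
    rw [← leftFrame_apply]
    refine h4.trans ?_
    exact congrArg (fderiv ℝ F 0) h5
  have h7 : ∀ X : TangentSpace (𝓡 n) g₀,
      (0 : TangentSpace (𝓡 n) g₀ →L[ℝ] ℝ) X = 0 := fun X => rfl
  rw [h7, sub_zero]
  exact h6

end LocalCoordinates

/-! ### Global extension of smooth germs -/

section Extension

open Set Filter

/-- A function that is smooth near a point has a globally smooth extension of its germ. -/
theorem ContDiffOn.exists_contDiff_eventuallyEq {E F : Type*} [NormedAddCommGroup E]
    [InnerProductSpace ℝ E] [NormedAddCommGroup F] [NormedSpace ℝ F]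
    {f : E → F} {O : Set E} {k : ℕ∞} (hf : ContDiffOn ℝ k f O) (hO : IsOpen O) {x₀ : E}
    (hx₀ : x₀ ∈ O) : ∃ f' : E → F, ContDiff ℝ k f' ∧ f' =ᶠ[𝓝 x₀] f := by
  obtain ⟨ε, hε, hb⟩ := Metric.isOpen_iff.1 hO x₀ hx₀
  let χ : ContDiffBump x₀ := ⟨ε / 4, ε / 2, by positivity, by linarith⟩
  have hχ : tsupport χ ⊆ O := by
    rw [χ.tsupport_eq]
    exact (Metric.closedBall_subset_ball (by change ε / 2 < ε; linarith)).trans hb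
  refine ⟨fun x => χ x • f x, ?_, ?_⟩
  · rw [contDiff_iff_contDiffAt]
    intro x
    by_cases hx : x ∈ O
    · exact χ.contDiff.contDiffAt.smul (hf.contDiffAt (hO.mem_nhds hx))
    · have h1 : x ∉ tsupport χ := fun h => hx (hχ h)
      refine (contDiffAt_const (c := (0 : F))).congr_of_eventuallyEq ?_
      filter_upwards [(isClosed_tsupport χ).isOpen_compl.mem_nhds h1] with y hy
      rw [image_eq_zero_of_notMem_tsupport hy, zero_smul]
  · filter_upwards [χ.eventuallyEq_one] with x hx
    simp [hx]

end Extension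

/-! ### The transformed vector field, its average and its linearization -/

section TransformedField

/-- The state space of the closed loop in local coordinates. -/
abbrev LocalState (n : ℕ) : Type :=
  EuclideanSpace ℝ (Fin n) × EuclideanSpace ℝ (Fin n) × EuclideanSpace ℝ (Fin n) × ℝ

variable {n : ℕ}

variable (X : EuclideanSpace ℝ (Fin n) → EuclideanSpace ℝ (Fin n) →L[ℝ] EuclideanSpace ℝ (Fin n)) (ψ : EuclideanSpace ℝ (Fin n) → ℝ) (Γ : EuclideanSpace ℝ (Fin n) →L[ℝ] EuclideanSpace ℝ (Fin n) →L[ℝ] EuclideanSpace ℝ (Fin n)) (R : EuclideanSpace ℝ (Fin n) →L[ℝ] EuclideanSpace ℝ (Fin n)) (α : ℝ → ℝ)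
  (a lam b kap h : ℝ)

/-- The closed-loop vector field in local coordinates and in the transformed variables. -/
def transformedField (y : LocalState n) (U : EuclideanSpace ℝ (Fin n)) : LocalState n :=
  let z := ψ y.1 - y.2.2.2
  let V := y.2.1 + (lam * α z) • U
  let z' := fderiv ℝ ψ y.1 (X y.1 V) - h * z
  (X y.1 V,
    -Γ V V - R V - b • y.2.2.1 +
      (lam ^ 2 * α z ^ 2) • ∑ i, Γ (EuclideanSpace.single i 1) (EuclideanSpace.single i 1) -
      (lam * (deriv α z * z')) • U,
    -(a • y.2.2.1) - (kap * (deriv α z * z')) • U,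
    h * z)

/-- The part of `transformedField` that does not depend on the perturbation. -/
def transformedDrift (y : LocalState n) : LocalState n :=
  (X y.1 y.2.1,
    -Γ y.2.1 y.2.1 - R y.2.1 - b • y.2.2.1 + (lam ^ 2 * α (ψ y.1 - y.2.2.2) ^ 2) •
      ∑ i, Γ (EuclideanSpace.single i 1) (EuclideanSpace.single i 1),
    -(a • y.2.2.1),
    h * (ψ y.1 - y.2.2.2))

/-- The part of `transformedField` that is linear in the perturbation. -/
def transformedLinear (y : LocalState n) : EuclideanSpace ℝ (Fin n) →ₗ[ℝ] LocalState n :=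
  let z := ψ y.1 - y.2.2.2
  let z' := fderiv ℝ ψ y.1 (X y.1 y.2.1) - h * z
  { toFun := fun U => ((lam * α z) • X y.1 U,
      -((lam * α z) • (Γ y.2.1 U + Γ U y.2.1 + R U)) - (lam * (deriv α z * z')) • U,
      -((kap * (deriv α z * z')) • U), 0)
    map_add' := fun U V => by
      simp only [map_add, add_apply, Prod.mk_add_mk, Prod.mk.injEq]
      refine ⟨by module, by module, by module, by simp⟩
    map_smul' := fun c U => by
      simp only [map_smul, smul_apply, Prod.smul_mk, Prod.mk.injEq, RingHom.id_apply]
      refine ⟨by module, by module, by module, by simp⟩ }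

/-- The part of `transformedField` that is quadratic in the perturbation. -/
def transformedQuadratic (y : LocalState n) : EuclideanSpace ℝ (Fin n) →ₗ[ℝ] EuclideanSpace ℝ (Fin n) →ₗ[ℝ] LocalState n :=
  let z := ψ y.1 - y.2.2.2
  LinearMap.mk₂ ℝ (fun U V => (0,
      -((lam ^ 2 * α z ^ 2) • Γ U V) -
        (lam ^ 2 * (α z * deriv α z) * fderiv ℝ ψ y.1 (X y.1 U)) • V,
      -((kap * lam * (α z * deriv α z) * fderiv ℝ ψ y.1 (X y.1 U)) • V), 0))
    (fun U U' V => by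
      simp only [map_add, add_apply, Prod.mk_add_mk, Prod.mk.injEq]
      refine ⟨by simp, by module, by module, by simp⟩)
    (fun c U V => by
      simp only [map_smul, smul_apply, Prod.smul_mk, Prod.mk.injEq, smul_eq_mul]
      refine ⟨by simp, by module, by module, by simp⟩)
    (fun U V V' => by
      simp only [map_add, Prod.mk_add_mk, Prod.mk.injEq]
      refine ⟨by simp, by module, by module, by simp⟩)
    (fun c U V => by
      simp only [map_smul, Prod.smul_mk, Prod.mk.injEq]
      refine ⟨by simp, by module, by module, by simp⟩)

theorem transformedField_eq (y : LocalState n) (U : EuclideanSpace ℝ (Fin n)) :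
    transformedField X ψ Γ R α a lam b kap h y U = transformedDrift X ψ Γ R α a lam b h y +
      transformedLinear X ψ Γ R α lam kap h y U + transformedQuadratic X ψ Γ α lam kap y U U := by
  simp only [transformedField, transformedDrift, transformedLinear, transformedQuadratic,
    LinearMap.coe_mk, AddHom.coe_mk, LinearMap.mk₂_apply, Prod.mk_add_mk, map_add, map_smul,
    add_apply, smul_apply, smul_eq_mul, Prod.mk.injEq]
  refine ⟨by module, by module, by module, by ring⟩

/-- The average of `transformedField` over the perturbation. -/
def averagedField (y : LocalState n) : LocalState n :=
  transformedDrift X ψ Γ R α a lam b h y + ∑ i, transformedQuadratic X ψ Γ α lam kap y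
    (EuclideanSpace.single i 1) (EuclideanSpace.single i 1)

/-- The coefficients of the oscillating part of `transformedField`. -/
def oscillatingField : Fin n ⊕ Fin n × Fin n → LocalState n → LocalState n
  | Sum.inl i, y => transformedLinear X ψ Γ R α lam kap h y (EuclideanSpace.single i 1)
  | Sum.inr p, y => transformedQuadratic X ψ Γ α lam kap y
      (EuclideanSpace.single p.1 1) (EuclideanSpace.single p.2 1)

theorem EuclideanSpace.eq_sum_single (U : EuclideanSpace ℝ (Fin n)) : U = ∑ i, U i • EuclideanSpace.single i (1 : ℝ) := by
  ext j
  simp [Pi.single_apply]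

/-- Expanding `U` in the standard basis, the residual of the product `Uᵢ Uⱼ` has `δᵢⱼ` subtracted;
these subtracted terms are the diagonal sum contained in the average. -/
theorem averagedField_add_oscillatingField (y : LocalState n) (U : ℝ → EuclideanSpace ℝ (Fin n)) (τ : ℝ) :
    averagedField X ψ Γ R α a lam b kap h y +
      ∑ k, residualSignal U k τ • oscillatingField X ψ Γ R α lam kap h k y =
    transformedField X ψ Γ R α a lam b kap h y (U τ) := by
  rw [transformedField_eq, averagedField, Fintype.sum_sum_type, Fintype.sum_prod_type]
  have h1 : transformedLinear X ψ Γ R α lam kap h y (U τ) = ∑ i, U τ i •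
      transformedLinear X ψ Γ R α lam kap h y (EuclideanSpace.single i 1) := by
    conv_lhs => rw [EuclideanSpace.eq_sum_single (U τ)]
    simp only [map_sum, map_smul]
  have h2 : transformedQuadratic X ψ Γ α lam kap y (U τ) (U τ) = ∑ i, ∑ j, (U τ i * U τ j) •
      transformedQuadratic X ψ Γ α lam kap y
        (EuclideanSpace.single i 1) (EuclideanSpace.single j 1) := by
    conv_lhs => rw [EuclideanSpace.eq_sum_single (U τ)]
    simp only [map_sum, map_smul, LinearMap.sum_apply, LinearMap.smul_apply, Finset.smul_sum,
      smul_smul]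
    rw [Finset.sum_comm]
    exact Finset.sum_congr rfl fun i _ => Finset.sum_congr rfl fun j _ => by rw [mul_comm]
  rw [h1, h2]
  simp only [residualSignal, oscillatingField, sub_smul, Finset.sum_sub_distrib, ite_smul, one_smul,
    zero_smul, Finset.sum_ite_eq, Finset.mem_univ, if_true]
  abel

variable {X ψ α}

theorem contDiff_transformedLinear (U : EuclideanSpace ℝ (Fin n)) (hX : ContDiff ℝ 1 X) (hψ : ContDiff ℝ ∞ ψ)
    (hα : ContDiff ℝ ∞ α) :
    ContDiff ℝ 1 (fun y => transformedLinear X ψ Γ R α lam kap h y U) := by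
  have h1 : ContDiff ℝ 1 α := hα.of_le (by norm_cast)
  have h2 : ContDiff ℝ 1 (deriv α) := (contDiff_infty_iff_deriv.1 hα).2.of_le (by norm_cast)
  have h3 : ContDiff ℝ 1 ψ := hψ.of_le (by norm_cast)
  have h4 : ContDiff ℝ 1 (fderiv ℝ ψ) := (hψ.fderiv_right (m := 1) (by norm_cast))
  simp only [transformedLinear, LinearMap.coe_mk, AddHom.coe_mk]
  fun_prop

theorem contDiff_transformedQuadratic (U V : EuclideanSpace ℝ (Fin n)) (hX : ContDiff ℝ 1 X) (hψ : ContDiff ℝ ∞ ψ)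
    (hα : ContDiff ℝ ∞ α) :
    ContDiff ℝ 1 (fun y => transformedQuadratic X ψ Γ α lam kap y U V) := by
  have h1 : ContDiff ℝ 1 α := hα.of_le (by norm_cast)
  have h2 : ContDiff ℝ 1 (deriv α) := (contDiff_infty_iff_deriv.1 hα).2.of_le (by norm_cast)
  have h3 : ContDiff ℝ 1 ψ := hψ.of_le (by norm_cast)
  have h4 : ContDiff ℝ 1 (fderiv ℝ ψ) := (hψ.fderiv_right (m := 1) (by norm_cast))
  simp only [transformedQuadratic, LinearMap.mk₂_apply]
  fun_prop

theorem contDiff_averagedField (hX : ContDiff ℝ 1 X) (hψ : ContDiff ℝ ∞ ψ)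
    (hα : ContDiff ℝ ∞ α) : ContDiff ℝ 1 (averagedField X ψ Γ R α a lam b kap h) := by
  have h1 : ContDiff ℝ 1 α := hα.of_le (by norm_cast)
  have h3 : ContDiff ℝ 1 ψ := hψ.of_le (by norm_cast)
  refine ContDiff.add ?_ (ContDiff.sum fun i _ =>
    contDiff_transformedQuadratic _ _ _ _ _ hX hψ hα)
  unfold transformedDrift
  fun_prop

theorem contDiff_oscillatingField (hX : ContDiff ℝ 1 X) (hψ : ContDiff ℝ ∞ ψ)
    (hα : ContDiff ℝ ∞ α) (k : Fin n ⊕ Fin n × Fin n) :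
    ContDiff ℝ 1 (oscillatingField X ψ Γ R α lam kap h k) := by
  rcases k with i | p
  · exact contDiff_transformedLinear Γ R lam kap h _ hX hψ hα
  · exact contDiff_transformedQuadratic Γ lam kap _ _ hX hψ hα

/-- The Hessian of `ψ` at `0`, as an endomorphism. -/
def hessianEndomorphism (ψ : EuclideanSpace ℝ (Fin n) → ℝ) :
    EuclideanSpace ℝ (Fin n) →L[ℝ] EuclideanSpace ℝ (Fin n) :=
  ∑ i, (((fderiv ℝ (fderiv ℝ ψ) 0).flip (EuclideanSpace.single i 1))).smulRight
    (EuclideanSpace.single i (1 : ℝ))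

theorem inner_hessianEndomorphism (ψ : EuclideanSpace ℝ (Fin n) → ℝ)
    (x y : EuclideanSpace ℝ (Fin n)) :
    inner ℝ (hessianEndomorphism ψ x) y = fderiv ℝ (fderiv ℝ ψ) 0 x y := by
  conv_rhs => rw [EuclideanSpace.eq_sum_single y]
  simp only [hessianEndomorphism, sum_apply,
    ContinuousLinearMap.smulRight_apply, ContinuousLinearMap.flip_apply, sum_inner, map_sum,
    map_smul, inner_smul_left, EuclideanSpace.inner_single_left, smul_eq_mul]
  exact Finset.sum_congr rfl fun i _ => by simp [mul_comm]

theorem inner_hessianEndomorphism_comm (hψ : ContDiff ℝ ∞ ψ) (x y : EuclideanSpace ℝ (Fin n)) :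
    inner ℝ (hessianEndomorphism ψ x) y = inner ℝ x (hessianEndomorphism ψ y) := by
  rw [real_inner_comm (hessianEndomorphism ψ y) x, inner_hessianEndomorphism, inner_hessianEndomorphism]
  exact (hψ.contDiffAt (x := 0)).isSymmSndFDerivAt (by simp; norm_cast) x y

theorem exists_pos_le_inner_of_pos (H : EuclideanSpace ℝ (Fin n) →L[ℝ] EuclideanSpace ℝ (Fin n))
    (hH : ∀ x, x ≠ 0 → 0 < inner ℝ (H x) x) : ∃ m > 0, ∀ x, m * ‖x‖ ^ 2 ≤ inner ℝ (H x) x := by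
  have hcont : Continuous fun x => inner ℝ (H x) x := by fun_prop
  -- The unit sphere is empty exactly in dimension zero; otherwise the constant is the minimum of
  -- the quadratic form on it.
  rcases (Metric.sphere (0 : EuclideanSpace ℝ (Fin n)) 1).eq_empty_or_nonempty with he | hne
  · refine ⟨1, one_pos, fun x => ?_⟩
    have hx : x = 0 := by
      by_contra hx
      have : ‖x‖⁻¹ • x ∈ Metric.sphere (0 : EuclideanSpace ℝ (Fin n)) 1 := by
        simp [norm_smul, hx]
      rw [he] at this
      exact this
    simp [hx]
  · obtain ⟨x₀, hx₀, hmin⟩ := (isCompact_sphere (0 : EuclideanSpace ℝ (Fin n)) 1).exists_isMinOn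
      hne hcont.continuousOn
    have hx₀' : ‖x₀‖ = 1 := mem_sphere_zero_iff_norm.1 hx₀
    refine ⟨inner ℝ (H x₀) x₀, hH x₀ (by rintro rfl; simp at hx₀'), fun x => ?_⟩
    by_cases hx : x = 0
    · simp [hx]
    have hn : 0 < ‖x‖ := norm_pos_iff.2 hx
    have h1 : inner ℝ (H x₀) x₀ ≤ inner ℝ (H (‖x‖⁻¹ • x)) (‖x‖⁻¹ • x) :=
      hmin (by simp [norm_smul, hx])
    rw [map_smul, inner_smul_left, inner_smul_right] at h1
    simp only [conj_trivial] at h1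
    calc inner ℝ (H x₀) x₀ * ‖x‖ ^ 2
        ≤ (‖x‖⁻¹ * (‖x‖⁻¹ * inner ℝ (H x) x)) * ‖x‖ ^ 2 := by gcongr
      _ = _ := by field_simp

section Linearization

/-- The decisive cancellation: the averaged connection term removes the feedback term with `∑ Γ(eᵢ,
eᵢ)`. The remaining quadratic part is a multiple of the gradient of `ψ` in the frame `X`, in the
velocity and in the compensator. -/
theorem averagedField_apply (y : LocalState n) :
    averagedField X ψ Γ R α a lam b kap h y =
      (X y.1 y.2.1,
        -Γ y.2.1 y.2.1 - R y.2.1 - b • y.2.2.1 -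
          (lam ^ 2 * (α (ψ y.1 - y.2.2.2) * deriv α (ψ y.1 - y.2.2.2))) •
            ∑ i, fderiv ℝ ψ y.1 (X y.1 (EuclideanSpace.single i 1)) •
              EuclideanSpace.single i (1 : ℝ),
        -(a • y.2.2.1) - (kap * lam * (α (ψ y.1 - y.2.2.2) * deriv α (ψ y.1 - y.2.2.2))) •
          ∑ i, fderiv ℝ ψ y.1 (X y.1 (EuclideanSpace.single i 1)) •
              EuclideanSpace.single i (1 : ℝ),
        h * (ψ y.1 - y.2.2.2)) := by
  simp only [averagedField, transformedDrift, transformedQuadratic, LinearMap.mk₂_apply]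
  ext1
  · simp [Prod.fst_sum]
  ext1
  · simp only [Prod.fst_add, Prod.snd_add, Prod.fst_sum, Prod.snd_sum, Finset.smul_sum, smul_smul,
      Finset.sum_sub_distrib, Finset.sum_neg_distrib]
    abel
  ext1
  · simp only [Prod.fst_add, Prod.snd_add, Prod.fst_sum, Prod.snd_sum, Finset.smul_sum, smul_smul,
      Finset.sum_neg_distrib]
    abel
  · simp [Prod.snd_sum]

theorem hasFDerivAt_averagedField (hX : ContDiff ℝ 1 X) (hψ : ContDiff ℝ ∞ ψ)
    (hα : ContDiff ℝ ∞ α) (hX₀ : X 0 = ContinuousLinearMap.id ℝ _) (hψ₀ : ψ 0 = 0)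
    (hψ₁ : fderiv ℝ ψ 0 = 0) :
    ∃ A : LocalState n →L[ℝ] LocalState n,
      HasFDerivAt (averagedField X ψ Γ R α a lam b kap h) A 0 ∧ ∀ q v w η, A (q, v, w, η) =
        (v, -R v - b • w - (lam ^ 2 * (α 0 * deriv α 0)) • hessianEndomorphism ψ q,
          -(a • w) - (kap * lam * (α 0 * deriv α 0)) • hessianEndomorphism ψ q, -(h * η)) := by
  let Dq : LocalState n →L[ℝ] EuclideanSpace ℝ (Fin n) := ContinuousLinearMap.fst ℝ _ _
  let D₂ : LocalState n →L[ℝ] EuclideanSpace ℝ (Fin n) × EuclideanSpace ℝ (Fin n) × ℝ :=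
    ContinuousLinearMap.snd ℝ _ _
  let Dv : LocalState n →L[ℝ] EuclideanSpace ℝ (Fin n) := (ContinuousLinearMap.fst ℝ _ _).comp D₂
  let D₃ : LocalState n →L[ℝ] EuclideanSpace ℝ (Fin n) × ℝ := (ContinuousLinearMap.snd ℝ _ _).comp D₂
  let Dw : LocalState n →L[ℝ] EuclideanSpace ℝ (Fin n) := (ContinuousLinearMap.fst ℝ _ _).comp D₃
  let Dη : LocalState n →L[ℝ] ℝ := (ContinuousLinearMap.snd ℝ _ _).comp D₃
  have hq : HasFDerivAt (fun y : LocalState n => y.1) Dq 0 := Dq.hasFDerivAt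
  have hv : HasFDerivAt (fun y : LocalState n => y.2.1) Dv 0 := Dv.hasFDerivAt
  have hw : HasFDerivAt (fun y : LocalState n => y.2.2.1) Dw 0 := Dw.hasFDerivAt
  have hη : HasFDerivAt (fun y : LocalState n => y.2.2.2) Dη 0 := Dη.hasFDerivAt
  have hXd : HasFDerivAt (fun y : LocalState n => X y.1) ((fderiv ℝ X 0).comp Dq) 0 :=
    HasFDerivAt.comp (g := X) (0 : LocalState n)
      ((hX.differentiable (by simp)) 0).hasFDerivAt hq
  have hψd : HasFDerivAt (fun y : LocalState n => ψ y.1) ((fderiv ℝ ψ 0).comp Dq) 0 :=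
    HasFDerivAt.comp (g := ψ) (0 : LocalState n)
      ((hψ.differentiable (by simp)) 0).hasFDerivAt hq
  have h4 : ContDiff ℝ 1 (fderiv ℝ ψ) := (hψ.fderiv_right (m := 1) (by norm_cast))
  have hDψ : HasFDerivAt (fun y : LocalState n => fderiv ℝ ψ y.1)
      ((fderiv ℝ (fderiv ℝ ψ) 0).comp Dq) 0 :=
    HasFDerivAt.comp (g := fderiv ℝ ψ) (0 : LocalState n)
      ((h4.differentiable (by simp)) 0).hasFDerivAt hq
  have hz := hψd.sub hη
  have hp : HasFDerivAt (fun y : LocalState n => ∑ i, fderiv ℝ ψ y.1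
      (X y.1 (EuclideanSpace.single i 1)) • EuclideanSpace.single i (1 : ℝ))
      ((hessianEndomorphism ψ).comp Dq) 0 := by
    have h5 := HasFDerivAt.fun_sum (u := Finset.univ) fun (i : Fin n) _ =>
      (hDψ.clm_apply (hXd.clm_apply
        (hasFDerivAt_const (EuclideanSpace.single i (1 : ℝ)) (0 : LocalState n)))).smul_const
          (EuclideanSpace.single i (1 : ℝ))
    refine h5.congr_fderiv (ContinuousLinearMap.ext fun y => ?_)
    simp [hessianEndomorphism, hψ₁, hX₀, sum_apply]
  -- The derivative of this factor is irrelevant, because it multiplies a gradient that vanishes at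
  -- the origin; only its value `α 0 * deriv α 0` enters the linearization.
  have hc : DifferentiableAt ℝ (fun y : LocalState n =>
      α (ψ y.1 - y.2.2.2) * deriv α (ψ y.1 - y.2.2.2)) 0 := by
    have h1 : Differentiable ℝ α := hα.differentiable (by simp)
    have h2 : Differentiable ℝ (deriv α) :=
      (contDiff_infty_iff_deriv.1 hα).2.differentiable (by simp)
    exact ((h1 _).comp _ hz.differentiableAt).mul ((h2 _).comp _ hz.differentiableAt)
  have hΓ := Γ.hasFDerivAt_of_bilinear hv hv
  have hR := R.hasFDerivAt.comp (0 : LocalState n) hv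
  have hcp := (hc.hasFDerivAt.const_mul (lam ^ 2)).smul hp
  have hcp' := (hc.hasFDerivAt.const_mul (kap * lam)).smul hp
  have hF := (hXd.clm_apply hv).prodMk ((((hΓ.neg.sub hR).sub (hw.const_smul b)).sub hcp).prodMk
    (((hw.const_smul a).neg.sub hcp').prodMk (hz.const_mul h)))
  refine ⟨_, hF.congr_of_eventuallyEq (Filter.Eventually.of_forall fun y => ?_), ?_⟩
  · rw [averagedField_apply]
    rfl
  · intro q v w η
    simp [Dq, D₂, Dv, D₃, Dw, Dη, hψ₁, hX₀, hψ₀]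

end Linearization

/-- The Lyapunov function of the linearized average still works for the nonlinear average near the
origin, and the averaging theorem then applies. The radius `r` stays free because stability needs
arbitrarily small tubes. -/
theorem exists_solution_transformedField (hX : ContDiff ℝ 1 X) (hψ : ContDiff ℝ ∞ ψ)
    (hα : ContDiff ℝ ∞ α) (hX₀ : X 0 = ContinuousLinearMap.id ℝ _) (hψ₀ : ψ 0 = 0)
    (hψ₁ : fderiv ℝ ψ 0 = 0)
    (hHess : ∀ v, v ≠ 0 → 0 < fderiv ℝ (fun q => fderiv ℝ ψ q (X q v)) 0 v)
    (hR : ∀ x, 0 ≤ inner ℝ (R x) x) (hα_pos : 0 < α 0 * deriv α 0)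
    {a lam b kap h : ℝ} (ha : 0 < a) (hlam : 0 < lam) (hb : 0 < b) (hkap : 0 < kap)
    (hh : 0 < h) (hgains : 0 < a * lam - b * kap)
    {T : ℝ} (hT : 0 < T) {U : ℝ → EuclideanSpace ℝ (Fin n)} (hU : Continuous U)
    (hper : Function.Periodic U T) (hmean : ∫ τ in (0 : ℝ)..T, U τ = 0)
    (hcov : ∀ i j, T⁻¹ * (∫ τ in (0 : ℝ)..T, U τ i * U τ j) = if i = j then 1 else 0) :
    ∃ r₀ > 0, ∀ r, 0 < r → r ≤ r₀ →
      ∃ ρ > 0, ∃ K > 0, ∃ k > 0, ∃ Ω₀ > 0, ∀ Ω ≥ Ω₀, ∀ (t₀ : ℝ) (y₀ : LocalState n), ‖y₀‖ ≤ ρ →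
      ∃ y : ℝ → LocalState n, y t₀ = y₀ ∧ Continuous y ∧ (∀ t ≥ t₀, ‖y t‖ < r) ∧
        (∀ t, ‖y t‖ ≤ r → HasDerivAt y
          (transformedField X ψ Γ R α a lam b kap h (y t) (U (Ω * t))) t) ∧
        ∀ t ≥ t₀, ‖y t‖ ^ 2 ≤ K * (Real.exp (-k * (t - t₀)) * ‖y₀‖ ^ 2 + 1 / Ω) := by
  -- Variation of the frame does not contribute, since the differential of `ψ` vanishes at the
  -- origin and the frame is the identity there.
  have hS : ∀ v, fderiv ℝ (fun q => fderiv ℝ ψ q (X q v)) 0 v = fderiv ℝ (fderiv ℝ ψ) 0 v v := by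
    intro v
    have h4 : ContDiff ℝ 1 (fderiv ℝ ψ) := (hψ.fderiv_right (m := 1) (by norm_cast))
    have h5 := ((h4.differentiable (by simp)) 0).hasFDerivAt.clm_apply
      (((hX.differentiable (by simp)) 0).hasFDerivAt.clm_apply (hasFDerivAt_const v 0))
    rw [h5.fderiv]
    simp [hψ₁, hX₀]
  obtain ⟨m, hm, hmH⟩ := exists_pos_le_inner_of_pos (hessianEndomorphism ψ) fun x hx => by
    rw [inner_hessianEndomorphism, ← hS]
    exact hHess x hx
  obtain ⟨A, hA, hA'⟩ := hasFDerivAt_averagedField Γ R a lam b kap h hX hψ hα hX₀ hψ₀ hψ₁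
  obtain ⟨P, c, hc, hPs, hPc, hPA⟩ := exists_lyapunov_of_phaseLead
    (inner_hessianEndomorphism_comm hψ) hm hmH hR ha hlam hb hkap hh hgains hα_pos hA'
  have hF0 : averagedField X ψ Γ R α a lam b kap h 0 = 0 := by
    rw [averagedField_apply]
    simp [hψ₀, hψ₁]
  have hloc : ∃ r₀ > 0, ∀ y : LocalState n, ‖y‖ ≤ r₀ →
      P y (averagedField X ψ Γ R α a lam b kap h y) ≤ -(c / 2) * ‖y‖ ^ 2 := by
    -- With this constant, the nonlinear remainder uses up at most half of the decay rate `c`.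
    have h1 := (hasFDerivAt_iff_isLittleO_nhds_zero.1 hA).def
      (show 0 < c / (2 * (‖P‖ + 1)) by positivity)
    obtain ⟨δ, hδ, hb⟩ := Metric.eventually_nhds_iff.1 h1
    refine ⟨δ / 2, by positivity, fun y hy => ?_⟩
    have h2 := @hb y (by rw [dist_zero_right]; linarith)
    rw [zero_add, hF0, sub_zero] at h2
    set D := averagedField X ψ Γ R α a lam b kap h y - A y with hD
    have h3 : averagedField X ψ Γ R α a lam b kap h y = A y + D := by rw [hD]; abel
    have h4 : P y D ≤ ‖P‖ * ‖y‖ * (c / (2 * (‖P‖ + 1)) * ‖y‖) :=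
      ((le_abs_self _).trans (P.le_opNorm₂ y D)).trans (by gcongr)
    have h5 : ‖P‖ * ‖y‖ * (c / (2 * (‖P‖ + 1)) * ‖y‖) ≤ c / 2 * ‖y‖ ^ 2 := by
      have : ‖P‖ * (c / (2 * (‖P‖ + 1))) ≤ c / 2 := by
        rw [mul_div_assoc', div_le_iff₀ (by positivity)]
        nlinarith [norm_nonneg P]
      calc _ = ‖P‖ * (c / (2 * (‖P‖ + 1))) * ‖y‖ ^ 2 := by ring
        _ ≤ _ := by gcongr
    rw [h3, map_add]
    linarith [hPA y]
  obtain ⟨r₀, hr₀, hdec⟩ := hloc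
  obtain ⟨M, C, hM, hmC, hMC⟩ := exists_antiderivative_residualSignal hT hU hper hmean hcov
  refine ⟨r₀, hr₀, fun r hr hrr₀ => ?_⟩
  obtain ⟨ρ, hρ, K, hK, k, hk, Ω₀, hΩ₀, hmain⟩ := exists_solution_of_averaged_lyapunov
    (contDiff_averagedField Γ R a lam b kap h hX hψ hα)
    (contDiff_oscillatingField Γ R lam kap h hX hψ hα)
    (continuous_residualSignal hU) hM hmC hMC hPs (half_pos hc)
    (fun y => (mul_le_mul_of_nonneg_right (by linarith) (by positivity)).trans (hPc y)) hr
    (fun y hy => hdec y (hy.trans hrr₀))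
  refine ⟨ρ, hρ, K, hK, k, hk, Ω₀, hΩ₀, fun Ω hΩ t₀ y₀ hy₀ => ?_⟩
  obtain ⟨y, h1, h2, h3, h4, h5⟩ := hmain Ω hΩ t₀ y₀ hy₀
  refine ⟨y, h1, h2, h3, fun t ht => ?_, h5⟩
  have h6 := h4 t ht
  rwa [averagedField_add_oscillatingField] at h6

end TransformedField

/-! ### Local Lipschitz estimates in both directions -/

section LocalLipschitz

open Set Filter

theorem ContDiff.exists_lipschitzOnWith_of_isCompact {E F : Type*} [NormedAddCommGroup E]
    [NormedSpace ℝ E] [NormedAddCommGroup F] [NormedSpace ℝ F] {f : E → F} (hf : ContDiff ℝ 1 f)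
    {s : Set E} (hs : IsCompact s) : ∃ K, LipschitzOnWith K f s :=
  hf.locallyLipschitz.locallyLipschitzOn.exists_lipschitzOnWith_of_compact hs

/-- A map with injective differential is expanding up to a factor near a point. -/
theorem HasStrictFDerivAt.exists_norm_sub_le_of_injective {E F : Type*} [NormedAddCommGroup E]
    [NormedSpace ℝ E] [FiniteDimensional ℝ E] [NormedAddCommGroup F] [NormedSpace ℝ F] {f : E → F}
    {f' : E →L[ℝ] F} {x : E} (hf : HasStrictFDerivAt f f' x) (hinj : Function.Injective f') :
    ∃ C > 0, ∃ s ∈ 𝓝 x, ∀ y ∈ s, ∀ z ∈ s, ‖y - z‖ ≤ C * ‖f y - f z‖ := by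
  obtain ⟨K, hK, hanti⟩ := f'.toLinearMap.exists_antilipschitzWith (LinearMap.ker_eq_bot.2 hinj)
  have hK' : (0 : ℝ) < K := hK
  -- The linearization error is at most half of the lower bound that injectivity of `f'` provides,
  -- which explains the final factor `2 * K`.
  have h1 := hf.isLittleO.def (show (0 : ℝ) < 1 / (2 * K) by positivity)
  rw [nhds_prod_eq] at h1
  obtain ⟨s, hs, hb⟩ := mem_prod_same_iff.1 h1
  refine ⟨2 * K, by positivity, s, hs, fun y hy z hz => ?_⟩
  have h2 : ‖f y - f z - f' (y - z)‖ ≤ 1 / (2 * K) * ‖y - z‖ := hb (mk_mem_prod hy hz)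
  have h3 : ‖y - z‖ ≤ K * ‖f' (y - z)‖ := by
    have := hanti.le_mul_dist (y - z) 0
    simpa [dist_zero_right] using this
  have h4 : ‖f' (y - z)‖ ≤ ‖f y - f z‖ + ‖f y - f z - f' (y - z)‖ := by
    have := norm_sub_le (f y - f z) (f y - f z - f' (y - z))
    rwa [sub_sub_cancel] at this
  have h5 : (K : ℝ) * (1 / (2 * K) * ‖y - z‖) = ‖y - z‖ / 2 := by field_simp
  have h6 : (K : ℝ) * ‖f' (y - z)‖ ≤
      K * ‖f y - f z‖ + K * (1 / (2 * K) * ‖y - z‖) := by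
    rw [← mul_add]
    gcongr
    exact h4.trans (by gcongr)
  linarith

end LocalLipschitz

/-! ### The closed loop in coordinates and the change of variables -/

section CoordinateField

variable {n N : ℕ}
variable (X : EuclideanSpace ℝ (Fin n) → EuclideanSpace ℝ (Fin n) →L[ℝ] EuclideanSpace ℝ (Fin n))
  (ψ : EuclideanSpace ℝ (Fin n) → ℝ)
  (Γ : EuclideanSpace ℝ (Fin n) →L[ℝ] EuclideanSpace ℝ (Fin n) →L[ℝ] EuclideanSpace ℝ (Fin n))
  (R : EuclideanSpace ℝ (Fin n) →L[ℝ] EuclideanSpace ℝ (Fin n)) (α : ℝ → ℝ)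
  (a lam b kap h Ω : ℝ)

/-- The closed-loop vector field in local coordinates, as a function of the state, of the
perturbation, and of its antiderivative. -/
def coordField (p : LocalState n × EuclideanSpace ℝ (Fin n) × EuclideanSpace ℝ (Fin n)) :
    LocalState n :=
  (X p.1.1 p.1.2.1,
    -Γ p.1.2.1 p.1.2.1 - R p.1.2.1 +
      (-(b • (p.1.2.2.1 - (kap * α (ψ p.1.1 - p.1.2.2.2)) • p.2.1)) +
        (lam * α (ψ p.1.1 - p.1.2.2.2) * Ω) • p.2.2 +
        (lam ^ 2 * α (ψ p.1.1 - p.1.2.2.2) ^ 2) •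
          ∑ i, Γ (EuclideanSpace.single i 1) (EuclideanSpace.single i 1)),
    -(a • (p.1.2.2.1 - (kap * α (ψ p.1.1 - p.1.2.2.2)) • p.2.1)) +
      (kap * α (ψ p.1.1 - p.1.2.2.2) * Ω) • p.2.2,
    h * (ψ p.1.1 - p.1.2.2.2))

/-- The inverse of the change of variables in local coordinates. -/
def shiftState (p : LocalState n × EuclideanSpace ℝ (Fin n)) : LocalState n :=
  (p.1.1, p.1.2.1 + (lam * α (ψ p.1.1 - p.1.2.2.2)) • p.2,
    p.1.2.2.1 + (kap * α (ψ p.1.1 - p.1.2.2.2)) • p.2, p.1.2.2.2)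

variable {X ψ α}

theorem contDiff_coordField (hX : ContDiff ℝ 1 X) (hψ : ContDiff ℝ ∞ ψ) (hα : ContDiff ℝ ∞ α) :
    ContDiff ℝ 1 (coordField X ψ Γ R α a lam b kap h Ω) := by
  have h1 : ContDiff ℝ 1 α := hα.of_le (by norm_cast)
  have h3 : ContDiff ℝ 1 ψ := hψ.of_le (by norm_cast)
  unfold coordField
  fun_prop

theorem contDiff_shiftState (hψ : ContDiff ℝ ∞ ψ) (hα : ContDiff ℝ ∞ α) :
    ContDiff ℝ 1 (shiftState ψ α lam kap) := by
  have h1 : ContDiff ℝ 1 α := hα.of_le (by norm_cast)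
  have h3 : ContDiff ℝ 1 ψ := hψ.of_le (by norm_cast)
  unfold shiftState
  fun_prop

theorem contDiff_transformedField (hX : ContDiff ℝ 1 X) (hψ : ContDiff ℝ ∞ ψ)
    (hα : ContDiff ℝ ∞ α) :
    ContDiff ℝ 1 (fun p : LocalState n × EuclideanSpace ℝ (Fin n) =>
      transformedField X ψ Γ R α a lam b kap h p.1 p.2) := by
  have h1 : ContDiff ℝ 1 α := hα.of_le (by norm_cast)
  have h2 : ContDiff ℝ 1 (deriv α) := (contDiff_infty_iff_deriv.1 hα).2.of_le (by norm_cast)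
  have h3 : ContDiff ℝ 1 ψ := hψ.of_le (by norm_cast)
  have h4 : ContDiff ℝ 1 (fderiv ℝ ψ) := (hψ.fderiv_right (m := 1) (by norm_cast))
  simp only [transformedField]
  fun_prop

/-- By the product rule, differentiating `α U(Ωt)` produces the term `Ω α u(Ωt)` of the closed loop
and a term with the derivative of `α` that `transformedField` contains with opposite sign. Only
differentiability of `U` at the single time `Ω * t` is needed, which suits measurable `u`. -/
theorem hasDerivAt_shiftState (hψ : ContDiff ℝ ∞ ψ) (hα : ContDiff ℝ ∞ α)
    {y : ℝ → LocalState n} {U : ℝ → EuclideanSpace ℝ (Fin n)} {u : EuclideanSpace ℝ (Fin n)} {t : ℝ}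
    (hy : HasDerivAt y (transformedField X ψ Γ R α a lam b kap h (y t) (U (Ω * t))) t)
    (hU : HasDerivAt U u (Ω * t)) :
    HasDerivAt (fun t => shiftState ψ α lam kap (y t, U (Ω * t)))
      (coordField X ψ Γ R α a lam b kap h Ω
        (shiftState ψ α lam kap (y t, U (Ω * t)), U (Ω * t), u)) t := by
  set y' := transformedField X ψ Γ R α a lam b kap h (y t) (U (Ω * t)) with hy'
  have hq : HasDerivAt (fun t => (y t).1) y'.1 t := hy.fst
  have h2 : HasDerivAt (fun t => (y t).2) y'.2 t := hy.snd
  have hv : HasDerivAt (fun t => (y t).2.1) y'.2.1 t := h2.fst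
  have h3 : HasDerivAt (fun t => (y t).2.2) y'.2.2 t := h2.snd
  have hw : HasDerivAt (fun t => (y t).2.2.1) y'.2.2.1 t := h3.fst
  have hη : HasDerivAt (fun t => (y t).2.2.2) y'.2.2.2 t := h3.snd
  have hUt : HasDerivAt (fun t => U (Ω * t)) (Ω • u) t := by
    refine (HasDerivAt.scomp (h := fun t => Ω * t) t hU
      ((hasDerivAt_id t).const_mul Ω)).congr_deriv ?_
    rw [mul_one]
  have hψt : HasDerivAt (fun t => ψ (y t).1) (fderiv ℝ ψ (y t).1 y'.1) t :=
    HasFDerivAt.comp_hasDerivAt (f := fun t => (y t).1) t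
      ((hψ.differentiable (by simp)) (y t).1).hasFDerivAt hq
  have hz := hψt.sub hη
  have hαt : HasDerivAt (fun t => α (ψ (y t).1 - (y t).2.2.2))
      (deriv α (ψ (y t).1 - (y t).2.2.2) * (fderiv ℝ ψ (y t).1 y'.1 - y'.2.2.2)) t :=
    HasDerivAt.comp (h := fun t => ψ (y t).1 - (y t).2.2.2) t
      ((hα.differentiable (by simp)) _).hasDerivAt hz
  have hA := hq.prodMk ((hv.add ((hαt.const_mul lam).smul hUt)).prodMk
    ((hw.add ((hαt.const_mul kap).smul hUt)).prodMk hη))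
  refine hA.congr_deriv ?_
  simp only [hy', transformedField, coordField, shiftState, Prod.mk.injEq]
  refine ⟨trivial, ?_, ?_, trivial⟩
  · simp only [add_sub_cancel_right, smul_smul]
    module
  · simp only [add_sub_cancel_right, smul_smul]
    module

variable {F : Type*} [NormedAddCommGroup F] [NormedSpace ℝ F]
  (L : (EuclideanSpace ℝ (Fin N) × EuclideanSpace ℝ (Fin N) × EuclideanSpace ℝ (Fin n) × ℝ) →L[ℝ] F)

/-- The embedding of the state manifold in local coordinates. -/
def coordEmbedding (ι : EuclideanSpace ℝ (Fin n) → EuclideanSpace ℝ (Fin N))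
    (J : EuclideanSpace ℝ (Fin n) →L[ℝ] EuclideanSpace ℝ (Fin N)) (s : ℝ) (y : LocalState n) : F :=
  L (ι y.1, J y.2.1, y.2.2.1, y.2.2.2 + s)

theorem contDiff_coordEmbedding {ι : EuclideanSpace ℝ (Fin n) → EuclideanSpace ℝ (Fin N)}
    (hι : ContDiff ℝ ∞ ι) (J : EuclideanSpace ℝ (Fin n) →L[ℝ] EuclideanSpace ℝ (Fin N)) (s : ℝ) :
    ContDiff ℝ ∞ (coordEmbedding L ι J s) := by
  unfold coordEmbedding
  fun_prop

theorem fderiv_coordEmbedding {ι : EuclideanSpace ℝ (Fin n) → EuclideanSpace ℝ (Fin N)}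
    (hι : ContDiff ℝ ∞ ι) (J : EuclideanSpace ℝ (Fin n) →L[ℝ] EuclideanSpace ℝ (Fin N)) (s : ℝ)
    (y v : LocalState n) : fderiv ℝ (coordEmbedding L ι J s) y v =
      L (fderiv ℝ ι y.1 v.1, J v.2.1, v.2.2.1, v.2.2.2) := by
  have h1 : HasFDerivAt (fun y : LocalState n => ι y.1) ((fderiv ℝ ι y.1).comp
      (ContinuousLinearMap.fst ℝ _ _)) y :=
    HasFDerivAt.comp (g := ι) y ((hι.differentiable (by simp)) y.1).hasFDerivAt hasFDerivAt_fst
  have h2 : HasFDerivAt (fun y : LocalState n => y.2) (ContinuousLinearMap.snd ℝ _ _) y :=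
    hasFDerivAt_snd
  have h3 := J.hasFDerivAt.comp y h2.fst
  have h4 := L.hasFDerivAt.comp y (h1.prodMk (h3.prodMk (h2.snd.fst.prodMk
    (h2.snd.snd.add_const s))))
  have h5 : HasFDerivAt (coordEmbedding L ι J s) _ y := h4
  rw [h5.fderiv]
  rfl

end CoordinateField

/-! ### Coordinate representatives of the geometric data -/

section LocalModel

open Set Filter

variable {n N : ℕ} {G : Type*} [TopologicalSpace G] [ChartedSpace (EuclideanSpace ℝ (Fin n)) G]
  [Group G]

/-- The dissipation endomorphism in the coordinates given by a basis of the Lie algebra. -/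
def coordDissipation (R : GroupLieAlgebra (𝓡 n) G →ₗ[ℝ] GroupLieAlgebra (𝓡 n) G)
    (e : Module.Basis (Fin n) ℝ (GroupLieAlgebra (𝓡 n) G)) :
    EuclideanSpace ℝ (Fin n) →L[ℝ] EuclideanSpace ℝ (Fin n) :=
  LinearMap.toContinuousLinearMap ((fromCoordsEquiv e).symm.toLinearMap ∘ₗ R ∘ₗ
    (fromCoordsEquiv e).toLinearMap)

theorem fromCoords_coordDissipation (R : GroupLieAlgebra (𝓡 n) G →ₗ[ℝ] GroupLieAlgebra (𝓡 n) G)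
    (e : Module.Basis (Fin n) ℝ (GroupLieAlgebra (𝓡 n) G)) (v : EuclideanSpace ℝ (Fin n)) :
    fromCoordsEquiv e (coordDissipation R e v) = R (fromCoordsEquiv e v) :=
  (fromCoordsEquiv e).apply_symm_apply _

theorem fromCoords_single (e : Module.Basis (Fin n) ℝ (GroupLieAlgebra (𝓡 n) G)) (i : Fin n) :
    fromCoordsEquiv e (EuclideanSpace.single i 1) = e i := by
  rw [fromCoordsEquiv_apply, fromCoords]
  simp

/-- Orthonormality makes the inner product on the Lie algebra the Euclidean one, so that
dissipativity of `R` can be read in coordinates. -/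
theorem form_fromCoords {B : InnerProd (GroupLieAlgebra (𝓡 n) G)}
    {e : Module.Basis (Fin n) ℝ (GroupLieAlgebra (𝓡 n) G)}
    (he : ∀ i j, B.form (e i) (e j) = if i = j then 1 else 0) (v w : EuclideanSpace ℝ (Fin n)) :
    B.form (fromCoordsEquiv e v) (fromCoordsEquiv e w) = inner ℝ v w := by
  rw [fromCoordsEquiv_apply, fromCoordsEquiv_apply, fromCoords, fromCoords]
  simp [he, PiLp.inner_apply, mul_comm]

theorem inner_coordDissipation_nonneg {B : InnerProd (GroupLieAlgebra (𝓡 n) G)}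
    {e : Module.Basis (Fin n) ℝ (GroupLieAlgebra (𝓡 n) G)}
    (he : ∀ i j, B.form (e i) (e j) = if i = j then 1 else 0)
    {R : GroupLieAlgebra (𝓡 n) G →ₗ[ℝ] GroupLieAlgebra (𝓡 n) G}
    (hR : ∀ v, 0 ≤ B.form (R v) v) (v : EuclideanSpace ℝ (Fin n)) :
    0 ≤ inner ℝ (coordDissipation R e v) v := by
  rw [← form_fromCoords he, fromCoords_coordDissipation]
  exact hR _

theorem eventually_mem_extChartAt_source {g₀ : G} (x : ClosedLoopState n G) (hx : x.1 = g₀) :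
    ∀ᶠ x' in 𝓝 x, x'.1 ∈ (extChartAt (𝓡 n) g₀).source := by
  have h : ContinuousAt (fun x : ClosedLoopState n G => x.1) x := continuous_fst.continuousAt
  exact h.preimage_mem_nhds (by
    rw [hx]
    exact extChartAt_source_mem_nhds (I := 𝓡 n) g₀)

variable [LieGroup (𝓡 n) ∞ G]

/-- The restricted connection in the coordinates given by a basis of the Lie algebra. -/
def coordConnection (B : InnerProd (GroupLieAlgebra (𝓡 n) G))
    (e : Module.Basis (Fin n) ℝ (GroupLieAlgebra (𝓡 n) G)) :
    EuclideanSpace ℝ (Fin n) →L[ℝ] EuclideanSpace ℝ (Fin n) →L[ℝ] EuclideanSpace ℝ (Fin n) :=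
  LinearMap.toContinuousBilinearMap (LinearMap.mk₂ ℝ
    (fun v w => (fromCoordsEquiv e).symm
      (restrictedConnection B (fromCoordsEquiv e v) (fromCoordsEquiv e w)))
    (fun _ _ _ => by simp) (fun _ _ _ => by simp) (fun _ _ _ => by simp) (fun _ _ _ => by simp))

theorem fromCoords_coordConnection (B : InnerProd (GroupLieAlgebra (𝓡 n) G))
    (e : Module.Basis (Fin n) ℝ (GroupLieAlgebra (𝓡 n) G)) (v w : EuclideanSpace ℝ (Fin n)) :
    fromCoordsEquiv e (coordConnection B e v w) =
      restrictedConnection B (fromCoordsEquiv e v) (fromCoordsEquiv e w) :=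
  (fromCoordsEquiv e).apply_symm_apply _

/-- Globally smooth representatives, near the origin, of the left frame, of an output function and
of an embedding in local coordinates. -/
structure LocalModel (e : Module.Basis (Fin n) ℝ (GroupLieAlgebra (𝓡 n) G))
    (ι : G → EuclideanSpace ℝ (Fin N)) (ψ : G → ℝ) (g₀ : G) where
  /-- The left frame. -/
  frame : EuclideanSpace ℝ (Fin n) → EuclideanSpace ℝ (Fin n) →L[ℝ] EuclideanSpace ℝ (Fin n)
  /-- The output function, up to a constant. -/
  output : EuclideanSpace ℝ (Fin n) → ℝ
  /-- The embedding. -/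
  embed : EuclideanSpace ℝ (Fin n) → EuclideanSpace ℝ (Fin N)
  /-- The radius of a ball on which these functions represent the given data. -/
  radius : ℝ
  radius_pos : 0 < radius
  contDiff_frame : ContDiff ℝ 1 frame
  contDiff_output : ContDiff ℝ ∞ output
  contDiff_embed : ContDiff ℝ ∞ embed
  mem_domain : ∀ q, ‖q‖ < radius → q ∈ coordDomain e g₀
  frame_eq : ∀ q, ‖q‖ < radius → frame q = coordFrame e g₀ q
  output_eq : ∀ q, ‖q‖ < radius → output q = ψ (coordInv e g₀ q) - ψ g₀
  embed_eq : ∀ q, ‖q‖ < radius → embed q = ι (coordInv e g₀ q)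
  fderiv_embed : ∀ q, ‖q‖ < radius → ∀ v, fderiv ℝ embed q (frame q v) =
    mvfderiv (𝓡 n) ι (coordInv e g₀ q) (leftTranslate (coordInv e g₀ q) (fromCoords e v))

/-- The averaging theorem wants fields defined on the whole vector space, while the coordinate
expressions exist only on the chart; germs at the origin suffice and extend globally. -/
theorem nonempty_localModel (e : Module.Basis (Fin n) ℝ (GroupLieAlgebra (𝓡 n) G))
    {ι : G → EuclideanSpace ℝ (Fin N)} (hι : ContMDiff (𝓡 n) (𝓡 N) ∞ ι)
    {ψ : G → ℝ} (hψ : ContMDiff (𝓡 n) 𝓘(ℝ, ℝ) ∞ ψ) (g₀ : G) : Nonempty (LocalModel e ι ψ g₀) := by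
  have hO := isOpen_coordDomain e g₀
  have h0 := zero_mem_coordDomain e g₀
  obtain ⟨X, hX, hX'⟩ := ContDiffOn.exists_contDiff_eventuallyEq (k := 2)
    (contDiffOn_coordFrame e g₀) hO h0
  obtain ⟨f, hf, hf'⟩ := ContDiffOn.exists_contDiff_eventuallyEq (k := ⊤)
    (f := fun q => ψ (coordInv e g₀ q) - ψ g₀)
    ((contDiffOn_comp_coordInv e g₀ le_rfl hψ).sub contDiffOn_const) hO h0
  obtain ⟨j, hj, hj'⟩ := ContDiffOn.exists_contDiff_eventuallyEq (k := ⊤)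
    (contDiffOn_comp_coordInv e g₀ le_rfl hι) hO h0
  -- For the embedding, agreement on a neighborhood of each point of the ball is required, because
  -- its derivative there is compared as well.
  obtain ⟨r, hr, hb⟩ := Metric.eventually_nhds_iff.1
    ((hX'.and (hf'.and hj'.eventually_nhds)).and (hO.mem_nhds h0))
  have hb' : ∀ q, ‖q‖ < r → _ := fun q hq => @hb q (by rwa [dist_zero_right])
  exact ⟨{
    frame := X
    output := f
    embed := j
    radius := r
    radius_pos := hr
    contDiff_frame := hX.of_le (by norm_cast)
    contDiff_output := hf
    contDiff_embed := hj
    mem_domain := fun q hq => (hb' q hq).2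
    frame_eq := fun q hq => (hb' q hq).1.1
    output_eq := fun q hq => (hb' q hq).1.2.1
    embed_eq := fun q hq => (hb' q hq).1.2.2.self_of_nhds
    fderiv_embed := fun q hq v => by
      rw [Filter.EventuallyEq.fderiv_eq (hb' q hq).1.2.2, (hb' q hq).1.1]
      exact fderiv_comp_coordInv e g₀ hι (hb' q hq).2 v }⟩

namespace LocalModel

variable {e : Module.Basis (Fin n) ℝ (GroupLieAlgebra (𝓡 n) G)}
  {ι : G → EuclideanSpace ℝ (Fin N)} {ψ : G → ℝ} {g₀ : G} (m : LocalModel e ι ψ g₀)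

theorem frame_zero : m.frame 0 = ContinuousLinearMap.id ℝ _ := by
  rw [m.frame_eq 0 (by simpa using m.radius_pos), coordFrame_zero]

theorem output_zero : m.output 0 = 0 := by
  rw [m.output_eq 0 (by simpa using m.radius_pos), coordInv_zero, sub_self]

theorem ball_mem_nhds : ∀ᶠ q in 𝓝 (0 : EuclideanSpace ℝ (Fin n)), ‖q‖ < m.radius := by
  filter_upwards [Metric.ball_mem_nhds (0 : EuclideanSpace ℝ (Fin n)) m.radius_pos] with q hq
  rwa [← mem_ball_zero_iff]

theorem output_eventuallyEq :
    m.output =ᶠ[𝓝 0] fun q => ψ (coordInv e g₀ q) - ψ g₀ := by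
  filter_upwards [m.ball_mem_nhds] with q hq using m.output_eq q hq

theorem fderiv_output_zero (hmin : IsLocalMin ψ g₀) : fderiv ℝ m.output 0 = 0 := by
  rw [m.output_eventuallyEq.fderiv_eq, fderiv_sub_const]
  exact (isLocalMin_comp_coordInv e g₀ hmin).fderiv_eq_zero

theorem hessian_eq (hψ : ContMDiff (𝓡 n) 𝓘(ℝ, ℝ) ∞ ψ) (hmin : IsLocalMin ψ g₀)
    (B : InnerProd (GroupLieAlgebra (𝓡 n) G)) (v : EuclideanSpace ℝ (Fin n)) :
    hessian B ψ g₀ (leftTranslate g₀ (fromCoords e v)) (leftTranslate g₀ (fromCoords e v)) =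
      fderiv ℝ (fun q => fderiv ℝ m.output q (m.frame q v)) 0 v := by
  rw [hessian_eq_of_isLocalMin e g₀ B hψ hmin v]
  have h : (fun q => fderiv ℝ m.output q (m.frame q v)) =ᶠ[𝓝 0] fun q =>
      fderiv ℝ (fun q => ψ (coordInv e g₀ q)) q (coordFrame e g₀ q v) := by
    filter_upwards [m.ball_mem_nhds, m.output_eventuallyEq.eventually_nhds] with q hq hq'
    rw [Filter.EventuallyEq.fderiv_eq hq', fderiv_sub_const, m.frame_eq q hq]
  rw [h.fderiv_eq]

/-- The parametrization of the state manifold. -/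
def param (_ : LocalModel e ι ψ g₀) (y : LocalState n) : ClosedLoopState n G :=
  (coordInv e g₀ y.1, fromCoordsEquiv e y.2.1, y.2.2.1, y.2.2.2 + ψ g₀)

/-- The coordinates on the state manifold. -/
def coords (_ : LocalModel e ι ψ g₀) (x : ClosedLoopState n G) : LocalState n :=
  (coordMap e g₀ x.1, (fromCoordsEquiv e).symm x.2.1, x.2.2.1, x.2.2.2 - ψ g₀)

theorem param_coords {x : ClosedLoopState n G} (hx : x.1 ∈ (extChartAt (𝓡 n) g₀).source) :
    m.param (m.coords x) = x := by
  simp [param, coords, coordInv_coordMap e g₀ hx]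

theorem param_zero : m.param 0 = (g₀, 0, 0, ψ g₀) := by
  simp [param, coordInv_zero]

theorem continuousAt_coords (x : ClosedLoopState n G) (hx : x.1 = g₀) :
    ContinuousAt m.coords x := by
  have h1 : ContinuousAt (coordMap e g₀) x.1 := by
    rw [hx]
    exact (hasMFDerivAt_coordMap e g₀ (mem_extChartAt_source g₀)).continuousAt
  have h2 : ContinuousAt (fun x : ClosedLoopState n G => coordMap e g₀ x.1) x :=
    ContinuousAt.comp (g := coordMap e g₀) h1 continuous_fst.continuousAt
  have h3 : Continuous fun x : ClosedLoopState n G =>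
      ((fromCoordsEquiv e).symm x.2.1, x.2.2.1, x.2.2.2 - ψ g₀) := by fun_prop
  exact h2.prodMk h3.continuousAt

section Lipschitz

variable {F : Type*} [NormedAddCommGroup F] [NormedSpace ℝ F]
  (L : (EuclideanSpace ℝ (Fin N) × EuclideanSpace ℝ (Fin N) × EuclideanSpace ℝ (Fin n) × ℝ) →L[ℝ] F)

/-- The differential of the embedding at the identity, in coordinates. -/
def tangentEmbedding (_ : LocalModel e ι ψ g₀) :
    EuclideanSpace ℝ (Fin n) →L[ℝ] EuclideanSpace ℝ (Fin N) :=
  (mvfderiv (𝓡 n) ι 1).comp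
    (fromCoordsEquiv e : EuclideanSpace ℝ (Fin n) →L[ℝ] GroupLieAlgebra (𝓡 n) G)

theorem tangentEmbedding_apply (v : EuclideanSpace ℝ (Fin n)) :
    m.tangentEmbedding v = mvfderiv (𝓡 n) ι 1 (fromCoordsEquiv e v) := rfl

theorem coordEmbedding_eq {y : LocalState n} (hy : ‖y.1‖ < m.radius) :
    coordEmbedding L m.embed m.tangentEmbedding (ψ g₀) y =
      L (ι (m.param y).1, mvfderiv (𝓡 n) ι 1 (m.param y).2.1, (m.param y).2.2.1,
        (m.param y).2.2.2) := by
  rw [coordEmbedding, m.embed_eq _ hy]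
  rfl

/-- The coordinates depend on the point of the ambient space in a Lipschitz way. -/
theorem exists_norm_sub_le (hι : Manifold.IsSmoothEmbedding (𝓡 n) (𝓡 N) ∞ ι)
    (hL : Function.Injective L) (y₀ : LocalState n) (hy₀ : y₀.1 = 0) :
    ∃ C > 0, ∃ s ∈ 𝓝 y₀, ∀ y ∈ s, ∀ z ∈ s, ‖y - z‖ ≤
      C * ‖coordEmbedding L m.embed m.tangentEmbedding (ψ g₀) y -
        coordEmbedding L m.embed m.tangentEmbedding (ψ g₀) z‖ := by
  have hs := ((contDiff_coordEmbedding L m.contDiff_embed m.tangentEmbedding (ψ g₀)).contDiffAt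
    (x := y₀)).hasStrictFDerivAt (by simp)
  refine hs.exists_norm_sub_le_of_injective ?_
  -- The differential splits into the differential of `ι` at the base point, its differential at the
  -- identity, and identities; each is injective.
  rw [injective_iff_map_eq_zero]
  intro v hv
  rw [fderiv_coordEmbedding L m.contDiff_embed] at hv
  have h1 := hL (hv.trans (map_zero L).symm)
  simp only [Prod.mk_eq_zero] at h1
  obtain ⟨h2, h3, h4, h5⟩ := h1
  have hfr := leftFrame_apply e (coordInv e g₀ 0) v.1
  have h6 : v.1 = 0 := by
    rw [hy₀] at h2
    have h7 := m.fderiv_embed 0 (by simpa using m.radius_pos) v.1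
    rw [m.frame_zero, ContinuousLinearMap.id_apply, h2] at h7
    have h8 := injective_mvfderiv_of_isSmoothEmbedding hι (coordInv e g₀ 0)
      (h7.symm.trans (map_zero _).symm)
    rw [← hfr] at h8
    exact (leftFrame e _).map_eq_zero_iff.1 h8
  have h9 : v.2.1 = 0 := by
    rw [tangentEmbedding_apply] at h3
    have h8 := injective_mvfderiv_of_isSmoothEmbedding hι 1 (h3.trans (map_zero _).symm)
    exact (fromCoordsEquiv e).map_eq_zero_iff.1 h8
  exact Prod.ext h6 (Prod.ext h9 (Prod.ext h4 h5))

variable (B : InnerProd (GroupLieAlgebra (𝓡 n) G))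
    (R : GroupLieAlgebra (𝓡 n) G →ₗ[ℝ] GroupLieAlgebra (𝓡 n) G)
    (α : ℝ → ℝ) (a lam b kap h : ℝ) (T : ℝ) (u : ℝ → EuclideanSpace ℝ (Fin n)) (Ω t : ℝ)

/-- The closed-loop vector field in local coordinates. -/
theorem fderiv_coordEmbedding_coordField {y : LocalState n} (hy : ‖y.1‖ < m.radius) :
    fderiv ℝ (coordEmbedding L m.embed m.tangentEmbedding (ψ g₀)) y
      (coordField m.frame m.output (coordConnection B e) (coordDissipation R e) α a lam b kap h Ω
        (y, zeroMeanAntiderivative T u (Ω * t), u (Ω * t))) =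
    L (mvfderiv (𝓡 n) ι (m.param y).1 (leftTranslate (m.param y).1 (m.param y).2.1),
      mvfderiv (𝓡 n) ι 1 (-restrictedConnection B (m.param y).2.1 (m.param y).2.1 -
        R (m.param y).2.1 + feedback B ψ α lam b kap e T u Ω t (m.param y)),
      -(a • ((m.param y).2.2.1 - (kap * α (ψ (m.param y).1 - (m.param y).2.2.2)) •
          zeroMeanAntiderivative T u (Ω * t))) +
        (kap * α (ψ (m.param y).1 - (m.param y).2.2.2) * Ω) • u (Ω * t),
      -(h * (m.param y).2.2.2) + h * ψ (m.param y).1) := by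
  have hz : m.output y.1 - y.2.2.2 = ψ (m.param y).1 - (m.param y).2.2.2 := by
    rw [m.output_eq _ hy]
    simp only [param]
    ring
  rw [fderiv_coordEmbedding L m.contDiff_embed]
  congr 1
  simp only [coordField, m.fderiv_embed _ hy, Prod.mk.injEq, tangentEmbedding_apply]
  refine ⟨?_, ?_, ?_, ?_⟩
  · rw [← fromCoordsEquiv_apply]
    rfl
  · congr 1
    rw [hz]
    simp only [feedback, param, map_add, map_sub, map_neg, map_smul, map_sum,
      fromCoords_coordConnection, fromCoords_coordDissipation, fromCoords_single,
      ← fromCoordsEquiv_apply]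
  · rw [hz]
    rfl
  · rw [hz]
    ring

theorem symm_changeOfVariables_param {y : LocalState n} (hy : ‖y.1‖ < m.radius) :
    (changeOfVariables ψ α lam kap e T u Ω t).symm (m.param y) =
      m.param (shiftState m.output α lam kap (y, zeroMeanAntiderivative T u (Ω * t))) := by
  have hz : m.output y.1 - y.2.2.2 = ψ (m.param y).1 - (m.param y).2.2.2 := by
    rw [m.output_eq _ hy]
    simp only [param]
    ring
  change ((m.param y).1, (m.param y).2.1 + (lam * α (ψ (m.param y).1 - (m.param y).2.2.2)) •
      fromCoords e (zeroMeanAntiderivative T u (Ω * t)), (m.param y).2.2.1 +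
      (kap * α (ψ (m.param y).1 - (m.param y).2.2.2)) • zeroMeanAntiderivative T u (Ω * t),
      (m.param y).2.2.2) = _
  rw [← hz, ← fromCoordsEquiv_apply]
  simp only [param, shiftState, map_add, map_smul]

end Lipschitz

end LocalModel

end LocalModel

/-! ### The closed loop in the ambient space -/

section LinearEmbedding

open Set Filter MeasureTheory

variable {n N : ℕ} {G : Type*} [TopologicalSpace G] [ChartedSpace (EuclideanSpace ℝ (Fin n)) G]
  [Group G] {F : Type*} [NormedAddCommGroup F] [NormedSpace ℝ F]
  (L : (EuclideanSpace ℝ (Fin N) × EuclideanSpace ℝ (Fin N) × EuclideanSpace ℝ (Fin n) × ℝ) →L[ℝ] F)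
  (ι : G → EuclideanSpace ℝ (Fin N))

/-- The map from the state manifold into a normed space that is induced by a map `ι` on `G` and by a
linear map `L`. -/
def stateEmbeddingInto : ClosedLoopState n G → F :=
  fun x => L (ι x.1, mvfderiv (𝓡 n) ι 1 x.2.1, x.2.2.1, x.2.2.2)

variable {L ι} in
theorem isEmbedding_stateEmbeddingInto [LieGroup (𝓡 n) ∞ G]
    (hι : Manifold.IsSmoothEmbedding (𝓡 n) (𝓡 N) ∞ ι)
    (hL : Function.Injective L) : Topology.IsEmbedding (stateEmbeddingInto L ι) := by
  have h1 : Topology.IsEmbedding L :=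
    (LinearMap.isClosedEmbedding_of_injective (f := L.toLinearMap)
      (LinearMap.ker_eq_bot.2 hL)).isEmbedding
  have h2 : Topology.IsEmbedding (mvfderiv (𝓡 n) ι 1) :=
    (LinearMap.isClosedEmbedding_of_injective
      (f := (mvfderiv (𝓡 n) ι 1 : TangentSpace (𝓡 n) (1 : G) →L[ℝ] EuclideanSpace ℝ (Fin N)).toLinearMap)
      (LinearMap.ker_eq_bot.2 (injective_mvfderiv_of_isSmoothEmbedding hι 1))).isEmbedding
  exact h1.comp (hι.isEmbedding.prodMap (h2.prodMap Topology.IsEmbedding.id))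

variable [LieGroup (𝓡 n) ∞ G] (B : InnerProd (GroupLieAlgebra (𝓡 n) G))
  (R : GroupLieAlgebra (𝓡 n) G →ₗ[ℝ] GroupLieAlgebra (𝓡 n) G) (ψ : G → ℝ) (α : ℝ → ℝ)
  (a lam b kap h : ℝ) (e : Module.Basis (Fin n) ℝ (GroupLieAlgebra (𝓡 n) G))
  (T : ℝ) (u : ℝ → EuclideanSpace ℝ (Fin n)) (Ω t : ℝ)

/-- The closed-loop vector field, mapped to a normed space by `stateEmbeddingInto L ι`. -/
def closedLoopInto (x : ClosedLoopState n G) : F :=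
  L (mvfderiv (𝓡 n) ι x.1 (leftTranslate x.1 x.2.1),
    mvfderiv (𝓡 n) ι 1 (-restrictedConnection B x.2.1 x.2.1 - R x.2.1 +
      feedback B ψ α lam b kap e T u Ω t x),
    -(a • (x.2.2.1 - (kap * α (ψ x.1 - x.2.2.2)) • zeroMeanAntiderivative T u (Ω * t))) +
      (kap * α (ψ x.1 - x.2.2.2) * Ω) • u (Ω * t),
    -(h * x.2.2.2) + h * ψ x.1)

variable {L ι ψ α e T u}

theorem contDiff_fderiv_coordField {g₀ : G} (m : LocalModel e ι ψ g₀) (hα : ContDiff ℝ ∞ α) :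
    ContDiff ℝ 1 (fun p => fderiv ℝ (coordEmbedding L m.embed m.tangentEmbedding (ψ g₀)) p.1
      (coordField m.frame m.output (coordConnection B e) (coordDissipation R e) α
        a lam b kap h Ω p)) := by
  have h1 : ContDiff ℝ 1 (fderiv ℝ (coordEmbedding L m.embed m.tangentEmbedding (ψ g₀))) :=
    (contDiff_coordEmbedding L m.contDiff_embed _ _).fderiv_right (by norm_cast)
  exact (h1.comp contDiff_fst).clm_apply
    (contDiff_coordField _ _ a lam b kap h Ω m.contDiff_frame m.contDiff_output hα)

/-- In coordinates centred at the point, the field is `C¹` in the state and the pair of signal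
values, and the latter stay in a compact ball; this makes the Lipschitz constant uniform in time.
The expanding property of the embedding then replaces coordinate distances by ambient ones. -/
theorem locallyLipschitzAlong_closedLoopInto (hι : Manifold.IsSmoothEmbedding (𝓡 n) (𝓡 N) ∞ ι)
    (hL : Function.Injective L) (hψ : ContMDiff (𝓡 n) 𝓘(ℝ, ℝ) ∞ ψ) (hα : ContDiff ℝ ∞ α)
    {C : ℝ} (hu : ∀ τ, ‖u τ‖ ≤ C) (hU : ∀ τ, ‖zeroMeanAntiderivative T u τ‖ ≤ C) :
    LocallyLipschitzAlong (stateEmbeddingInto L ι)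
      (closedLoopInto L ι B R ψ α a lam b kap h e T u Ω) := by
  intro p
  obtain ⟨m⟩ := nonempty_localModel e hι.isImmersion.contMDiff hψ p.1
  have hp : (m.coords p).1 = 0 := coordMap_self e p.1
  obtain ⟨C₁, hC₁, s, hs, hsep⟩ := m.exists_norm_sub_le L hι hL (m.coords p) hp
  obtain ⟨K, hK⟩ := (contDiff_fderiv_coordField (L := L) B R a lam b kap h Ω m hα
    ).exists_lipschitzOnWith_of_isCompact ((isCompact_closedBall (m.coords p) 1).prod
      ((isCompact_closedBall (0 : EuclideanSpace ℝ (Fin n)) C).prod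
        (isCompact_closedBall (0 : EuclideanSpace ℝ (Fin n)) C)))
  have hr : {y : LocalState n | ‖y.1‖ < m.radius} ∈ 𝓝 (m.coords p) :=
    (isOpen_lt (by fun_prop) continuous_const).mem_nhds (by simpa [hp] using m.radius_pos)
  refine ⟨_, inter_mem (eventually_mem_extChartAt_source p rfl) ((m.continuousAt_coords p rfl
    ).preimage_mem_nhds (inter_mem hs (inter_mem (Metric.closedBall_mem_nhds _ one_pos) hr))),
    K * C₁, ?_⟩
  rintro t x ⟨hx1, hx2, hx3, hx4⟩ y ⟨hy1, hy2, hy3, hy4⟩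
  have hU' : zeroMeanAntiderivative T u (Ω * t) ∈
      Metric.closedBall (0 : EuclideanSpace ℝ (Fin n)) C := mem_closedBall_zero_iff.2 (hU _)
  have hu' : u (Ω * t) ∈
      Metric.closedBall (0 : EuclideanSpace ℝ (Fin n)) C := mem_closedBall_zero_iff.2 (hu _)
  have hf : ∀ x : ClosedLoopState n G, x.1 ∈ (extChartAt (𝓡 n) p.1).source →
      ‖(m.coords x).1‖ < m.radius → closedLoopInto L ι B R ψ α a lam b kap h e T u Ω t x =
        fderiv ℝ (coordEmbedding L m.embed m.tangentEmbedding (ψ p.1)) (m.coords x)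
          (coordField m.frame m.output (coordConnection B e) (coordDissipation R e) α
            a lam b kap h Ω (m.coords x, zeroMeanAntiderivative T u (Ω * t), u (Ω * t))) := by
    intro x hx hx'
    rw [m.fderiv_coordEmbedding_coordField L B R α a lam b kap h T u Ω t hx', m.param_coords hx]
    rfl
  have hΦ : ∀ x : ClosedLoopState n G, x.1 ∈ (extChartAt (𝓡 n) p.1).source →
      ‖(m.coords x).1‖ < m.radius → stateEmbeddingInto L ι x =
        coordEmbedding L m.embed m.tangentEmbedding (ψ p.1) (m.coords x) := by
    intro x hx hx'
    rw [m.coordEmbedding_eq L hx', m.param_coords hx]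
    rfl
  rw [hf x hx1 hx4, hf y hy1 hy4, hΦ x hx1 hx4, hΦ y hy1 hy4]
  have h1 := hK.dist_le_mul (m.coords x, zeroMeanAntiderivative T u (Ω * t), u (Ω * t))
    ⟨hx3, hU', hu'⟩ (m.coords y, zeroMeanAntiderivative T u (Ω * t), u (Ω * t)) ⟨hy3, hU', hu'⟩
  rw [dist_eq_norm] at h1
  refine h1.trans ?_
  rw [mul_assoc]
  refine mul_le_mul_of_nonneg_left ?_ K.2
  refine le_trans ?_ (hsep _ hx2 _ hy2)
  simp [dist_eq_norm]

theorem ae_comp_const_mul {P : ℝ → Prop} (hP : ∀ᵐ τ, P τ) {Ω : ℝ} (hΩ : Ω ≠ 0) :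
    ∀ᵐ τ : ℝ, P (Ω * τ) := by
  rw [ae_iff] at hP ⊢
  have h := Real.volume_preimage_mul_left hΩ {τ | ¬P τ}
  rw [hP, mul_zero] at h
  exact h

/-- The curve is a smooth map composed with a differentiable coordinate solution and the Lipschitz
signal `U(Ωt)`. So it is locally Lipschitz, and its derivative is the closed-loop field wherever `U`
has derivative `u`, that is, almost everywhere. -/
theorem isSolutionOn_closedLoopInto [CompleteSpace F] {g₀ : G} (m : LocalModel e ι ψ g₀)
    (hα : ContDiff ℝ ∞ α)
    (hu_meas : Measurable u) {C : ℝ} (hu : ∀ τ, ‖u τ‖ ≤ C) (hΩ : Ω ≠ 0) {J : Set ℝ}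
    (hJ : IsOpen J) (hJ' : J.OrdConnected) {y : ℝ → LocalState n} (hyc : Continuous y)
    (hyr : ∀ t ∈ J, ‖y t‖ < m.radius)
    (hy : ∀ t ∈ J, HasDerivAt y (transformedField m.frame m.output (coordConnection B e)
      (coordDissipation R e) α a lam b kap h (y t) (zeroMeanAntiderivative T u (Ω * t))) t) :
    IsSolutionOn (stateEmbeddingInto L ι) (closedLoopInto L ι B R ψ α a lam b kap h e T u Ω) J
      (fun t => (changeOfVariables ψ α lam kap e T u Ω t).symm (m.param (y t))) := by
  set U := zeroMeanAntiderivative T u with hU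
  have hUlip : LipschitzWith C.toNNReal U := lipschitzWith_zeroMeanAntiderivative hu_meas hu
  have hUc : Continuous fun t => U (Ω * t) := hUlip.continuous.comp (by fun_prop)
  let Y : ℝ → LocalState n := fun t => shiftState m.output α lam kap (y t, U (Ω * t))
  let Ψ : LocalState n → F := coordEmbedding L m.embed m.tangentEmbedding (ψ g₀)
  let V : LocalState n × EuclideanSpace ℝ (Fin n) × EuclideanSpace ℝ (Fin n) → F := fun p =>
    fderiv ℝ Ψ p.1 (coordField m.frame m.output (coordConnection B e) (coordDissipation R e) α
      a lam b kap h Ω p)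
  have hV : Continuous V := (contDiff_fderiv_coordField B R a lam b kap h Ω m hα).continuous
  have hΨ : ContDiff ℝ ∞ Ψ := contDiff_coordEmbedding L m.contDiff_embed _ _
  have hshift := contDiff_shiftState lam kap m.contDiff_output hα
  have hYc : Continuous Y := hshift.continuous.comp (hyc.prodMk hUc)
  have hyr' : ∀ t ∈ J, ‖(y t).1‖ < m.radius := fun t ht => (norm_fst_le _).trans_lt (hyr t ht)
  have hx : ∀ t ∈ J, (changeOfVariables ψ α lam kap e T u Ω t).symm (m.param (y t)) =
      m.param (Y t) := fun t ht =>
    m.symm_changeOfVariables_param α lam kap T u Ω t (hyr' t ht)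
  have hΦ : ∀ t ∈ J, stateEmbeddingInto L ι
      ((changeOfVariables ψ α lam kap e T u Ω t).symm (m.param (y t))) = Ψ (Y t) := by
    intro t ht
    rw [hx t ht]
    exact (m.coordEmbedding_eq L (y := Y t) (hyr' t ht)).symm
  have hf : ∀ t ∈ J, closedLoopInto L ι B R ψ α a lam b kap h e T u Ω t
      ((changeOfVariables ψ α lam kap e T u Ω t).symm (m.param (y t))) =
        V (Y t, U (Ω * t), u (Ω * t)) := by
    intro t ht
    rw [hx t ht]
    exact (m.fderiv_coordEmbedding_coordField L B R α a lam b kap h T u Ω t (y := Y t)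
      (hyr' t ht)).symm
  have hVm : StronglyMeasurable fun t => V (Y t, U (Ω * t), u (Ω * t)) :=
    hV.comp_stronglyMeasurable (hYc.stronglyMeasurable.prodMk
      (hUc.stronglyMeasurable.prodMk (hu_meas.comp (by fun_prop)).stronglyMeasurable))
  -- Boundedness of `u` replaces continuity: its values lie in a compact ball, and the other
  -- arguments run through a compact image.
  have hVb : ∀ s t, ∃ M, ∀ τ ∈ uIcc s t, ‖V (Y τ, U (Ω * τ), u (Ω * τ))‖ ≤ M := by
    intro s t
    obtain ⟨M, hM⟩ := (((isCompact_uIcc (a := s) (b := t)).image (hYc.prodMk hUc)).prod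
      (isCompact_closedBall (0 : EuclideanSpace ℝ (Fin n)) C)).exists_bound_of_continuousOn
        (f := fun p => V (p.1.1, p.1.2, p.2))
        (hV.comp (by fun_prop : Continuous fun p : (LocalState n × EuclideanSpace ℝ (Fin n)) ×
          EuclideanSpace ℝ (Fin n) => (p.1.1, p.1.2, p.2))).continuousOn
    exact ⟨M, fun τ hτ => hM ((Y τ, U (Ω * τ)), u (Ω * τ))
      ⟨mem_image_of_mem _ hτ, mem_closedBall_zero_iff.2 (hu _)⟩⟩
  have hVi : ∀ s t, IntervalIntegrable (fun t => V (Y t, U (Ω * t), u (Ω * t))) volume s t := by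
    intro s t
    obtain ⟨M, hM⟩ := hVb s t
    refine (intervalIntegrable_const (c := M)).mono_fun' hVm.aestronglyMeasurable ?_
    refine (ae_restrict_iff' measurableSet_uIoc).2 (Eventually.of_forall fun τ hτ => ?_)
    exact hM τ (uIoc_subset_uIcc hτ)
  have hΨY : ∀ s ∈ J, ∀ t ∈ J, ∃ K, LipschitzOnWith K (fun τ => Ψ (Y τ)) (uIcc s t) := by
    intro s hs t ht
    have hsub : uIcc s t ⊆ J := hJ'.uIcc_subset hs ht
    have hW : Continuous fun τ => transformedField m.frame m.output (coordConnection B e)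
        (coordDissipation R e) α a lam b kap h (y τ) (U (Ω * τ)) :=
      (contDiff_transformedField _ _ a lam b kap h m.contDiff_frame m.contDiff_output
        hα).continuous.comp (hyc.prodMk hUc)
    obtain ⟨M, hM⟩ := (isCompact_uIcc (a := s) (b := t)).exists_bound_of_continuousOn
      hW.continuousOn
    have hylip : LipschitzOnWith M.toNNReal y (uIcc s t) := by
      refine (convex_uIcc s t).lipschitzOnWith_of_nnnorm_hasDerivWithin_le
        (fun τ hτ => (hy τ (hsub hτ)).hasDerivWithinAt) fun τ hτ => ?_
      exact NNReal.le_toNNReal_of_coe_le (hM τ hτ)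
    have hlip : LipschitzWith (C.toNNReal * ‖Ω‖₊) fun t => U (Ω * t) :=
      hUlip.comp (lipschitzWith_iff_norm_sub_le.2 fun x y => by
        rw [← mul_sub, norm_mul, coe_nnnorm])
    obtain ⟨K, hK⟩ := ((hΨ.of_le (by norm_cast)).comp hshift).exists_lipschitzOnWith_of_isCompact
      ((isCompact_uIcc (a := s) (b := t)).image (hyc.prodMk hUc))
    exact ⟨_, hK.comp (hylip.prodMk hlip.lipschitzOnWith) (mapsTo_image _ _)⟩
  refine ⟨hJ, hJ', fun s hs t ht => ?_, fun s hs t ht => ?_⟩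
  · refine (hVi s t).congr fun τ hτ => ?_
    exact (hf τ (hJ'.uIcc_subset hs ht (uIoc_subset_uIcc hτ))).symm
  · have hsub : uIcc s t ⊆ J := hJ'.uIcc_subset hs ht
    rw [hΦ s hs, hΦ t ht]
    obtain ⟨K, hK⟩ := hΨY s hs t ht
    obtain ⟨M, hM⟩ := hVb s t
    rw [hK.integral_eq_sub_of_ae_hasDerivAt (hVi s t) hM]
    · exact intervalIntegral.integral_congr fun τ hτ => (hf τ (hsub hτ)).symm
    -- Rescaling time by a nonzero factor preserves null sets, so `U` is differentiable at `Ω * τ`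
    -- for almost every `τ`.
    · filter_upwards [ae_comp_const_mul
        (ae_hasDerivAt_zeroMeanAntiderivative (T := T) hu_meas hu) hΩ] with τ hτ hτ'
      exact HasFDerivAt.comp_hasDerivAt (f := Y) τ
        ((hΨ.differentiable (by simp)) (Y τ)).hasFDerivAt
        (hasDerivAt_shiftState (coordConnection B e) (coordDissipation R e) a lam b kap h Ω
          m.contDiff_output hα (hy τ (hsub hτ')) hτ)

end LinearEmbedding

/-! ### From coordinate estimates to practical stability -/

section Stability

open Set Filter

variable {n N : ℕ} {G : Type*} [TopologicalSpace G] [ChartedSpace (EuclideanSpace ℝ (Fin n)) G]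
  [Group G] [LieGroup (𝓡 n) ∞ G]

/-- Coordinates and ambient space induce the same topology near the equilibrium, so the coordinate
estimates transfer in both directions. An arbitrary injective linear `L` keeps the choice of ambient
norm out of the argument. -/
theorem locallyPracticallyUniformlyAsymptoticallyStable_closedLoopInto
    {F : Type*} [NormedAddCommGroup F] [NormedSpace ℝ F] [CompleteSpace F]
    {L : (EuclideanSpace ℝ (Fin N) × EuclideanSpace ℝ (Fin N) × EuclideanSpace ℝ (Fin n) × ℝ)
      →L[ℝ] F} (hL : Function.Injective L)
    {ι : G → EuclideanSpace ℝ (Fin N)} (hι : Manifold.IsSmoothEmbedding (𝓡 n) (𝓡 N) ∞ ι)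
    (B : InnerProd (GroupLieAlgebra (𝓡 n) G))
    (R : GroupLieAlgebra (𝓡 n) G →ₗ[ℝ] GroupLieAlgebra (𝓡 n) G)
    (hR_nonneg : ∀ v, 0 ≤ B.form (R v) v)
    {ψ : G → ℝ} (hψ : ContMDiff (𝓡 n) 𝓘(ℝ, ℝ) ∞ ψ)
    {T : ℝ} (hT : 0 < T) {u : ℝ → EuclideanSpace ℝ (Fin n)} (hu_meas : Measurable u)
    (hu_bdd : ∃ C, ∀ τ, ‖u τ‖ ≤ C) (hu_per : Function.Periodic u T)
    (hu_mean : ∫ τ in (0 : ℝ)..T, u τ = 0)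
    (hU : ∀ i j, T⁻¹ * (∫ τ in (0 : ℝ)..T,
      zeroMeanAntiderivative T u τ i * zeroMeanAntiderivative T u τ j) = if i = j then 1 else 0)
    {α : ℝ → ℝ} (hα : ContDiff ℝ ∞ α) (hα_pos : 0 < α 0 * deriv α 0)
    {a lam b kap h : ℝ} (ha : 0 < a) (hlam : 0 < lam) (hb : 0 < b) (hkap : 0 < kap) (hh : 0 < h)
    (hgains : 0 < a * lam - b * kap)
    {e : Module.Basis (Fin n) ℝ (GroupLieAlgebra (𝓡 n) G)}
    (he : ∀ i j, B.form (e i) (e j) = if i = j then 1 else 0)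
    {gs : G} (hmin : IsLocalMin ψ gs)
    (hHess : ∀ X : TangentSpace (𝓡 n) gs, X ≠ 0 → 0 < hessian B ψ gs X X) :
    LocallyPracticallyUniformlyAsymptoticallyStable (stateEmbeddingInto L ι)
      (closedLoopInto L ι B R ψ α a lam b kap h e T u)
      (changeOfVariables ψ α lam kap e T u)
      ((gs, 0, 0, ψ gs) : ClosedLoopState n G) := by
  obtain ⟨Cu, hCu⟩ := hu_bdd
  obtain ⟨CU, hCU⟩ := exists_norm_zeroMeanAntiderivative_le hT hu_meas hCu hu_per hu_mean
  obtain ⟨m⟩ := nonempty_localModel e hι.isImmersion.contMDiff hψ gs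
  set Φ := stateEmbeddingInto (n := n) L ι with hΦdef
  set xs : ClosedLoopState n G := (gs, 0, 0, ψ gs) with hxs
  have hemb : Topology.IsEmbedding Φ := isEmbedding_stateEmbeddingInto hι hL
  have hlip : ∀ Ω, LocallyLipschitzAlong Φ (closedLoopInto L ι B R ψ α a lam b kap h e T u Ω) :=
    fun Ω => locallyLipschitzAlong_closedLoopInto B R a lam b kap h Ω hι hL hψ hα (C := max Cu CU)
      (fun τ => (hCu τ).trans (le_max_left _ _)) (fun τ => (hCU τ).trans (le_max_right _ _))
  have hHess' : ∀ v, v ≠ 0 → 0 < fderiv ℝ (fun q => fderiv ℝ m.output q (m.frame q v)) 0 v := by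
    intro v hv
    rw [← m.hessian_eq hψ hmin B]
    refine hHess _ fun h0 => hv ?_
    rw [← leftFrame_apply] at h0
    exact (leftFrame e gs).map_eq_zero_iff.1 h0
  obtain ⟨r₀, hr₀, hsol⟩ := exists_solution_transformedField (coordConnection B e)
    (coordDissipation R e) m.contDiff_frame m.contDiff_output hα m.frame_zero m.output_zero
    (m.fderiv_output_zero hmin) hHess' (inner_coordDissipation_nonneg he hR_nonneg) hα_pos
    ha hlam hb hkap hh hgains hT (lipschitzWith_zeroMeanAntiderivative hu_meas hCu).continuous
    (periodic_zeroMeanAntiderivative hu_meas hCu hu_per hu_mean)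
    (integral_zeroMeanAntiderivative hT hu_meas hCu) hU
  -- closeness in the ambient space
  have hclose : ∀ ε > 0, ∃ r > 0, ∀ y : LocalState n, ‖y‖ < r → ‖Φ (m.param y) - Φ xs‖ ≤ ε := by
    intro ε hε
    have hc := (contDiff_coordEmbedding L m.contDiff_embed m.tangentEmbedding (ψ gs)
      ).continuous.continuousAt (x := 0)
    obtain ⟨δ, hδ, hb⟩ := Metric.continuousAt_iff.1 hc ε hε
    refine ⟨min δ m.radius, lt_min hδ m.radius_pos, fun y hy => ?_⟩
    have h1 := @hb y (by rw [dist_zero_right]; exact hy.trans_le (min_le_left _ _))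
    rw [m.coordEmbedding_eq L ((norm_fst_le y).trans_lt (hy.trans_le (min_le_right _ _))),
      m.coordEmbedding_eq L (by simpa using m.radius_pos), m.param_zero, dist_eq_norm] at h1
    exact h1.le
  have hcoords : ∀ ρ > 0, ∀ᶠ x in 𝓝 xs,
      x.1 ∈ (extChartAt (𝓡 n) gs).source ∧ ‖m.coords x‖ ≤ ρ := by
    intro ρ hρ
    have h1 := m.continuousAt_coords xs rfl
    have h2 : m.coords xs = 0 := by simp [LocalModel.coords, hxs, coordMap_self]
    have h3 : Metric.closedBall (0 : LocalState n) ρ ∈ 𝓝 (m.coords xs) := by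
      rw [h2]; exact Metric.closedBall_mem_nhds _ hρ
    filter_upwards [eventually_mem_extChartAt_source xs rfl, h1.preimage_mem_nhds h3]
      with x hx hx' using ⟨hx, mem_closedBall_zero_iff.1 hx'⟩
  -- the solution in the original variables
  have hmax : ∀ (Ω t₀ r : ℝ) (x₀ : ClosedLoopState n G) (y : ℝ → LocalState n)
      (P : (ℝ → ClosedLoopState n G) → Prop), 0 < Ω → r ≤ m.radius →
      x₀.1 ∈ (extChartAt (𝓡 n) gs).source → y t₀ = m.coords x₀ → Continuous y →
      (∀ t ≥ t₀, ‖y t‖ < r) →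
      (∀ t, ‖y t‖ ≤ r → HasDerivAt y (transformedField m.frame m.output (coordConnection B e)
        (coordDissipation R e) α a lam b kap h (y t) (zeroMeanAntiderivative T u (Ω * t))) t) →
      (∀ x, (∀ t ≥ t₀, changeOfVariables ψ α lam kap e T u Ω t (x t) = m.param (y t)) → P x) →
      MaximalSolutionSatisfies Φ (closedLoopInto L ι B R ψ α a lam b kap h e T u Ω) t₀
        ((changeOfVariables ψ α lam kap e T u Ω t₀).symm x₀) P := by
    intro Ω t₀ r x₀ y P hΩ hr hx₀ hy₀ hyc hyr hyd hP
    -- Solutions live on open intervals, so the domain has to reach slightly below `t₀`; continuity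
    -- keeps the curve in the ball of radius `r` there.
    obtain ⟨ε, hε, hball⟩ := Metric.isOpen_iff.1 (isOpen_lt hyc.norm continuous_const) t₀
      (hyr t₀ le_rfl)
    have hJr : ∀ t ∈ Ioi (t₀ - ε), ‖y t‖ < r := by
      intro t ht
      rcases le_or_gt t₀ t with h1 | h1
      · exact hyr t h1
      · refine hball ?_
        rw [Metric.mem_ball, Real.dist_eq, abs_lt]
        constructor <;> linarith [mem_Ioi.1 ht]
    have hz := isSolutionOn_closedLoopInto (L := L) B R a lam b kap h Ω m hα hu_meas hCu hΩ.ne'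
      isOpen_Ioi ordConnected_Ioi hyc (fun t ht => (hJr t ht).trans_le hr)
      (fun t ht => hyd t (hJr t ht).le)
    have h1 := maximalSolutionSatisfies_of_isSolutionOn (t₀ := t₀) (P := P) hemb.isInducing
      hemb.injective (hlip Ω) hz
      (fun t ht => by rw [mem_Ioi]; linarith [mem_Ici.1 ht]) (fun x hx => hP x fun t ht => by
        rw [hx ht, Equiv.apply_symm_apply])
    rwa [hy₀, m.param_coords hx₀] at h1
  constructor
  · intro ε hε
    obtain ⟨r₁, hr₁, hεr⟩ := hclose ε hε
    -- For stability the confinement to a small ball is enough.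
    obtain ⟨ρ, hρ, _, _, _, _, Ω₀, hΩ₀, hmain⟩ := hsol (min (min r₀ r₁) m.radius)
      (lt_min (lt_min hr₀ hr₁) m.radius_pos) ((min_le_left _ _).trans (min_le_left _ _))
    have hev := hcoords ρ hρ
    rw [hemb.isInducing.nhds_eq_comap, eventually_comap] at hev
    obtain ⟨δ, hδ, hb⟩ := Metric.eventually_nhds_iff.1 hev
    refine ⟨Ω₀, hΩ₀, δ / 2, by positivity, fun Ω hΩ t₀ x₀ hx₀ => ?_⟩
    obtain ⟨hx1, hx2⟩ := @hb (Φ x₀) (by rw [dist_eq_norm]; linarith) x₀ rfl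
    obtain ⟨y, hy0, hyc, hyr, hyd, -⟩ := hmain Ω hΩ t₀ (m.coords x₀) hx2
    refine hmax Ω t₀ _ x₀ y _ (hΩ₀.trans_le hΩ) (min_le_right _ _) hx1 hy0 hyc hyr hyd
      fun x hx t ht => ?_
    rw [hx t ht]
    exact hεr _ ((hyr t ht).trans_le ((min_le_left _ _).trans (min_le_right _ _)))
  · obtain ⟨r₁, hr₁, h1r⟩ := hclose 1 one_pos
    obtain ⟨ρ, hρ, K, hK, k, hk, Ω₀, hΩ₀, hmain⟩ := hsol (min (min r₀ r₁) m.radius)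
      (lt_min (lt_min hr₀ hr₁) m.radius_pos) ((min_le_left _ _).trans (min_le_left _ _))
    -- The neighborhood `S` consists of the points whose coordinates lie in the ball of radius `ρ`.
    -- It is fixed before `ε`, and every solution starting in it stays within ambient distance 1,
    -- the witness for the overshoot bound.
    refine ⟨_, hcoords ρ hρ, fun r _ ε hε => ?_⟩
    obtain ⟨r₂, hr₂, hεr⟩ := hclose ε hε
    -- After time `Δ` the transient, and for large `Ω` the averaging error, are each at most `r₂² /
    -- (4 K)`; together they give `‖y‖² ≤ r₂² / 2 < r₂²`.
    obtain ⟨Δ, hΔ, hΔ'⟩ : ∃ Δ > 0, Real.exp (-k * Δ) * ρ ^ 2 ≤ r₂ ^ 2 / (4 * K) := by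
      have h1 : Tendsto (fun Δ => Real.exp (-k * Δ) * ρ ^ 2) atTop (𝓝 (0 * ρ ^ 2)) := by
        refine Tendsto.mul_const _ (Real.tendsto_exp_atBot.comp ?_)
        exact tendsto_id.const_mul_atTop_of_neg (by linarith)
      rw [zero_mul] at h1
      obtain ⟨Δ, h2, h3⟩ := ((h1.eventually (eventually_le_nhds
        (show 0 < r₂ ^ 2 / (4 * K) by positivity))).and (eventually_gt_atTop 0)).exists
      exact ⟨Δ, h3, h2⟩
    refine ⟨max Ω₀ (4 * K / r₂ ^ 2), hΩ₀.trans_le (le_max_left _ _), Δ, hΔ, 1, one_pos,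
      fun Ω hΩ t₀ x₀ hx₀ _ => ?_⟩
    have hΩ' : Ω₀ ≤ Ω := (le_max_left _ _).trans hΩ
    have hΩpos : 0 < Ω := hΩ₀.trans_le hΩ'
    obtain ⟨y, hy0, hyc, hyr, hyd, hest⟩ := hmain Ω hΩ' t₀ (m.coords x₀) hx₀.2
    refine hmax Ω t₀ _ x₀ y _ hΩpos (min_le_right _ _) hx₀.1 hy0 hyc hyr hyd
      fun x hx => ⟨fun t ht => ?_, fun t ht => ?_⟩
    · rw [hx t ht]
      exact h1r _ ((hyr t ht).trans_le ((min_le_left _ _).trans (min_le_right _ _)))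
    · have ht' : t₀ ≤ t := by linarith
      rw [hx t ht']
      refine hεr _ ?_
      have h1 : 1 / Ω ≤ r₂ ^ 2 / (4 * K) := by
        have h2 : 4 * K / r₂ ^ 2 ≤ Ω := (le_max_right _ _).trans hΩ
        rw [div_le_iff₀ (by positivity)] at h2
        rw [div_le_div_iff₀ hΩpos (by positivity)]
        linarith
      have h3 : Real.exp (-k * (t - t₀)) * ‖m.coords x₀‖ ^ 2 ≤ r₂ ^ 2 / (4 * K) := by
        refine le_trans ?_ hΔ'
        have h4 : -k * (t - t₀) ≤ -k * Δ := by
          have := mul_le_mul_of_nonneg_left (show Δ ≤ t - t₀ by linarith) hk.le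
          linarith
        have h5 := hx₀.2
        gcongr
      have h6 : ‖y t‖ ^ 2 ≤ r₂ ^ 2 / 2 := by
        calc ‖y t‖ ^ 2 ≤ K * (r₂ ^ 2 / (4 * K) + r₂ ^ 2 / (4 * K)) :=
              (hest t ht').trans (by gcongr)
          _ = r₂ ^ 2 / 2 := by field_simp; norm_num
      refine lt_of_pow_lt_pow_left₀ 2 hr₂.le (h6.trans_lt ?_)
      have : 0 < r₂ ^ 2 := by positivity
      linarith

end Stability

/-- The linear isomorphism onto the ambient space of the state manifold. -/
def ambientPointL (n N : ℕ) : (EuclideanSpace ℝ (Fin N) × EuclideanSpace ℝ (Fin N) ×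
    EuclideanSpace ℝ (Fin n) × ℝ) ≃L[ℝ] AmbientSpace n N :=
  ((ContinuousLinearEquiv.refl ℝ _).prodCongr (((ContinuousLinearEquiv.refl ℝ _).prodCongr
    (WithLp.prodContinuousLinearEquiv 2 ℝ _ _).symm).trans
      (WithLp.prodContinuousLinearEquiv 2 ℝ _ _).symm)).trans
        (WithLp.prodContinuousLinearEquiv 2 ℝ _ _).symm

end

theorem theorem1
    -- the Lie group, a closed embedded submanifold of a Euclidean space
    {n N : ℕ} {G : Type*} [TopologicalSpace G] [ChartedSpace (EuclideanSpace ℝ (Fin n)) G]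
    [Group G] [LieGroup (𝓡 n) ∞ G]
    (ι : G → EuclideanSpace ℝ (Fin N)) (hι : Manifold.IsSmoothEmbedding (𝓡 n) (𝓡 N) ∞ ι)
    (hι_closed : IsClosed (Set.range ι))
    -- the inner product, the dissipation and the objective function
    (B : InnerProd (GroupLieAlgebra (𝓡 n) G))
    (R : GroupLieAlgebra (𝓡 n) G →ₗ[ℝ] GroupLieAlgebra (𝓡 n) G)
    (hR_symm : ∀ v w, B.form (R v) w = B.form v (R w)) (hR_nonneg : ∀ v, 0 ≤ B.form (R v) v)
    (ψ : G → ℝ) (hψ : ContMDiff (𝓡 n) 𝓘(ℝ, ℝ) ∞ ψ)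
    -- the perturbation signals
    (T : ℝ) (hT : 0 < T) (u : ℝ → EuclideanSpace ℝ (Fin n)) (hu_meas : Measurable u)
    (hu_bdd : ∃ C, ∀ τ, ‖u τ‖ ≤ C) (hu_per : Function.Periodic u T)
    (hu_mean : ∫ τ in (0 : ℝ)..T, u τ = 0)
    (hU : ∀ i j, T⁻¹ * (∫ τ in (0 : ℝ)..T,
      zeroMeanAntiderivative T u τ i * zeroMeanAntiderivative T u τ j) = if i = j then 1 else 0)
    -- the design function and the gains
    (α : ℝ → ℝ) (hα : ContDiff ℝ ∞ α) (hα_mono : StrictMono fun z => α z * deriv α z)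
    (hα_pos : ∀ z, 0 < α z * deriv α z)
    (a lam b kap h : ℝ) (ha : 0 < a) (hlam : 0 < lam) (hb : 0 < b) (hkap : 0 < kap) (hh : 0 < h)
    (hgains : 0 < a * lam - b * kap)
    -- the orthonormal basis of the Lie algebra
    (e : Module.Basis (Fin n) ℝ (GroupLieAlgebra (𝓡 n) G))
    (he : ∀ i j, B.form (e i) (e j) = if i = j then 1 else 0)
    -- the minimizer
    (gs : G) (hmin : IsLocalMin ψ gs)
    (hHess : ∀ X : TangentSpace (𝓡 n) gs, X ≠ 0 → 0 < hessian B ψ gs X X) :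
    LocallyPracticallyUniformlyAsymptoticallyStable (stateEmbedding ι)
      (closedLoop ι B R ψ α a lam b kap h e T u)
      (changeOfVariables ψ α lam kap e T u)
      ((gs, 0, 0, ψ gs) : ClosedLoopState n G) := by
  have hL : Function.Injective (ambientPointL n N).toContinuousLinearMap :=
    (ambientPointL n N).injective
  -- `ambientPoint` is by definition `ambientPointL` applied to a tuple, so the embedding and the
  -- closed loop agree definitionally with their `Into` versions.
  exact locallyPracticallyUniformlyAsymptoticallyStable_closedLoopInto hL hι B R hR_nonneg hψ hT
    hu_meas hu_bdd hu_per hu_mean hU hα (hα_pos 0) ha hlam hb hkap hh hgains he hmin hHess
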